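/- **Model.** Let $M,K,L\ge 1$ and $N_u$ be integers. A base station with $M$ antennas serves $K$ single-antenna users over channels with $L$ taps. In one coherence interval with $N_u$ uplink channel uses: - $h_{mk}[l]\sim\mathcal{CN}(0,\sigma_{hkl}^2)$ are the channel gains, with $\sigma_{hkl}>0$ ($1\le m\le M$, $1\le k\le K$, $0\le l\le L-1$); - $w_m[t]\sim\mathcal{CN}(0,\sigma^2)$ is the receiver noise, with $\sigma^2>0$ ($0\le t<N_u$); - $x_k[t]\sim\mathcal{CN}(0,1)$ are the symbols of the preamble, data and postamble phases ($KL\le t<N_u$); - all these variables are mutually independent, and jointly independent of the carrier frequency offsets (CFOs) and their estimates $(\omega_k,\widehat\omega_k)_k$; - $\Delta\omega_k=\widehat\omega_k-\omega_k\sim\mathcal N(0,\sigma_{\omega_k}^2)$ is the residual CFO, with $\sigma_{\omega_k}^2\ge 0$ an arbitrary parameter. With transmit power $p_u>0$, the received pilot of user $k$ is $r_m[(k-1)L+l]=\sqrt{KLp_u}\,h_{mk}[l]e^{j\omega_k((k-1)L+l)}+w_m[(k-1)L+l]$, and the channel estimate is $\widehat h_{mk}[l]=\frac{1}{\sqrt{KLp_u}}r_m[(k-1)L+l]e^{-j\widehat\omega_k((k-1)L+l)}$.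 During and after the data phase the received signal is $$r_m[t]=\sqrt{p_u}\sum_{q=1}^K\sum_{l=0}^{L-1}h_{mq}[l]x_q[t-l]e^{j\omega_q t}+w_m[t].$$ The output of the time-reversal maximum-ratio-combining (TR-MRC) receiver is $$\widehat x_k[t]=\sum_{m=1}^M\sum_{l=0}^{L-1}\widehat h_{mk}^*[l]\,r_m[t+l]\,e^{-j\widehat\omega_k(t+l)},$$ for the data times $KL+L-1\le t\le N_u-L$. Put $\tau_{k,t}=t-(k-1)L$, $\widetilde h_{mk}[l]=h_{mk}[l]e^{-j\Delta\omega_k((k-1)L+l)}$, $A_k[t]=\sqrt{p_u}\sum_{m,l}|\widetilde h_{mk}[l]|^2e^{-j\Delta\omega_k\tau_{k,t}}$, and - $\mathrm{ES}_k[t]=\mathbb E[A_k[t]]\,x_k[t]$ and $\mathrm{SIF}_k[t]=(A_k[t]-\mathbb E[A_k[t]])\,x_k[t]$ (effective signal and self-interference); - $\mathrm{ISI}_k[t]=\sqrt{p_u}\sum_{m}\sum_{l}\sum_{l'\ne l}\widetilde h_{mk}^*[l]\widetilde h_{mk}[l']x_k[t-l'+l]e^{-j\Delta\omega_k\tau_{k,t}}e^{-j\Delta\omega_k(l-l')}$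 (inter-symbol interference); - $\mathrm{MUI}_k[t]=\sqrt{p_u}\sum_{m}\sum_{l}\sum_{q\ne k}\sum_{l'}\widetilde h_{mk}^*[l]\widetilde h_{mq}[l']x_q[t-l'+l]e^{j((\widehat\omega_q-\widehat\omega_k)(t+l)-\Delta\omega_q(t-(q-1)L+l-l'))}$ (multi-user interference); - $\mathrm{EN}_k[t]=\widehat x_k[t]-A_k[t]x_k[t]-\mathrm{ISI}_k[t]-\mathrm{MUI}_k[t]$ (effective noise); - $W_k[t]=\mathrm{SIF}_k[t]+\mathrm{ISI}_k[t]+\mathrm{MUI}_k[t]+\mathrm{EN}_k[t]$. Let $\theta_k=\sum_l\sigma_{hkl}^2$, $\gamma_k=p_u\theta_k/\sigma^2$, $c_1=1+\frac{\sum_q\theta_q}{K\theta_k}$, $c_2=\frac{1}{\theta_k}\sum_q\theta_q$ and $d_k[t]=e^{-\sigma_{\omega_k}^2(t-(k-1)L)^2}$. **Claim.** For every user $k$ and every data time $t$: 1. $\widehat x_k[t]=\mathrm{ES}_k[t]+W_k[t]$. The variables $\mathrm{ES}_k[t],\mathrm{SIF}_k[t],\mathrm{ISI}_k[t],\mathrm{MUI}_k[t],\mathrm{EN}_k[t]$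 are square integrable, have mean zero, and are pairwise uncorrelated. 2. Their variances are $$\mathbb E|\mathrm{ES}_k[t]|^2=M^2p_u\theta_k^2d_k[t],\qquad \mathbb E|\mathrm{SIF}_k[t]|^2=M^2p_u\theta_k^2(1-d_k[t])+Mp_u\sum_l\sigma_{hkl}^4,$$ $$\mathbb E|\mathrm{ISI}_k[t]|^2=Mp_u\Big(\theta_k^2-\sum_l\sigma_{hkl}^4\Big),\qquad \mathbb E|\mathrm{MUI}_k[t]|^2=Mp_u\theta_k\sum_{q\ne k}\theta_q,$$ $$\mathbb E|\mathrm{EN}_k[t]|^2=\frac{M\sigma^2}{K}\sum_q\theta_q+\frac{M\sigma^4}{Kp_u}+M\sigma^2\theta_k,$$ and $\mathbb E|W_k[t]|^2$ is the sum of the last four. 3. $$\mathrm{SINR}_k[t]:=\frac{\mathbb E|\mathrm{ES}_k[t]|^2}{\mathbb E|W_k[t]|^2}=\frac{d_k[t]}{(1-d_k[t])+\frac{1}{MK\gamma_k^2}+\frac{c_1}{M\gamma_k}+\frac{c_2}{M}}.$$ 4. The mutual information in bits satisfies $I(\widehat x_k[t];x_k[t])\ge\log_2(1+\mathrm{SINR}_k[t])$.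 Moreover the rates $I_k=\frac{1}{N_u}\sum_{t=KL+L-1}^{N_u-L}\log_2(1+\mathrm{SINR}_k[t])$, $k=1,\dots,K$, are simultaneously achievable in the following sense. For every $\varepsilon>0$ and all sufficiently large $n$ there are codes over $n$ independent, identically distributed coherence intervals, one code for each user $k$ and data time $t$, such that: - the codeword for $(k,t)$ supplies the symbol $x_k[t]$ of each of the $n$ intervals, and every codeword has average power at most $1$ (preamble and postamble symbols stay random); - the message for $(k,t)$ is decoded from the $n$ outputs $\widehat x_k[t]$ alone; - for independent uniform messages, the probability that any message is decoded wrongly is at most $\varepsilon$; - for every user $k$, the total number of message bits divided by $nN_u$ is at least $I_k-\varepsilon$. -/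

import Mathlib

namespace TRMRC

open MeasureTheory ProbabilityTheory

noncomputable section

/-- The circularly symmetric complex Gaussian law `CN(0, v)`: real and imaginary parts are
independent `N(0, v/2)`. -/
def complexGaussian (v : NNReal) : Measure ℂ :=
  ((gaussianReal 0 (v / 2)).prod (gaussianReal 0 (v / 2))).map
    (fun z : ℝ × ℝ => (z.1 : ℂ) + (z.2 : ℂ) * Complex.I)

/-- Mutual information in bits: the Kullback-Leibler divergence of the joint law from the product
of the marginal laws, divided by `log 2`. -/
def mutualInfoBits {Ω : Type*} [MeasurableSpace Ω] (P : Measure Ω) (X Y : Ω → ℂ) : ENNReal :=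
  InformationTheory.klDiv (P.map (fun a => (X a, Y a))) ((P.map X).prod (P.map Y)) /
    ENNReal.ofReal (Real.log 2)

/-- `e^{jθ}`. -/
def phase (θ : ℝ) : ℂ := Complex.exp (Complex.I * (θ : ℂ))

/-- Deterministic system parameters for `K` users and `L` taps. Users and taps are indexed from
`0`, so user `k : Fin K` sends its channel-estimation pilot at time `k * L`. -/
structure Params (K L : ℕ) where
  /-- average transmit power `p_u` -/
  pu : ℝ
  pu_pos : 0 < pu
  /-- noise power `σ²` -/
  noiseVar : NNReal
  noiseVar_pos : 0 < noiseVar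
  /-- power delay profile `σ_{hkl}²` -/
  pdp : Fin K → Fin L → NNReal
  pdp_pos : ∀ k l, 0 < pdp k l
  /-- mean squared error `σ_{ω_k}²` of the CFO estimate -/
  cfoVar : Fin K → NNReal

/-- Times of data transmission `KL + L - 1, …, N_u - L`. -/
def dataTimes (K L Nu : ℕ) : Finset ℕ := Finset.Icc (K * L + L - 1) (Nu - L)

/-- Everything that is realized in one coherence interval: channel gains `h_{mk}[l]`, receiver
noise `w_m[t]`, CFOs `ω_k`, CFO estimates, and the unit-power symbols `x_k[t]`. -/
structure Realization (M K L : ℕ) where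
  h : Fin M → Fin K → Fin L → ℂ
  w : Fin M → ℕ → ℂ
  cfo : Fin K → ℝ
  cfoHat : Fin K → ℝ
  x : Fin K → ℕ → ℂ

namespace Realization

variable {M K L : ℕ} (S : Realization M K L) (par : Params K L)

/-- Residual CFO `Δω_k`. -/
def cfoErr (k : Fin K) : ℝ := S.cfoHat k - S.cfo k

/-- Received pilot of user `k` at antenna `m` at time `k * L + l`. -/
def pilotRx (m : Fin M) (k : Fin K) (l : Fin L) : ℂ :=
  (Real.sqrt (K * L * par.pu) : ℂ) * S.h m k l *
      phase (S.cfo k * ((k : ℝ) * L + (l : ℝ))) + S.w m ((k : ℕ) * L + l)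

/-- Channel estimate from the CFO-compensated pilot. -/
def chanEst (m : Fin M) (k : Fin K) (l : Fin L) : ℂ :=
  (1 / (Real.sqrt (K * L * par.pu) : ℂ)) * S.pilotRx par m k l *
    phase (-(S.cfoHat k * ((k : ℝ) * L + (l : ℝ))))

/-- Received signal at antenna `m` at time `t`, during data transmission. -/
def dataRx (m : Fin M) (t : ℕ) : ℂ :=
  (Real.sqrt par.pu : ℂ) * ∑ q : Fin K, ∑ l : Fin L,
      S.h m q l * S.x q (t - l) * phase (S.cfo q * (t : ℝ)) + S.w m t

/-- Output of the TR-MRC receiver for user `k` at time `t`. -/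
def output (k : Fin K) (t : ℕ) : ℂ :=
  ∑ m : Fin M, ∑ l : Fin L, (starRingEnd ℂ) (S.chanEst par m k l) *
    (S.dataRx par m (t + l) * phase (-(S.cfoHat k * ((t : ℝ) + (l : ℝ)))))

/-- Effective channel gain: `h` rotated by the residual CFO. -/
def hEff (m : Fin M) (k : Fin K) (l : Fin L) : ℂ :=
  S.h m k l * phase (-(S.cfoErr k * ((k : ℝ) * L + (l : ℝ))))

/-- The random gain `A_k[t]` of the desired symbol. -/
def gain (k : Fin K) (t : ℕ) : ℂ :=
  (Real.sqrt par.pu : ℂ) * ∑ m : Fin M, ∑ l : Fin L,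
    ((‖S.hEff m k l‖ ^ 2 : ℝ) : ℂ) * phase (-(S.cfoErr k * ((t : ℝ) - (k : ℝ) * L)))

/-- Inter-symbol interference. -/
def isi (k : Fin K) (t : ℕ) : ℂ :=
  (Real.sqrt par.pu : ℂ) * ∑ m : Fin M, ∑ l : Fin L, ∑ l' ∈ Finset.univ.erase l,
    (starRingEnd ℂ) (S.hEff m k l) * S.hEff m k l' * S.x k (t + l - l') *
      phase (-(S.cfoErr k * ((t : ℝ) - (k : ℝ) * L))) *
      phase (-(S.cfoErr k * ((l : ℝ) - (l' : ℝ))))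

/-- Multi-user interference. -/
def mui (k : Fin K) (t : ℕ) : ℂ :=
  (Real.sqrt par.pu : ℂ) * ∑ m : Fin M, ∑ l : Fin L, ∑ q ∈ Finset.univ.erase k, ∑ l' : Fin L,
    (starRingEnd ℂ) (S.hEff m k l) * S.hEff m q l' * S.x q (t + l - l') *
      phase ((S.cfoHat q - S.cfoHat k) * ((t : ℝ) + (l : ℝ)) -
        S.cfoErr q * ((t : ℝ) - (q : ℝ) * L + ((l : ℝ) - (l' : ℝ))))

/-- Effective noise: what remains of the output. -/
def en (k : Fin K) (t : ℕ) : ℂ :=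
  S.output par k t - S.gain par k t * S.x k t - S.isi par k t - S.mui par k t

end Realization

/-- The random model of one coherence interval of `Nu` uplink channel uses. The symbols
`x_k[s]`, `K * L ≤ s < Nu`, are those of the preamble, the data phase and the postamble.
All gains, noise samples and symbols are mutually independent, and jointly independent
of the CFOs and their estimates. -/
structure Model (M K L Nu : ℕ) (par : Params K L) {Ω : Type*} [MeasurableSpace Ω]
    (P : Measure Ω) where
  h : Fin M → Fin K → Fin L → Ω → ℂ
  w : Fin M → ℕ → Ω → ℂ
  x : Fin K → ℕ → Ω → ℂ
  cfo : Fin K → Ω → ℝ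
  cfoHat : Fin K → Ω → ℝ
  measurable_h : ∀ m k l, Measurable (h m k l)
  measurable_w : ∀ m s, Measurable (w m s)
  measurable_x : ∀ k s, Measurable (x k s)
  measurable_cfo : ∀ k, Measurable (cfo k)
  measurable_cfoHat : ∀ k, Measurable (cfoHat k)
  law_h : ∀ m k l, P.map (h m k l) = complexGaussian (par.pdp k l)
  law_w : ∀ m s, s < Nu → P.map (w m s) = complexGaussian par.noiseVar
  law_x : ∀ k s, K * L ≤ s → s < Nu → P.map (x k s) = complexGaussian 1
  law_cfoErr : ∀ k, P.map (fun a => cfoHat k a - cfo k a) = gaussianReal 0 (par.cfoVar k)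
  indep : iIndepFun
    (fun i : (Fin M × Fin K × Fin L) ⊕ (Fin M × Fin Nu) ⊕ (Fin K × Set.Ico (K * L) Nu) =>
      (Sum.elim (fun j => h j.1 j.2.1 j.2.2)
        (Sum.elim (fun j => w j.1 j.2) (fun j => x j.1 j.2)) i : Ω → ℂ)) P
  indep_cfo : IndepFun (fun a => fun k => (cfo k a, cfoHat k a))
    (fun a => fun i : (Fin M × Fin K × Fin L) ⊕ (Fin M × Fin Nu) ⊕
        (Fin K × Set.Ico (K * L) Nu) =>
      (Sum.elim (fun j => h j.1 j.2.1 j.2.2)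
        (Sum.elim (fun j => w j.1 j.2) (fun j => x j.1 j.2)) i : Ω → ℂ) a) P

namespace Params

variable {K L : ℕ} (par : Params K L)

/-- `θ_k = ∑_l σ_{hkl}²`. -/
def theta (k : Fin K) : ℝ := ∑ l, (par.pdp k l : ℝ)

/-- Received SNR `γ_k`. -/
def gamma (k : Fin K) : ℝ := par.pu / par.noiseVar * par.theta k

def c1 (k : Fin K) : ℝ := 1 + (∑ q, par.theta q) / (K * par.theta k)

def c2 (k : Fin K) : ℝ := 1 / par.theta k * ∑ q, par.theta q

/-- `e^{-σ_{ω_k}² (t - (k-1)L)²}` in one-based user numbering. -/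
def decay (k : Fin K) (t : ℕ) : ℝ :=
  Real.exp (-((par.cfoVar k : ℝ) * ((t : ℝ) - (k : ℝ) * L) ^ 2))

/-- The closed form of the SINR. -/
def sinrFormula (M : ℕ) (k : Fin K) (t : ℕ) : ℝ :=
  par.decay k t /
    ((1 - par.decay k t) + 1 / (M * K * par.gamma k ^ 2) + par.c1 k / (M * par.gamma k) +
      par.c2 k / M)

/-- The per-user information rate `I_k` in bits per channel use. -/
def infoRate (M Nu : ℕ) (k : Fin K) : ℝ :=
  1 / (Nu : ℝ) * ∑ t ∈ dataTimes K L Nu, Real.logb 2 (1 + par.sinrFormula M k t)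

end Params

/-- The components of the receiver output: effective signal, self-interference, inter-symbol
interference, multi-user interference, effective noise. -/
inductive Component where
  | ES
  | SIF
  | ISI
  | MUI
  | EN

/-- The table of the variances of the components. -/
def tableVariance {K L : ℕ} (par : Params K L) (M : ℕ) (k : Fin K) (t : ℕ) : Component → ℝ
  | .ES => (M : ℝ) ^ 2 * par.pu * par.theta k ^ 2 * par.decay k t
  | .SIF => (M : ℝ) ^ 2 * par.pu * par.theta k ^ 2 * (1 - par.decay k t) +
      M * par.pu * ∑ l, (par.pdp k l : ℝ) ^ 2
  | .ISI => M * par.pu * (par.theta k ^ 2 - ∑ l, (par.pdp k l : ℝ) ^ 2)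
  | .MUI => M * par.pu * par.theta k * ∑ q ∈ Finset.univ.erase k, par.theta q
  | .EN => M * (par.noiseVar : ℝ) / K * (∑ q, par.theta q) +
      M * (par.noiseVar : ℝ) ^ 2 / (K * par.pu) + M * (par.noiseVar : ℝ) * par.theta k

namespace Model

variable {M K L Nu : ℕ} {par : Params K L} {Ω : Type*} [MeasurableSpace Ω] {P : Measure Ω}
  (U : Model M K L Nu par P)

/-- The realization at a sample point. -/
def realization (a : Ω) : Realization M K L where
  h := fun m k l => U.h m k l a
  w := fun m s => U.w m s a
  cfo := fun k => U.cfo k a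
  cfoHat := fun k => U.cfoHat k a
  x := fun k s => U.x k s a

/-- TR-MRC output as a random variable. -/
def output (k : Fin K) (t : ℕ) (a : Ω) : ℂ := (U.realization a).output par k t

/-- `E[A_k[t]]`. -/
def meanGain (k : Fin K) (t : ℕ) : ℂ := ∫ a, (U.realization a).gain par k t ∂P

/-- The components of the output as random variables. -/
def component (k : Fin K) (t : ℕ) : Component → Ω → ℂ
  | .ES => fun a => U.meanGain k t * U.x k t a
  | .SIF => fun a => ((U.realization a).gain par k t - U.meanGain k t) * U.x k t a
  | .ISI => fun a => (U.realization a).isi par k t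
  | .MUI => fun a => (U.realization a).mui par k t
  | .EN => fun a => (U.realization a).en par k t

/-- The overall noise and interference `W_k[t]`. -/
def totalNoise (k : Fin K) (t : ℕ) (a : Ω) : ℂ :=
  U.component k t .SIF a + U.component k t .ISI a + U.component k t .MUI a +
    U.component k t .EN a

/-- `SINR_k[t] = E[|ES_k[t]|²] / E[|W_k[t]|²]`. -/
def sinr (k : Fin K) (t : ℕ) : ℝ :=
  (∫ a, ‖U.component k t .ES a‖ ^ 2 ∂P) / ∫ a, ‖U.totalNoise k t a‖ ^ 2 ∂P

end Model

/-- A coding scheme over `n` coherence intervals, with one code for each user `q` and each data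
time `t`. The code for `(q, t)` has `size q t` messages, its codewords have one symbol per
coherence interval (sent at time `t` of that interval), and it is decoded from the `n` receiver
outputs for user `q` at time `t`. Codewords have average power at most `1`. -/
structure Code (K L Nu n : ℕ) where
  size : Fin K → dataTimes K L Nu → ℕ
  size_pos : ∀ q t, 0 < size q t
  enc : (q : Fin K) → (t : dataTimes K L Nu) → Fin (size q t) → Fin n → ℂ
  power_le : ∀ q t m, ∑ i, ‖enc q t m i‖ ^ 2 ≤ (n : ℝ)
  dec : (q : Fin K) → (t : dataTimes K L Nu) → (Fin n → ℂ) → Fin (size q t)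
  measurable_dec : ∀ q t, Measurable (dec q t)

namespace Code

variable {M K L Nu n : ℕ} {par : Params K L} (C : Code K L Nu n)

/-- A choice of one message for every user and every data time. -/
abbrev Messages : Type := (q : Fin K) → (t : dataTimes K L Nu) → Fin (C.size q t)

/-- Rate of user `q` in bits per channel use: all its bits, divided by the `n * Nu` uplink
channel uses. -/
def rate (q : Fin K) : ℝ := (∑ t, Real.logb 2 (C.size q t)) / (n * Nu)

variable {Ω : Type*} [MeasurableSpace Ω] {P : Measure Ω} (U : Model M K L Nu par P)

/-- Coherence interval `i` when the messages `msg` are sent: data symbols come from the codewords,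
everything else (preamble and postamble symbols, channel, noise, CFOs) from the model. -/
def codedRealization (msg : C.Messages) (i : Fin n) (a : Ω) : Realization M K L :=
  { U.realization a with
    x := fun q s => if hs : s ∈ dataTimes K L Nu then C.enc q ⟨s, hs⟩ (msg q ⟨s, hs⟩) i
      else U.x q s a }

/-- Probability that some message is decoded wrongly, for independent uniform messages and
independent, identically distributed coherence intervals. -/
def errorProb [IsProbabilityMeasure P] : ℝ :=
  (∑ msg : C.Messages, (Measure.pi (fun _ : Fin n => P)).real
    {a : Fin n → Ω | ∃ (q : Fin K) (t : dataTimes K L Nu),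
      C.dec q t (fun i => (C.codedRealization U msg i (a i)).output par q t) ≠ msg q t}) /
    (Fintype.card C.Messages : ℝ)

end Code

/-- The rate tuple `R` (bits per channel use) is achievable, simultaneously by all users, under the
average power constraint, with TR-MRC and separate coding across coherence intervals for every
user and data time. -/
def IsAchievable {M K L Nu : ℕ} {par : Params K L} {Ω : Type*} [MeasurableSpace Ω]
    {P : Measure Ω} [IsProbabilityMeasure P] (U : Model M K L Nu par P) (R : Fin K → ℝ) : Prop :=
  ∀ ε : ℝ, 0 < ε → ∃ n₀ : ℕ, ∀ n : ℕ, n₀ ≤ n → ∃ C : Code K L Nu n,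
    (∀ q, R q - ε ≤ C.rate q) ∧ C.errorProb U ≤ ε

end

end TRMRC

namespace TRMRC

open MeasureTheory ProbabilityTheory

noncomputable section

set_option linter.unusedSectionVars false
set_option linter.unusedSimpArgs false

/-! Moments. Expanding the receiver output gives a finite sum of terms, each a phase depending only
on the CFOs times a product of two or three Gaussian variables. Every Gaussian law is invariant
under a change of sign, independently of the others, so a product of terms in which some variable
occurs to an odd total degree has mean zero. Apart from the terms |h|² x of the desired symbol, each
term is a product of distinct variables, and the set of its variables determines the term
(`Term.supp_injective`). Hence these terms are pairwise orthogonal (`IsMono.integral_mul_conj`),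
phases drop out of their second moments, and the variances of ISI, MUI and EN are sums of products
of variances. The remaining terms add up to A x, with A a phase times a sum of |h|². Here ES is the
projection of A x on x, and Pythagoras gives the power of SIF from the fourth moments of the gains
(`integral_ES_mul_conj_SIF`).

Information. Let f be the log-likelihood ratio of the Gaussian channel y = a x + n, where a is the
mean gain and n has the power v of the total noise. For every fixed y, exp f has mean 1 over a
Gaussian x (`lintegral_exp_infoDensity`), whatever the law of y. The mean of f under the true joint
law involves only the second moments of y and y - a x, and equals log(1 + SINR). The
Donsker–Varadhan inequality turns these two facts into the bound on mutual information, although the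
true noise is neither Gaussian nor independent of x.

Coding. The same two facts serve a random Gaussian codebook with threshold decoding by the score f.
The law of large numbers puts the score of the sent codeword above the threshold, and Chernoff's
bound with mean exp f equal to 1 makes each wrong codeword exponentially unlikely to pass it. A
union bound over the finitely many slots and an average over codebooks give one good family of codes
(`exists_code`). For the power constraint, codewords are multiplied by some s < 1 before
transmission, while the decoder keeps the original metric and the unscaled codebook. The output is
affine in the data symbols, so the mean score is continuous in s and little is lost as s tends to 1
(`tendsto_integral_metric`). -/

instance (v : NNReal) : IsProbabilityMeasure (complexGaussian v) := by
  unfold complexGaussian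
  exact Measure.isProbabilityMeasure_map (by fun_prop)

/-! ### Moments of complex Gaussian variables -/

theorem measurePreserving_complexGaussian (v : NNReal) :
    MeasurePreserving (fun z : ℝ × ℝ => (z.1 : ℂ) + (z.2 : ℂ) * Complex.I)
      ((gaussianReal 0 (v / 2)).prod (gaussianReal 0 (v / 2))) (complexGaussian v) :=
  ⟨by fun_prop, rfl⟩

/-- This symmetry is the only source of the vanishing correlations between different terms of the
output. -/
theorem measurePreserving_neg_complexGaussian (v : NNReal) :
    MeasurePreserving (fun z : ℂ => -z) (complexGaussian v) (complexGaussian v) := by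
  refine ⟨by fun_prop, ?_⟩
  have h : MeasurePreserving (fun x : ℝ => -x) (gaussianReal 0 (v / 2)) (gaussianReal 0 (v / 2)) :=
    ⟨by fun_prop, by simp [gaussianReal_map_neg]⟩
  conv_rhs => rw [complexGaussian, ← (h.prod h).map_eq]
  rw [complexGaussian, Measure.map_map (by fun_prop) (by fun_prop),
    Measure.map_map (by fun_prop) (by fun_prop)]
  congr 1
  ext z
  simp [Prod.map]
  ring

theorem norm_sq_add_mul_I (x y : ℝ) : ‖(x : ℂ) + y * Complex.I‖ ^ 2 = x ^ 2 + y ^ 2 := by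
  rw [Complex.sq_norm, Complex.normSq_add_mul_I]

theorem integrable_pow_gaussianReal (v : NNReal) (n : ℕ) :
    Integrable (fun x : ℝ => x ^ n) (gaussianReal 0 v) := by
  rcases Nat.eq_zero_or_pos n with rfl | hn
  · simp
  · have := (memLp_id_gaussianReal (μ := 0) (v := v) (n : NNReal)).integrable_norm_pow
      (by exact_mod_cast hn.ne')
    refine this.mono' (by fun_prop) (Filter.Eventually.of_forall fun x => by simp)

theorem integral_sq_gaussianReal (v : NNReal) : ∫ x, x ^ 2 ∂(gaussianReal 0 v) = v := by
  have h := variance_id_gaussianReal (μ := 0) (v := v)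
  rw [variance_eq_integral (by fun_prop)] at h
  simpa using h

/-- The sum of two independent copies has the law of √2 times one copy. Comparing fourth moments m
on both sides gives 4m = 2m + 6v². -/
theorem integral_pow_four_gaussianReal (v : NNReal) :
    ∫ x, x ^ 4 ∂(gaussianReal 0 v) = 3 * (v : ℝ) ^ 2 := by
  have hconv := gaussianReal_conv_gaussianReal (m₁ := 0) (m₂ := 0) (v₁ := v) (v₂ := v)
  have hdil := gaussianReal_map_const_mul (μ := 0) (v := v) (Real.sqrt 2)
  have hv : (⟨Real.sqrt 2 ^ 2, sq_nonneg (Real.sqrt 2)⟩ : {r : ℝ // 0 ≤ r}) = (2 : NNReal) := by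
    ext; simp
  rw [show NNReal.mk (Real.sqrt 2 ^ 2) (sq_nonneg _) = (2 : NNReal) from hv, two_mul v, mul_zero] at hdil
  rw [add_zero] at hconv
  have h2 : ∫ x, x ^ 4 ∂(gaussianReal 0 (v + v)) = 4 * ∫ x, x ^ 4 ∂(gaussianReal 0 v) := by
    rw [← hdil, integral_map (by fun_prop) (by fun_prop), ← integral_const_mul]
    congr with x
    have : Real.sqrt 2 ^ 4 = 4 := by
      rw [show 4 = 2 * 2 from rfl, pow_mul, Real.sq_sqrt (by norm_num)]; norm_num
    rw [mul_pow, this]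
  have h3 : ∫ x, x ^ 4 ∂(gaussianReal 0 (v + v)) =
      2 * (∫ x, x ^ 4 ∂(gaussianReal 0 v)) + 6 * (v : ℝ) ^ 2 := by
    rw [← hconv, Measure.conv, integral_map (by fun_prop) (by fun_prop)]
    have e : ∀ z : ℝ × ℝ, (z.1 + z.2) ^ 4 = z.1 ^ 4 * z.2 ^ 0 + 4 * (z.1 ^ 3 * z.2 ^ 1) +
      6 * (z.1 ^ 2 * z.2 ^ 2) + 4 * (z.1 ^ 1 * z.2 ^ 3) + z.1 ^ 0 * z.2 ^ 4 := fun z => by ring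
    have hi : ∀ i j : ℕ, Integrable (fun z : ℝ × ℝ => z.1 ^ i * z.2 ^ j)
        ((gaussianReal 0 v).prod (gaussianReal 0 v)) := fun i j =>
      (integrable_pow_gaussianReal v i).mul_prod (integrable_pow_gaussianReal v j)
    have hp : ∀ i j : ℕ, ∫ z : ℝ × ℝ, z.1 ^ i * z.2 ^ j
        ∂((gaussianReal 0 v).prod (gaussianReal 0 v)) =
          (∫ x, x ^ i ∂(gaussianReal 0 v)) * ∫ x, x ^ j ∂(gaussianReal 0 v) := fun i j =>
      integral_prod_mul (fun x : ℝ => x ^ i) (fun x : ℝ => x ^ j)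
    have h1 : ∫ x, x ^ 1 ∂(gaussianReal 0 v) = 0 := by simp
    have h0 : ∫ x, x ^ 0 ∂(gaussianReal 0 v) = 1 := by simp
    simp_rw [e]
    have i1 := (hi 4 0).fun_add ((hi 3 1).const_mul 4)
    have i2 := i1.fun_add ((hi 2 2).const_mul 6)
    have i3 := i2.fun_add ((hi 1 3).const_mul 4)
    rw [integral_add i3 (hi 0 4), integral_add i2 ((hi 1 3).const_mul 4),
      integral_add i1 ((hi 2 2).const_mul 6), integral_add (hi 4 0) ((hi 3 1).const_mul 4)]
    simp only [integral_const_mul, hp, h0, h1, integral_sq_gaussianReal]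
    ring
  linarith

theorem integrable_norm_pow_complexGaussian (v : NNReal) (n : ℕ) :
    Integrable (fun z : ℂ => ‖z‖ ^ n) (complexGaussian v) := by
  rw [← (measurePreserving_complexGaussian v).integrable_comp (by fun_prop)]
  have hi := ((integrable_pow_gaussianReal (v / 2) n).norm.mul_prod
    (integrable_pow_gaussianReal (v / 2) 0).norm).add
    (((integrable_pow_gaussianReal (v / 2) 0).norm.mul_prod
      (integrable_pow_gaussianReal (v / 2) n).norm))
  -- The constant is that of the convexity bound (a + b)^n ≤ 2^(n-1) (a^n + b^n).
  refine (hi.const_mul (2 ^ (n - 1))).mono' (by fun_prop) (Filter.Eventually.of_forall fun z => ?_)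
  have hz : ‖(z.1 : ℂ) + z.2 * Complex.I‖ ≤ ‖z.1‖ + ‖z.2‖ :=
    (norm_add_le _ _).trans (by simp)
  simp only [Function.comp_apply, norm_pow, norm_norm, Pi.add_apply, pow_zero, norm_one, mul_one,
    one_mul]
  exact (pow_le_pow_left₀ (norm_nonneg _) hz n).trans
    (add_pow_le (norm_nonneg _) (norm_nonneg _) n)

theorem integral_norm_sq_complexGaussian (v : NNReal) :
    ∫ z, ‖z‖ ^ 2 ∂(complexGaussian v) = v := by
  rw [← (measurePreserving_complexGaussian v).map_eq, integral_map (by fun_prop) (by fun_prop)]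
  simp_rw [norm_sq_add_mul_I]
  have h := integrable_pow_gaussianReal (v / 2) 2
  rw [integral_add (h.comp_fst _) (h.comp_snd _)]
  rw [integral_fun_fst (fun x : ℝ => x ^ 2), integral_fun_snd (fun x : ℝ => x ^ 2)]
  simp [integral_sq_gaussianReal]

/-- The excess of this value over the squared variance v² is what produces the sum of the σ⁴ in the
power of the self-interference. -/
theorem integral_norm_pow_four_complexGaussian (v : NNReal) :
    ∫ z, ‖z‖ ^ 4 ∂(complexGaussian v) = 2 * (v : ℝ) ^ 2 := by
  rw [← (measurePreserving_complexGaussian v).map_eq, integral_map (by fun_prop) (by fun_prop)]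
  have e : ∀ z : ℝ × ℝ, ‖(z.1 : ℂ) + z.2 * Complex.I‖ ^ 4 =
      z.1 ^ 4 + 2 * (z.1 ^ 2 * z.2 ^ 2) + z.2 ^ 4 := fun z => by
    rw [show 4 = 2 * 2 from rfl, pow_mul, norm_sq_add_mul_I]; ring
  simp_rw [e]
  have h4 := integrable_pow_gaussianReal (v / 2) 4
  have h2 := integrable_pow_gaussianReal (v / 2) 2
  have h22 := (h2.mul_prod h2).const_mul 2
  rw [integral_add (by exact (h4.comp_fst _).add h22) (h4.comp_snd _), integral_add (h4.comp_fst _) h22,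
    integral_const_mul, integral_prod_mul (fun x : ℝ => x ^ 2) (fun x : ℝ => x ^ 2),
    integral_fun_fst (fun x : ℝ => x ^ 4), integral_fun_snd (fun x : ℝ => x ^ 4)]
  simp [integral_sq_gaussianReal, integral_pow_four_gaussianReal]
  ring

/-- Log-likelihood ratio (in nats) of the channel `y = a x + n` with noise power `v`, relative to
the Gaussian output law, for a unit-power Gaussian input. -/
def infoDensity (a v : ℝ) (x y : ℂ) : ℝ :=
  Real.log ((a ^ 2 + v) / v) - ‖y - a * x‖ ^ 2 / v + ‖y‖ ^ 2 / (a ^ 2 + v)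

theorem measurable_infoDensity (a v : ℝ) :
    Measurable (fun p : ℂ × ℂ => infoDensity a v p.1 p.2) := by
  unfold infoDensity; fun_prop

/-- Completing the square: (y - a u)²/v + u² = b (u - a y/(a² + v))² + y²/(a² + v) with b = (a² +
v)/v. The variance 1/2 is that of the real or imaginary part of a unit-power symbol. -/
theorem lintegral_exp_quadratic_gaussianReal (a y : ℝ) {v : ℝ} (hv : 0 < v) :
    ∫⁻ u, ENNReal.ofReal (Real.exp (-((y - a * u) ^ 2 / v))) ∂(gaussianReal 0 (1 / 2)) =
      ENNReal.ofReal (Real.sqrt (v / (a ^ 2 + v)) * Real.exp (-(y ^ 2 / (a ^ 2 + v)))) := by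
  have hav : 0 < a ^ 2 + v := by positivity
  have hb : 0 < (a ^ 2 + v) / v := by positivity
  rw [gaussianReal_of_var_ne_zero _ (by norm_num), lintegral_withDensity_eq_lintegral_mul _
    (by fun_prop) (by fun_prop)]
  have e : ∀ u : ℝ, (gaussianPDF 0 (1 / 2) * fun u : ℝ =>
      ENNReal.ofReal (Real.exp (-((y - a * u) ^ 2 / v)))) u =
      ENNReal.ofReal ((Real.sqrt Real.pi)⁻¹ * Real.exp (-(y ^ 2 / (a ^ 2 + v))) *
        Real.exp (-((a ^ 2 + v) / v) * (u - a * y / (a ^ 2 + v)) ^ 2)) := fun u => by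
    rw [Pi.mul_apply, gaussianPDF, ← ENNReal.ofReal_mul (gaussianPDFReal_nonneg _ _ _),
      gaussianPDFReal]
    congr 1
    rw [mul_assoc, mul_assoc (Real.sqrt Real.pi)⁻¹, ← Real.exp_add, ← Real.exp_add]
    congr 2
    · congr 1
      push_cast
      ring
    · simp
      field_simp
      ring
  simp_rw [e]
  rw [← ofReal_integral_eq_lintegral_ofReal]
  · congr 1
    rw [integral_const_mul,
      integral_sub_right_eq_self (fun u : ℝ => Real.exp (-((a ^ 2 + v) / v) * u ^ 2)),
      integral_gaussian, Real.sqrt_div Real.pi_pos.le, Real.sqrt_div hav.le, Real.sqrt_div hv.le]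
    have := Real.sqrt_pos.2 Real.pi_pos
    have := Real.sqrt_pos.2 hv
    have := Real.sqrt_pos.2 hav
    field_simp
  · exact ((integrable_exp_neg_mul_sq hb).comp_sub_right _).const_mul _
  · exact Filter.Eventually.of_forall fun u => by positivity

/-- The exponential of the metric is the ratio of the conditional to the marginal output density in
the Gaussian channel, and the marginal is the average of the conditional over x. The identity holds
for each y separately, so it can be integrated against any output law. -/
theorem lintegral_exp_infoDensity (a : ℝ) {v : ℝ} (hv : 0 < v) (y : ℂ) :
    ∫⁻ x, ENNReal.ofReal (Real.exp (infoDensity a v x y)) ∂(complexGaussian 1) = 1 := by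
  have hav : 0 < a ^ 2 + v := by positivity
  have hm := measurable_infoDensity a v
  rw [← (measurePreserving_complexGaussian 1).lintegral_comp
    (by exact (Real.measurable_exp.comp (hm.comp measurable_prodMk_right)).ennreal_ofReal)]
  have e : ∀ z : ℝ × ℝ, ENNReal.ofReal (Real.exp
        (infoDensity a v ((z.1 : ℂ) + z.2 * Complex.I) y)) =
      ENNReal.ofReal ((a ^ 2 + v) / v * Real.exp (‖y‖ ^ 2 / (a ^ 2 + v))) *
        (ENNReal.ofReal (Real.exp (-((y.re - a * z.1) ^ 2 / v))) *
          ENNReal.ofReal (Real.exp (-((y.im - a * z.2) ^ 2 / v)))) := fun z => by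
    rw [← ENNReal.ofReal_mul (by positivity), ← ENNReal.ofReal_mul (by positivity), infoDensity]
    congr 1
    have h1 : ‖y - a * ((z.1 : ℂ) + z.2 * Complex.I)‖ ^ 2 =
        (y.re - a * z.1) ^ 2 + (y.im - a * z.2) ^ 2 := by
      rw [← norm_sq_add_mul_I]
      congr 2
      apply Complex.ext <;> simp
    rw [h1, Real.exp_add, Real.exp_sub, Real.exp_log (by positivity),
      add_div ((y.re - a * z.1) ^ 2), Real.exp_add ((y.re - a * z.1) ^ 2 / v), Real.exp_neg, Real.exp_neg, div_mul_eq_mul_div,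
      ← mul_inv, div_eq_mul_inv _ (Real.exp _ * Real.exp _)]
  simp_rw [e]
  rw [lintegral_const_mul _ (by fun_prop),
    lintegral_prod_mul (f := fun u : ℝ => ENNReal.ofReal (Real.exp (-((y.re - a * u) ^ 2 / v))))
      (g := fun u : ℝ => ENNReal.ofReal (Real.exp (-((y.im - a * u) ^ 2 / v))))
      (by fun_prop) (by fun_prop),
    lintegral_exp_quadratic_gaussianReal _ _ hv, lintegral_exp_quadratic_gaussianReal _ _ hv,
    ← ENNReal.ofReal_mul (by positivity), ← ENNReal.ofReal_mul (by positivity),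
    ENNReal.ofReal_eq_one]
  have h2 : ‖y‖ ^ 2 = y.re ^ 2 + y.im ^ 2 := by
    rw [Complex.sq_norm, Complex.normSq_apply]; ring
  have hs : Real.sqrt (v / (a ^ 2 + v)) * Real.sqrt (v / (a ^ 2 + v)) = v / (a ^ 2 + v) :=
    Real.mul_self_sqrt (by positivity)
  have h3 : Real.exp (‖y‖ ^ 2 / (a ^ 2 + v)) *
      (Real.exp (-(y.re ^ 2 / (a ^ 2 + v))) * Real.exp (-(y.im ^ 2 / (a ^ 2 + v)))) = 1 := by
    rw [← Real.exp_add, ← Real.exp_add, h2, Real.exp_eq_one_iff]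
    field_simp
    ring
  calc _ = (a ^ 2 + v) / v * (Real.sqrt (v / (a ^ 2 + v)) * Real.sqrt (v / (a ^ 2 + v))) *
        (Real.exp (‖y‖ ^ 2 / (a ^ 2 + v)) * (Real.exp (-(y.re ^ 2 / (a ^ 2 + v))) *
          Real.exp (-(y.im ^ 2 / (a ^ 2 + v))))) := by ring
    _ = 1 := by rw [hs, h3]; field_simp

/-! ### Monomials in independent Gaussians and sign changes -/

section Monomials

variable {Γ ι : Type*} [DecidableEq ι]

/-- Change of the sign of coordinate `i`. -/
def signFlip (i : ι) (p : Γ × (ι → ℂ)) : Γ × (ι → ℂ) :=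
  (p.1, fun j => if j = i then -p.2 j else p.2 j)

theorem signFlip_signFlip (i : ι) (p : Γ × (ι → ℂ)) : signFlip i (signFlip i p) = p := by
  ext j
  · rfl
  · by_cases h : j = i <;> simp [signFlip, h]

variable [MeasurableSpace Γ]

/-- `F` has the symmetries and the modulus of a product of the coordinates in `S`, each of them
possibly conjugated, and a coefficient of squared modulus `C`. -/
structure IsMono (F : Γ × (ι → ℂ) → ℂ) (S : Finset ι) (C : ℝ) : Prop where
  measurable : Measurable F
  map_flip : ∀ i p, F (signFlip i p) = (if i ∈ S then -1 else 1) * F p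
  norm_sq : ∀ p, ‖F p‖ ^ 2 = C * ∏ i ∈ S, ‖p.2 i‖ ^ 2

/-- Distinctness of the factors matters: a repeated variable would be even under its sign change and
would contribute a fourth moment. -/
theorem IsMono.three {φ : Γ → ℂ} (hφ : Measurable φ) {C : ℝ} (hC : ∀ γ, ‖φ γ‖ ^ 2 = C) {a b c : ι}
    (hab : a ≠ b) (hac : a ≠ c) (hbc : b ≠ c) :
    IsMono (fun p => φ p.1 * ((starRingEnd ℂ) (p.2 a) * p.2 b * p.2 c)) {a, b, c} C where
  measurable := by
    have : Measurable fun p : Γ × (ι → ℂ) => φ p.1 := by fun_prop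
    have h1 : Measurable fun p : Γ × (ι → ℂ) => (starRingEnd ℂ) (p.2 a) :=
      Complex.continuous_conj.measurable.comp (by fun_prop)
    exact this.mul ((h1.mul (by fun_prop)).mul (by fun_prop))
  map_flip i p := by
    by_cases h1 : i = a
    · subst h1; simp [signFlip, hab.symm, hac.symm]
    by_cases h2 : i = b
    · subst h2; simp [signFlip, hab, hbc.symm]
    by_cases h3 : i = c
    · subst h3; simp [signFlip, hac, hbc]
    simp [signFlip, h1, h2, h3, Ne.symm h1, Ne.symm h2, Ne.symm h3]
  norm_sq p := by
    rw [Finset.prod_insert (by simp [hab, hac]), Finset.prod_pair hbc]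
    simp only [norm_mul, RCLike.norm_conj, mul_pow, hC]
    ring

theorem IsMono.two {φ : Γ → ℂ} (hφ : Measurable φ) {C : ℝ} (hC : ∀ γ, ‖φ γ‖ ^ 2 = C) {a b : ι}
    (hab : a ≠ b) :
    IsMono (fun p => φ p.1 * ((starRingEnd ℂ) (p.2 a) * p.2 b)) {a, b} C where
  measurable := by
    have : Measurable fun p : Γ × (ι → ℂ) => φ p.1 := by fun_prop
    have h1 : Measurable fun p : Γ × (ι → ℂ) => (starRingEnd ℂ) (p.2 a) :=
      Complex.continuous_conj.measurable.comp (by fun_prop)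
    exact this.mul (h1.mul (by fun_prop))
  map_flip i p := by
    by_cases h1 : i = a
    · subst h1; simp [signFlip, hab.symm]
    by_cases h2 : i = b
    · subst h2; simp [signFlip, hab]
    simp [signFlip, h1, h2, Ne.symm h1, Ne.symm h2]
  norm_sq p := by
    rw [Finset.prod_pair hab]
    simp only [norm_mul, RCLike.norm_conj, mul_pow, hC]

variable [Fintype ι]

/-- Joint law of a side variable with law `μ` and independent Gaussians with variances `v`. -/
def jointLaw (μ : Measure Γ) (v : ι → NNReal) : Measure (Γ × (ι → ℂ)) :=
  μ.prod (Measure.pi fun i => complexGaussian (v i))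

instance (μ : Measure Γ) [IsProbabilityMeasure μ] (v : ι → NNReal) :
    IsProbabilityMeasure (jointLaw μ v) := by
  unfold jointLaw; infer_instance

variable (μ : Measure Γ) [IsProbabilityMeasure μ] (v : ι → NNReal)

theorem measurePreserving_flip (i : ι) :
    MeasurePreserving (signFlip i) (jointLaw μ v) (jointLaw μ v) := by
  refine (MeasurePreserving.id μ).prod (measurePreserving_pi
    (fun i => complexGaussian (v i)) (fun i => complexGaussian (v i))
    (f := fun j z => if j = i then -z else z) fun j => ?_)
  by_cases h : j = i
  · simpa [h] using measurePreserving_neg_complexGaussian (v i)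
  · simp only [h, if_false]
    exact MeasurePreserving.id _

/-- The sign change is a measure-preserving measurable equivalence, so the integral equals its own
negative. No integrability is needed. -/
theorem integral_eq_zero_of_flip {F : Γ × (ι → ℂ) → ℂ} (i : ι)
    (hF : ∀ p, F (signFlip i p) = -F p) : ∫ p, F p ∂(jointLaw μ v) = 0 := by
  have hm : Measurable (signFlip i : Γ × (ι → ℂ) → _) := (measurePreserving_flip μ v i).measurable
  let e : Γ × (ι → ℂ) ≃ᵐ Γ × (ι → ℂ) :=
    ⟨⟨signFlip i, signFlip i, signFlip_signFlip i, signFlip_signFlip i⟩, hm, hm⟩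
  have h := (show MeasurePreserving e (jointLaw μ v) (jointLaw μ v) from
    measurePreserving_flip μ v i).integral_comp' F
  have h' : ∫ p, F (e p) ∂(jointLaw μ v) = -∫ p, F p ∂(jointLaw μ v) := by
    rw [← integral_neg]; exact integral_congr_ae (Filter.Eventually.of_forall hF)
  rw [h] at h'
  exact self_eq_neg.1 h'

theorem integrable_prod_coord (S : Finset ι) {g : ι → ℂ → ℝ}
    (hg : ∀ i, Integrable (g i) (complexGaussian (v i))) :
    Integrable (fun p : Γ × (ι → ℂ) => ∏ i ∈ S, g i (p.2 i)) (jointLaw μ v) := by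
  -- Factors outside `S` are replaced by the constant 1, which makes this a product over all
  -- coordinates.
  have h := Integrable.fintype_prod (μ := fun i => complexGaussian (v i))
    (f := fun i z => if i ∈ S then g i z else 1) fun i => by
      by_cases hi : i ∈ S
      · simpa [hi] using hg i
      · simp [hi]
  simp only [Finset.prod_ite_mem, Finset.univ_inter] at h
  exact h.comp_snd μ

theorem integral_prod_coord (S : Finset ι) (g : ι → ℂ → ℝ) :
    ∫ p : Γ × (ι → ℂ), ∏ i ∈ S, g i (p.2 i) ∂(jointLaw μ v) =
      ∏ i ∈ S, ∫ z, g i z ∂(complexGaussian (v i)) := by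
  have h := integral_fintype_prod_eq_prod (μ := fun i => complexGaussian (v i))
    (fun i z => if i ∈ S then g i z else 1)
  simp only [Finset.prod_ite_mem, Finset.univ_inter] at h
  rw [jointLaw, integral_fun_snd (fun z : ι → ℂ => ∏ i ∈ S, g i (z i)), h, probReal_univ, one_smul,
    ← Finset.univ_inter S, ← Finset.prod_ite_mem]
  refine Finset.prod_congr (by simp) fun i _ => ?_
  by_cases hi : i ∈ S <;> simp [hi]

variable {μ v} {F G : Γ × (ι → ℂ) → ℂ} {S S' : Finset ι} {C C' : ℝ}

theorem IsMono.integral_norm_sq (h : IsMono F S C) :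
    ∫ p, ‖F p‖ ^ 2 ∂(jointLaw μ v) = C * ∏ i ∈ S, (v i : ℝ) := by
  simp_rw [h.norm_sq, integral_const_mul, integral_prod_coord μ v S fun _ z => ‖z‖ ^ 2,
    integral_norm_sq_complexGaussian]

theorem IsMono.memLp (h : IsMono F S C) : MemLp F 2 (jointLaw μ v) := by
  rw [memLp_two_iff_integrable_sq_norm h.measurable.aestronglyMeasurable]
  simp_rw [h.norm_sq]
  exact (integrable_prod_coord μ v S
    (fun i => integrable_norm_pow_complexGaussian (v i) 2)).const_mul C

/-- Orthogonality of a function that is invariant under a sign change with one that is odd. -/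
theorem integral_mul_conj_eq_zero_of_flip (i : ι) {s : ℂ} (hs : s = 1 ∨ s = -1)
    (hF : ∀ p, F (signFlip i p) = s * F p) (hG : ∀ p, G (signFlip i p) = -s * G p) :
    ∫ p, F p * (starRingEnd ℂ) (G p) ∂(jointLaw μ v) = 0 := by
  refine integral_eq_zero_of_flip μ v i fun p => ?_
  rw [hF, hG]
  rcases hs with rfl | rfl <;> simp

theorem IsMono.integral_eq_zero (h : IsMono F S C) (hS : S.Nonempty) :
    ∫ p, F p ∂(jointLaw μ v) = 0 := by
  obtain ⟨i, hi⟩ := hS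
  exact integral_eq_zero_of_flip μ v i fun p => by simp [h.map_flip, hi]

/-- A variable that lies in exactly one of the two supports changes the sign of exactly one of the
two factors. -/
theorem IsMono.integral_mul_conj (h : IsMono F S C) (h' : IsMono G S' C') (hS : S ≠ S') :
    ∫ p, F p * (starRingEnd ℂ) (G p) ∂(jointLaw μ v) = 0 := by
  obtain ⟨i, hi⟩ : ∃ i, ¬(i ∈ S ↔ i ∈ S') := by
    by_contra! hc; exact hS (Finset.ext hc)
  by_cases h1 : i ∈ S
  · exact integral_mul_conj_eq_zero_of_flip i (s := -1) (by simp)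
      (by simp [h.map_flip, h1]) (by have : i ∉ S' := by tauto
                                     simp [h'.map_flip, this])
  · exact integral_mul_conj_eq_zero_of_flip i (s := 1) (by simp)
      (by simp [h.map_flip, h1]) (by have : i ∈ S' := by tauto
                                     simp [h'.map_flip, this])

end Monomials

/-! ### Orthogonal sums of square-integrable functions -/

section Orthogonal

variable {Ω τ τ' : Type*} [MeasurableSpace Ω] {P : Measure Ω}

theorem MemLp.integrable_mul_conj {F G : Ω → ℂ} (hF : MemLp F 2 P) (hG : MemLp G 2 P) :
    Integrable (fun p => F p * (starRingEnd ℂ) (G p)) P :=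
  hF.integrable_mul (q := 2) hG.star

theorem integral_sum_mul_conj_sum {F : τ → Ω → ℂ} {G : τ' → Ω → ℂ} (s : Finset τ) (s' : Finset τ')
    (hF : ∀ a ∈ s, MemLp (F a) 2 P) (hG : ∀ b ∈ s', MemLp (G b) 2 P) :
    ∫ p, (∑ a ∈ s, F a p) * (starRingEnd ℂ) (∑ b ∈ s', G b p) ∂P =
      ∑ a ∈ s, ∑ b ∈ s', ∫ p, F a p * (starRingEnd ℂ) (G b p) ∂P := by
  simp_rw [map_sum, Finset.sum_mul_sum]
  rw [integral_finsetSum _ fun a ha => integrable_finsetSum _ fun b hb =>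
    MemLp.integrable_mul_conj (hF a ha) (hG b hb)]
  refine Finset.sum_congr rfl fun a ha => ?_
  rw [integral_finsetSum _ fun b hb => MemLp.integrable_mul_conj (hF a ha) (hG b hb)]

theorem integral_mul_conj_self (F : Ω → ℂ) :
    ∫ p, F p * (starRingEnd ℂ) (F p) ∂P = ((∫ p, ‖F p‖ ^ 2 ∂P : ℝ) : ℂ) := by
  rw [← integral_complex_ofReal]
  congr with p
  rw [Complex.mul_conj, Complex.normSq_eq_norm_sq]

theorem integral_norm_sq_sum_of_orthogonal {F : τ → Ω → ℂ} (s : Finset τ)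
    (hF : ∀ a ∈ s, MemLp (F a) 2 P)
    (ho : ∀ a ∈ s, ∀ b ∈ s, a ≠ b → ∫ p, F a p * (starRingEnd ℂ) (F b p) ∂P = 0) :
    ∫ p, ‖∑ a ∈ s, F a p‖ ^ 2 ∂P = ∑ a ∈ s, ∫ p, ‖F a p‖ ^ 2 ∂P := by
  have h := integral_sum_mul_conj_sum s s hF hF
  rw [integral_mul_conj_self (fun p => ∑ a ∈ s, F a p)] at h
  have : ∀ a ∈ s, ∑ b ∈ s, ∫ p, F a p * (starRingEnd ℂ) (F b p) ∂P =
      ((∫ p, ‖F a p‖ ^ 2 ∂P : ℝ) : ℂ) := fun a ha => by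
    rw [Finset.sum_eq_single a (fun b hb hba => ho a ha b hb hba.symm) (by simp [ha]),
      integral_mul_conj_self]
  rw [Finset.sum_congr rfl this] at h
  exact_mod_cast h

end Orthogonal

/-! ### Expansion of the receiver output into terms -/

theorem phase_add (a b : ℝ) : phase (a + b) = phase a * phase b := by
  simp only [phase, Complex.ofReal_add, mul_add, Complex.exp_add]

theorem norm_phase (a : ℝ) : ‖phase a‖ = 1 := by
  rw [phase, mul_comm, Complex.norm_exp_ofReal_mul_I]

theorem conj_phase (a : ℝ) : (starRingEnd ℂ) (phase a) = phase (-a) := by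
  simp [phase, ← Complex.exp_conj]

theorem measurable_phase : Measurable phase := by
  unfold phase; fun_prop

namespace Realization

variable {M K L : ℕ} (S : Realization M K L) (par : Params K L)

/-- Contribution of tap `l'` of user `q` to tap `l` of the matched filter of user `k`. -/
def sigTerm (k : Fin K) (t : ℕ) (m : Fin M) (l : Fin L) (q : Fin K) (l' : Fin L) : ℂ :=
  (Real.sqrt par.pu : ℂ) * phase (S.cfoErr k * ((k : ℝ) * L + (l : ℝ))) *
    phase (S.cfo q * ((t : ℝ) + l)) * phase (-(S.cfoHat k * ((t : ℝ) + (l : ℝ)))) *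
    ((starRingEnd ℂ) (S.h m k l) * S.h m q l' * S.x q (t + l - l'))

/-- Contribution of the pilot noise and of tap `l'` of user `q`. -/
def pilotTerm (k : Fin K) (t : ℕ) (m : Fin M) (l : Fin L) (q : Fin K) (l' : Fin L) : ℂ :=
  (1 / (Real.sqrt (K * L * par.pu) : ℂ)) * (Real.sqrt par.pu : ℂ) *
    phase (S.cfoHat k * ((k : ℝ) * L + (l : ℝ))) *
    phase (S.cfo q * ((t : ℝ) + l)) * phase (-(S.cfoHat k * ((t : ℝ) + (l : ℝ)))) *
    ((starRingEnd ℂ) (S.w m (k * L + l)) * S.h m q l' * S.x q (t + l - l'))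

/-- Contribution of the receiver noise through the true channel. -/
def noiseTerm (k : Fin K) (t : ℕ) (m : Fin M) (l : Fin L) : ℂ :=
  phase (S.cfoErr k * ((k : ℝ) * L + (l : ℝ))) * phase (-(S.cfoHat k * ((t : ℝ) + (l : ℝ)))) *
    ((starRingEnd ℂ) (S.h m k l) * S.w m (t + l))

/-- Product of pilot noise and receiver noise. -/
def pilotNoiseTerm (k : Fin K) (t : ℕ) (m : Fin M) (l : Fin L) : ℂ :=
  (1 / (Real.sqrt (K * L * par.pu) : ℂ)) * phase (S.cfoHat k * ((k : ℝ) * L + (l : ℝ))) *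
    phase (-(S.cfoHat k * ((t : ℝ) + (l : ℝ)))) *
    ((starRingEnd ℂ) (S.w m (k * L + l)) * S.w m (t + l))

/-- Compensation with the estimated CFO leaves the rotation by the residual CFO on the gain, plus
scaled pilot noise. -/
theorem conj_chanEst (m : Fin M) (k : Fin K) (l : Fin L) :
    (starRingEnd ℂ) (S.chanEst par m k l) =
      (starRingEnd ℂ) (S.h m k l) * phase (S.cfoErr k * ((k : ℝ) * L + (l : ℝ))) +
      (1 / (Real.sqrt (K * L * par.pu) : ℂ)) * (starRingEnd ℂ) (S.w m (k * L + l)) *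
        phase (S.cfoHat k * ((k : ℝ) * L + (l : ℝ))) := by
  have hK : (0 : ℝ) < K := by exact_mod_cast k.pos
  have hL : (0 : ℝ) < L := by exact_mod_cast l.pos
  have hs : (Real.sqrt (K * L * par.pu) : ℂ) ≠ 0 := by
    exact_mod_cast (Real.sqrt_pos.2 (mul_pos (mul_pos hK hL) par.pu_pos)).ne'
  have hp : phase (S.cfoErr k * ((k : ℝ) * L + (l : ℝ))) =
      phase (-(S.cfo k * ((k : ℝ) * L + (l : ℝ)))) *
        phase (S.cfoHat k * ((k : ℝ) * L + (l : ℝ))) := by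
    rw [← phase_add, cfoErr]; congr 1; ring
  rw [chanEst, pilotRx, hp]
  simp only [map_mul, map_add, map_div₀, map_one, Complex.conj_ofReal, conj_phase, neg_neg]
  field_simp

theorem output_eq_sum (k : Fin K) (t : ℕ) :
    S.output par k t = ∑ m, ∑ l, ((∑ q, ∑ l', S.sigTerm par k t m l q l') +
      (∑ q, ∑ l', S.pilotTerm par k t m l q l') + S.noiseTerm k t m l +
        S.pilotNoiseTerm par k t m l) := by
  unfold output
  refine Finset.sum_congr rfl fun m _ => Finset.sum_congr rfl fun l _ => ?_
  have h1 : ∑ q, ∑ l', S.sigTerm par k t m l q l' = (Real.sqrt par.pu : ℂ) * (∑ q, ∑ l',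
      S.h m q l' * S.x q (t + l - l') * phase (S.cfo q * ((t + l : ℕ) : ℝ))) *
      ((starRingEnd ℂ) (S.h m k l) * phase (S.cfoErr k * ((k : ℝ) * L + (l : ℝ))) *
        phase (-(S.cfoHat k * ((t : ℝ) + (l : ℝ))))) := by
    simp only [Finset.mul_sum, Finset.sum_mul]
    refine Finset.sum_congr rfl fun q _ => Finset.sum_congr rfl fun l' _ => ?_
    rw [sigTerm, Nat.cast_add]
    ring
  have h2 : ∑ q, ∑ l', S.pilotTerm par k t m l q l' = (Real.sqrt par.pu : ℂ) * (∑ q, ∑ l',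
      S.h m q l' * S.x q (t + l - l') * phase (S.cfo q * ((t + l : ℕ) : ℝ))) *
      ((1 / (Real.sqrt (K * L * par.pu) : ℂ)) * (starRingEnd ℂ) (S.w m (k * L + l)) *
        phase (S.cfoHat k * ((k : ℝ) * L + (l : ℝ))) *
        phase (-(S.cfoHat k * ((t : ℝ) + (l : ℝ))))) := by
    simp only [Finset.mul_sum, Finset.sum_mul]
    refine Finset.sum_congr rfl fun q _ => Finset.sum_congr rfl fun l' _ => ?_
    rw [pilotTerm, Nat.cast_add]
    ring
  rw [h1, h2, conj_chanEst, dataRx, noiseTerm, pilotNoiseTerm]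
  ring

theorem hEff_conj_mul (k : Fin K) (m : Fin M) (l : Fin L) : (starRingEnd ℂ) (S.hEff m k l) =
    (starRingEnd ℂ) (S.h m k l) * phase (S.cfoErr k * ((k : ℝ) * L + (l : ℝ))) := by
  simp [hEff, conj_phase]

theorem norm_hEff (k : Fin K) (m : Fin M) (l : Fin L) : ‖S.hEff m k l‖ = ‖S.h m k l‖ := by
  simp [hEff, norm_phase]

theorem gain_eq (k : Fin K) (t : ℕ) : S.gain par k t =
    (Real.sqrt par.pu : ℂ) * phase (-(S.cfoErr k * ((t : ℝ) - (k : ℝ) * L))) *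
      ((∑ m, ∑ l, ‖S.h m k l‖ ^ 2 : ℝ) : ℂ) := by
  simp only [gain, norm_hEff, ← Finset.sum_mul]
  push_cast
  ring

/-- These are the terms q = k, l' = l. The tap-dependent parts of the pilot rotation and the data
rotation cancel, so a single phase, depending on the time elapsed since the pilot, is common to all
taps and antennas. -/
theorem gain_mul_eq_sum (k : Fin K) (t : ℕ) : S.gain par k t * S.x k t =
    ∑ m, ∑ l, S.sigTerm par k t m l k l := by
  simp only [gain_eq, Complex.ofReal_sum, Finset.mul_sum, Finset.sum_mul]
  refine Finset.sum_congr rfl fun m _ => Finset.sum_congr rfl fun l _ => ?_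
  rw [sigTerm, show -(S.cfoErr k * ((t : ℝ) - (k : ℝ) * L)) =
    S.cfoErr k * ((k : ℝ) * L + (l : ℝ)) + S.cfo k * ((t : ℝ) + l) +
      -(S.cfoHat k * ((t : ℝ) + (l : ℝ))) by rw [cfoErr]; ring, phase_add, phase_add,
    Nat.add_sub_cancel]
  have : ((‖S.h m k l‖ ^ 2 : ℝ) : ℂ) = (starRingEnd ℂ) (S.h m k l) * S.h m k l := by
    rw [mul_comm, Complex.mul_conj, Complex.normSq_eq_norm_sq]
  rw [this]
  ring

theorem isi_eq_sum (k : Fin K) (t : ℕ) : S.isi par k t =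
    ∑ m, ∑ l, ∑ l' ∈ Finset.univ.erase l, S.sigTerm par k t m l k l' := by
  simp only [isi, Finset.mul_sum]
  refine Finset.sum_congr rfl fun m _ => Finset.sum_congr rfl fun l _ =>
    Finset.sum_congr rfl fun l' _ => ?_
  rw [sigTerm, hEff_conj_mul, hEff]
  have : phase (-(S.cfoErr k * ((k : ℝ) * L + (l' : ℝ)))) *
      phase (-(S.cfoErr k * ((t : ℝ) - (k : ℝ) * L))) *
      phase (-(S.cfoErr k * ((l : ℝ) - (l' : ℝ)))) = phase (S.cfo k * ((t : ℝ) + l)) *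
        phase (-(S.cfoHat k * ((t : ℝ) + (l : ℝ)))) := by
    rw [← phase_add, ← phase_add, ← phase_add, cfoErr]; congr 1; ring
  linear_combination (Real.sqrt par.pu : ℂ) * (starRingEnd ℂ) (S.h m k l) * S.h m k l' *
    S.x k (t + l - l') * phase (S.cfoErr k * ((k : ℝ) * L + (l : ℝ))) * this

theorem mui_eq_sum (k : Fin K) (t : ℕ) : S.mui par k t =
    ∑ m, ∑ l, ∑ q ∈ Finset.univ.erase k, ∑ l', S.sigTerm par k t m l q l' := by
  simp only [mui, Finset.mul_sum]
  refine Finset.sum_congr rfl fun m _ => Finset.sum_congr rfl fun l _ =>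
    Finset.sum_congr rfl fun q _ => Finset.sum_congr rfl fun l' _ => ?_
  rw [sigTerm, hEff_conj_mul, hEff]
  have : phase (-(S.cfoErr q * ((q : ℝ) * L + (l' : ℝ)))) *
      phase ((S.cfoHat q - S.cfoHat k) * ((t : ℝ) + (l : ℝ)) -
        S.cfoErr q * ((t : ℝ) - (q : ℝ) * L + ((l : ℝ) - (l' : ℝ)))) =
      phase (S.cfo q * ((t : ℝ) + l)) * phase (-(S.cfoHat k * ((t : ℝ) + (l : ℝ)))) := by
    rw [← phase_add, ← phase_add, cfoErr]; congr 1; ring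
  linear_combination (Real.sqrt par.pu : ℂ) * (starRingEnd ℂ) (S.h m k l) * S.h m q l' *
    S.x q (t + l - l') * phase (S.cfoErr k * ((k : ℝ) * L + (l : ℝ))) * this

/-- The effective noise is defined as a remainder. The desired signal, ISI and MUI exhaust the terms
free of noise, so exactly the terms with a noise factor remain. -/
theorem en_eq_sum (k : Fin K) (t : ℕ) : S.en par k t =
    ∑ m, ∑ l, ((∑ q, ∑ l', S.pilotTerm par k t m l q l') + S.noiseTerm k t m l +
        S.pilotNoiseTerm par k t m l) := by
  have h : ∑ m, ∑ l, ∑ q, ∑ l', S.sigTerm par k t m l q l' =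
      S.gain par k t * S.x k t + S.isi par k t + S.mui par k t := by
    rw [gain_mul_eq_sum, isi_eq_sum, mui_eq_sum]
    simp only [← Finset.sum_add_distrib]
    refine Finset.sum_congr rfl fun m _ => Finset.sum_congr rfl fun l _ => ?_
    rw [← Finset.add_sum_erase _ _ (Finset.mem_univ k),
      ← Finset.add_sum_erase _ (S.sigTerm par k t m l k) (Finset.mem_univ l)]
  rw [en, output_eq_sum]
  simp only [add_assoc, Finset.sum_add_distrib, h]
  ring

end Realization

/-! ### The sample space and the supports of the terms -/

/-- Indices of the Gaussian variables: gains, noise samples, symbols. -/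
abbrev Idx (M K L Nu : ℕ) : Type :=
  (Fin M × Fin K × Fin L) ⊕ (Fin M × Fin Nu) ⊕ (Fin K × Set.Ico (K * L) Nu)

/-- Variances of the Gaussian variables. -/
def idxVar {K L : ℕ} (par : Params K L) (M Nu : ℕ) : Idx M K L Nu → NNReal :=
  Sum.elim (fun j => par.pdp j.2.1 j.2.2) (Sum.elim (fun _ => par.noiseVar) fun _ => 1)

/-- Sample space of the model: CFOs with their estimates, and the Gaussian variables. -/
abbrev Sample (M K L Nu : ℕ) : Type := (Fin K → ℝ × ℝ) × (Idx M K L Nu → ℂ)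

/-- The realization with given values of the random variables of the model. -/
def Sample.toRealization {M K L Nu : ℕ} (p : Sample M K L Nu) : Realization M K L where
  h m k l := p.2 (Sum.inl (m, k, l))
  -- The value 0 outside the coherence interval is immaterial: the output at a data time reads no
  -- such sample. The same applies to the symbols.
  w m s := if hs : s < Nu then p.2 (Sum.inr (Sum.inl (m, ⟨s, hs⟩))) else 0
  cfo k := (p.1 k).1
  cfoHat k := (p.1 k).2
  x k s := if hs : s ∈ Set.Ico (K * L) Nu then p.2 (Sum.inr (Sum.inr (k, ⟨s, hs⟩))) else 0

/-- Data times stay L - 1 away from the end of the pilots and from the end of the interval, which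
leaves room for a shift by any l - l'. -/
theorem symbol_time_mem {K L Nu : ℕ} (q : Fin K) {t : ℕ} (ht : t ∈ dataTimes K L Nu)
    (l l' : Fin L) : t + l - l' ∈ Set.Ico (K * L) Nu := by
  have hl := l.2
  have hl' := l'.2
  -- This excludes the case in which the subtraction Nu - L is truncated: the lower end of the data
  -- times is then positive.
  have h : L ≤ K * L := Nat.le_mul_of_pos_left L q.pos
  simp only [dataTimes, Finset.mem_Icc] at ht
  constructor <;> omega

theorem noise_time_lt {K L Nu : ℕ} (q : Fin K) {t : ℕ} (ht : t ∈ dataTimes K L Nu)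
    (l : Fin L) : K * L ≤ t + l ∧ t + l < Nu := by
  have hl := l.2
  have h : L ≤ K * L := Nat.le_mul_of_pos_left L q.pos
  simp only [dataTimes, Finset.mem_Icc] at ht
  constructor <;> omega

/-- All pilot times precede K L, so the noise in a channel estimate is never the noise of a data
sample. -/
theorem pilot_time_lt {K L : ℕ} (k : Fin K) (l : Fin L) : k * L + l < K * L := by
  have h : (k + 1) * L ≤ K * L := Nat.mul_le_mul_right L k.2
  have hl := l.2
  rw [add_mul] at h
  omega

section Terms

variable {M K L Nu : ℕ} (par : Params K L) (k : Fin K) {t : ℕ} (ht : t ∈ dataTimes K L Nu)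

/-- Index of a symbol that interferes at time `t`. -/
def symIdx (q : Fin K) (l l' : Fin L) : Idx M K L Nu :=
  Sum.inr (Sum.inr (q, ⟨t + l - l', symbol_time_mem q ht l l'⟩))

/-- Index of the receiver noise at time `t + l`. -/
def noiseIdx (m : Fin M) (l : Fin L) : Idx M K L Nu :=
  Sum.inr (Sum.inl (m, ⟨t + l, (noise_time_lt k ht l).2⟩))

/-- Index of the pilot noise of user `k` in tap `l`. -/
def pilotIdx (m : Fin M) (l : Fin L) : Idx M K L Nu :=
  Sum.inr (Sum.inl (m, ⟨k * L + l, by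
    have := noise_time_lt k ht l
    have := pilot_time_lt k l
    omega⟩))

/-- Index of a channel gain. -/
def gainIdx (m : Fin M) (q : Fin K) (l : Fin L) : Idx M K L Nu := Sum.inl (m, q, l)

/-- The terms of the receiver output: signal terms, pilot noise terms, receiver noise terms,
products of pilot noise and receiver noise. -/
inductive Term (M K L : ℕ) where
  | sig (m : Fin M) (l : Fin L) (q : Fin K) (l' : Fin L)
  | pil (m : Fin M) (l : Fin L) (q : Fin K) (l' : Fin L)
  | noise (m : Fin M) (l : Fin L)
  | pilNoise (m : Fin M) (l : Fin L)

namespace Term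

/-- The value of a term. -/
def val : Term M K L → Sample M K L Nu → ℂ
  | sig m l q l' => fun p => p.toRealization.sigTerm par k t m l q l'
  | pil m l q l' => fun p => p.toRealization.pilotTerm par k t m l q l'
  | noise m l => fun p => p.toRealization.noiseTerm k t m l
  | pilNoise m l => fun p => p.toRealization.pilotNoiseTerm par k t m l

/-- The Gaussian variables that occur in a term. -/
def supp : Term M K L → Finset (Idx M K L Nu)
  | sig m l q l' => {gainIdx m k l, gainIdx m q l', symIdx ht q l l'}
  | pil m l q l' => {pilotIdx k ht m l, gainIdx m q l', symIdx ht q l l'}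
  | noise m l => {gainIdx m k l, noiseIdx k ht m l}
  | pilNoise m l => {pilotIdx k ht m l, noiseIdx k ht m l}

/-- The squared modulus of the coefficient of a term. -/
def coefSq : Term M K L → ℝ
  | sig _ _ _ _ => par.pu
  | pil _ _ _ _ => 1 / (K * L)
  | noise _ _ => 1
  | pilNoise _ _ => 1 / (K * L * par.pu)

/-- Terms whose three factors are distinct variables. -/
def Proper : Term M K L → Prop
  | sig _ l q l' => ¬(q = k ∧ l' = l)
  | _ => True

theorem pilotIdx_ne_noiseIdx (m m' : Fin M) (l l' : Fin L) :
    (pilotIdx k ht m l : Idx M K L Nu) ≠ noiseIdx k ht m' l' := by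
  have h1 := pilot_time_lt k l
  have h2 := noise_time_lt k ht l'
  simp only [pilotIdx, noiseIdx, ne_eq, Sum.inr.injEq, Sum.inl.injEq, Prod.mk.injEq,
    Fin.mk.injEq, not_and]
  omega

/-- All dependence on the CFOs sits in unimodular phases, so the coefficient has constant modulus.
-/
theorem isMono_val {τ : Term M K L} (hτ : τ.Proper k) :
    IsMono (τ.val par k (t := t) (Nu := Nu)) (τ.supp k ht) (τ.coefSq par) := by
  have hpu := par.pu_pos
  have hKL : (L : ℝ) ≠ 0 → 0 < (K : ℝ) * L * par.pu := fun h =>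
    mul_pos (mul_pos (by exact_mod_cast k.pos) (lt_of_le_of_ne (by positivity) h.symm)) hpu
  have hm := measurable_phase
  have hsym : ∀ (p : Sample M K L Nu) (q : Fin K) (l l' : Fin L),
      p.toRealization.x q (t + l - l') = p.2 (symIdx ht q l l') := fun p q l l' =>
    dif_pos (symbol_time_mem q ht l l')
  have hpil : ∀ (p : Sample M K L Nu) (m : Fin M) (l : Fin L),
      p.toRealization.w m (k * L + l) = p.2 (pilotIdx k ht m l) := fun p m l =>
    dif_pos (by have := noise_time_lt k ht l; have := pilot_time_lt k l; omega)
  have hnoi : ∀ (p : Sample M K L Nu) (m : Fin M) (l : Fin L),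
      p.toRealization.w m (t + l) = p.2 (noiseIdx k ht m l) := fun p m l =>
    dif_pos (noise_time_lt k ht l).2
  cases τ with
  | sig m l q l' =>
    simp only [val, Realization.sigTerm, hsym, supp, coefSq]
    refine IsMono.three (φ := fun γ : Fin K → ℝ × ℝ => (Real.sqrt par.pu : ℂ) *
        phase (((γ k).2 - (γ k).1) * ((k : ℝ) * L + (l : ℝ))) *
        phase ((γ q).1 * ((t : ℝ) + l)) * phase (-((γ k).2 * ((t : ℝ) + (l : ℝ)))))
      (by fun_prop) (fun γ => ?_) ?_ ?_ ?_
    · simp [norm_phase, Real.sq_sqrt hpu.le]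
    · simp only [Proper] at hτ
      simp only [gainIdx, ne_eq, Sum.inl.injEq, Prod.mk.injEq, true_and]
      tauto
    · simp [gainIdx, symIdx]
    · simp [gainIdx, symIdx]
  | pil m l q l' =>
    have hL : (L : ℝ) ≠ 0 := by exact_mod_cast l.pos.ne'
    have hK : (K : ℝ) ≠ 0 := by exact_mod_cast k.pos.ne'
    simp only [val, Realization.pilotTerm, hsym, hpil, supp, coefSq]
    refine IsMono.three (φ := fun γ : Fin K → ℝ × ℝ => (1 / (Real.sqrt (K * L * par.pu) : ℂ)) *
        (Real.sqrt par.pu : ℂ) * phase ((γ k).2 * ((k : ℝ) * L + (l : ℝ))) *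
        phase ((γ q).1 * ((t : ℝ) + l)) * phase (-((γ k).2 * ((t : ℝ) + (l : ℝ)))))
      (by fun_prop) (fun γ => ?_) ?_ ?_ ?_
    · simp only [norm_mul, norm_phase, norm_div, norm_one, Complex.norm_real, mul_one, mul_pow,
        Real.norm_eq_abs, sq_abs, div_pow, Real.sq_sqrt hpu.le, Real.sq_sqrt (hKL hL).le]
      field_simp
    · simp [gainIdx, pilotIdx]
    · simp [pilotIdx, symIdx]
    · simp [gainIdx, symIdx]
  | noise m l =>
    simp only [val, Realization.noiseTerm, hnoi, supp, coefSq]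
    refine IsMono.two (φ := fun γ : Fin K → ℝ × ℝ =>
        phase (((γ k).2 - (γ k).1) * ((k : ℝ) * L + (l : ℝ))) *
        phase (-((γ k).2 * ((t : ℝ) + (l : ℝ)))))
      (by fun_prop) (fun γ => ?_) ?_
    · simp [norm_phase]
    · simp [gainIdx, noiseIdx]
  | pilNoise m l =>
    have hL : (L : ℝ) ≠ 0 := by exact_mod_cast l.pos.ne'
    simp only [val, Realization.pilotNoiseTerm, hnoi, hpil, supp, coefSq]
    refine IsMono.two (φ := fun γ : Fin K → ℝ × ℝ => (1 / (Real.sqrt (K * L * par.pu) : ℂ)) *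
        phase ((γ k).2 * ((k : ℝ) * L + (l : ℝ))) *
        phase (-((γ k).2 * ((t : ℝ) + (l : ℝ)))))
      (by fun_prop) (fun γ => ?_) (pilotIdx_ne_noiseIdx k ht m m l l)
    simp only [norm_mul, norm_phase, norm_div, norm_one, Complex.norm_real, mul_one,
        Real.norm_eq_abs, sq_abs, div_pow, Real.sq_sqrt (hKL hL).le]
    field_simp

/-- The kinds of variables present separate the four kinds of terms. Within a kind, indices are read
off the variables. The one delicate case is two signal terms with the two gains exchanged: then both
users are k, and equality of the symbol times t + l - l' and t + l' - l forces l = l', which is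
excluded for proper terms. -/
theorem supp_injective {τ τ' : Term M K L} (hτ : τ.Proper k) (hτ' : τ'.Proper k)
    (h : τ.supp k ht (Nu := Nu) = τ'.supp k ht) : τ = τ' := by
  have key := fun i => Finset.ext_iff.1 h i
  cases τ with
  | sig m l q l' =>
    cases τ' with
    | sig m₁ l₁ q₁ l₁' =>
      have h1 := key (gainIdx m k l)
      have h2 := key (gainIdx m q l')
      have h3 := key (symIdx ht q l l')
      simp [supp, gainIdx, symIdx] at h1 h2 h3
      simp only [Proper] at hτ hτ'
      have := (noise_time_lt k ht l).1
      have := (noise_time_lt k ht l₁).1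
      grind
    | pil m₁ l₁ q₁ l₁' => simpa [supp, gainIdx, symIdx, pilotIdx] using key (pilotIdx k ht m₁ l₁)
    | noise m₁ l₁ => simpa [supp, gainIdx, symIdx, noiseIdx] using key (noiseIdx k ht m₁ l₁)
    | pilNoise m₁ l₁ =>
      simpa [supp, gainIdx, symIdx, noiseIdx, pilotIdx] using key (noiseIdx k ht m₁ l₁)
  | pil m l q l' =>
    cases τ' with
    | sig m₁ l₁ q₁ l₁' => simpa [supp, gainIdx, symIdx, pilotIdx] using key (pilotIdx k ht m l)
    | pil m₁ l₁ q₁ l₁' =>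
      have h1 := key (pilotIdx k ht m l)
      have h2 := key (gainIdx m q l')
      simp [supp, gainIdx, symIdx, pilotIdx] at h1 h2
      grind
    | noise m₁ l₁ =>
      simpa [supp, gainIdx, symIdx, noiseIdx, pilotIdx] using key (symIdx ht q l l')
    | pilNoise m₁ l₁ =>
      simpa [supp, gainIdx, symIdx, noiseIdx, pilotIdx] using key (symIdx ht q l l')
  | noise m l =>
    cases τ' with
    | sig m₁ l₁ q₁ l₁' => simpa [supp, gainIdx, symIdx, noiseIdx] using key (noiseIdx k ht m l)
    | pil m₁ l₁ q₁ l₁' =>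
      simpa [supp, gainIdx, symIdx, noiseIdx, pilotIdx] using key (symIdx ht q₁ l₁ l₁')
    | noise m₁ l₁ =>
      have h1 := key (gainIdx m k l)
      simp [supp, gainIdx, noiseIdx] at h1
      grind
    | pilNoise m₁ l₁ => simpa [supp, gainIdx, noiseIdx, pilotIdx] using key (gainIdx m k l)
  | pilNoise m l =>
    cases τ' with
    | sig m₁ l₁ q₁ l₁' =>
      simpa [supp, gainIdx, symIdx, noiseIdx, pilotIdx] using key (noiseIdx k ht m l)
    | pil m₁ l₁ q₁ l₁' =>
      simpa [supp, gainIdx, symIdx, noiseIdx, pilotIdx] using key (symIdx ht q₁ l₁ l₁')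
    | noise m₁ l₁ => simpa [supp, gainIdx, noiseIdx, pilotIdx] using key (gainIdx m₁ k l₁)
    | pilNoise m₁ l₁ =>
      have h1 := key (pilotIdx k ht m l)
      simp only [supp, Finset.mem_insert, Finset.mem_singleton, pilotIdx_ne_noiseIdx, true_or,
        or_false, true_iff] at h1
      simp [pilotIdx] at h1
      grind

end Term

end Terms

/-! ### Moments of sums of squared gains -/

section SideVariable

variable {Γ ι : Type*} [MeasurableSpace Γ] [Fintype ι] [DecidableEq ι]
  (μ : Measure Γ) [IsProbabilityMeasure μ] (v : ι → NNReal)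

/-- Independence of the CFOs from the Gaussian variables lets the mean phase split off from the mean
squared gains. -/
theorem integral_fst_mul_snd (f : Γ → ℂ) (g : (ι → ℂ) → ℝ) :
    ∫ p, f p.1 * ((g p.2 : ℝ) : ℂ) ∂(jointLaw μ v) =
      (∫ γ, f γ ∂μ) * ((∫ p, g p.2 ∂(jointLaw μ v) : ℝ) : ℂ) := by
  rw [jointLaw, integral_prod_mul f (fun z => (g z : ℂ)), integral_fun_snd g, probReal_univ, one_smul,
    integral_complex_ofReal]

variable {J : Type*} [Fintype J] [DecidableEq J] {a : J → ι} {x : ι}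

theorem integrable_norm_sq_coord (i : ι) :
    Integrable (fun p : Γ × (ι → ℂ) => ‖p.2 i‖ ^ 2) (jointLaw μ v) := by
  simpa using integrable_prod_coord μ v {i} (g := fun _ z => ‖z‖ ^ 2)
    fun i => integrable_norm_pow_complexGaussian (v i) 2

theorem integral_norm_sq_coord (i : ι) :
    ∫ p : Γ × (ι → ℂ), ‖p.2 i‖ ^ 2 ∂(jointLaw μ v) = v i := by
  have h := integral_prod_coord μ v {i} fun _ z => ‖z‖ ^ 2
  simpa only [Finset.prod_singleton, integral_norm_sq_complexGaussian] using h

theorem integral_sum_norm_sq :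
    ∫ p : Γ × (ι → ℂ), ∑ j, ‖p.2 (a j)‖ ^ 2 ∂(jointLaw μ v) = ∑ j, (v (a j) : ℝ) := by
  rw [integral_finsetSum _ fun j _ => integrable_norm_sq_coord μ v (a j)]
  simp_rw [integral_norm_sq_coord]

theorem integral_sum_norm_sq_mul (hx : ∀ j, a j ≠ x) :
    ∫ p : Γ × (ι → ℂ), (∑ j, ‖p.2 (a j)‖ ^ 2) * ‖p.2 x‖ ^ 2 ∂(jointLaw μ v) =
      (∑ j, (v (a j) : ℝ)) * v x := by
  have h := fun j => integral_prod_coord μ v {a j, x} fun _ z => ‖z‖ ^ 2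
  have hi := fun j => integrable_prod_coord μ v {a j, x} (g := fun _ z => ‖z‖ ^ 2)
    fun i => integrable_norm_pow_complexGaussian (v i) 2
  simp only [Finset.prod_pair (hx _), integral_norm_sq_complexGaussian] at h hi
  simp_rw [Finset.sum_mul]
  rw [integral_finsetSum _ fun j _ => hi j]
  simp_rw [h]

theorem integrable_and_integral_norm_sq_mul_norm_sq_mul (ha : Function.Injective a)
    (hx : ∀ j, a j ≠ x) (j j' : J) :
    Integrable (fun p : Γ × (ι → ℂ) => ‖p.2 (a j)‖ ^ 2 * ‖p.2 (a j')‖ ^ 2 * ‖p.2 x‖ ^ 2)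
      (jointLaw μ v) ∧
    ∫ p : Γ × (ι → ℂ), ‖p.2 (a j)‖ ^ 2 * ‖p.2 (a j')‖ ^ 2 * ‖p.2 x‖ ^ 2 ∂(jointLaw μ v) =
      (v (a j) * v (a j') + if j = j' then (v (a j) : ℝ) ^ 2 else 0) * v x := by
  by_cases hj : j = j'
  · subst hj
    -- For equal indices the gain occurs to the fourth power and the symbol to the second, so the
    -- exponent has to depend on the coordinate.
    have hg : ∀ i, Integrable (fun z : ℂ => if i = x then ‖z‖ ^ 2 else ‖z‖ ^ 4)
        (complexGaussian (v i)) := fun i => by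
      by_cases h : i = x
      · simpa [h] using integrable_norm_pow_complexGaussian (v x) 2
      · simpa [h] using integrable_norm_pow_complexGaussian (v i) 4
    have h := integral_prod_coord μ v {a j, x} fun i z => if i = x then ‖z‖ ^ 2 else ‖z‖ ^ 4
    have hi := integrable_prod_coord μ v {a j, x} hg
    simp only [Finset.prod_pair (hx _), integral_norm_sq_complexGaussian, hx, if_true, if_false,
      integral_norm_pow_four_complexGaussian] at h hi
    have e : ∀ p : Γ × (ι → ℂ), ‖p.2 (a j)‖ ^ 2 * ‖p.2 (a j)‖ ^ 2 * ‖p.2 x‖ ^ 2 =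
        ‖p.2 (a j)‖ ^ 4 * ‖p.2 x‖ ^ 2 := fun p => by ring
    simp_rw [e]
    refine ⟨hi, h.trans ?_⟩
    simp only [if_true]
    ring
  · have hne : a j ≠ a j' := fun h => hj (ha h)
    have h := integral_prod_coord μ v {a j, a j', x} fun _ z => ‖z‖ ^ 2
    have hi := integrable_prod_coord μ v {a j, a j', x} (g := fun _ z => ‖z‖ ^ 2)
      fun i => integrable_norm_pow_complexGaussian (v i) 2
    simp only [Finset.prod_insert (show a j ∉ ({a j', x} : Finset ι) by simp [hne, hx]),
      Finset.prod_pair (hx _), integral_norm_sq_complexGaussian, ← mul_assoc] at h hi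
    exact ⟨hi, by simpa [hj] using h⟩

/-- Off-diagonal pairs contribute products of variances, and diagonal pairs twice the squared
variance. The diagonal excess is the second sum. -/
theorem integrable_and_integral_sum_norm_sq_sq_mul (ha : Function.Injective a)
    (hx : ∀ j, a j ≠ x) :
    Integrable (fun p : Γ × (ι → ℂ) => (∑ j, ‖p.2 (a j)‖ ^ 2) ^ 2 * ‖p.2 x‖ ^ 2)
      (jointLaw μ v) ∧
    ∫ p : Γ × (ι → ℂ), (∑ j, ‖p.2 (a j)‖ ^ 2) ^ 2 * ‖p.2 x‖ ^ 2 ∂(jointLaw μ v) =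
      ((∑ j, (v (a j) : ℝ)) ^ 2 + ∑ j, (v (a j) : ℝ) ^ 2) * v x := by
  have h := integrable_and_integral_norm_sq_mul_norm_sq_mul μ v ha hx
  have e : ∀ p : Γ × (ι → ℂ), (∑ j, ‖p.2 (a j)‖ ^ 2) ^ 2 * ‖p.2 x‖ ^ 2 =
      ∑ j, ∑ j', ‖p.2 (a j)‖ ^ 2 * ‖p.2 (a j')‖ ^ 2 * ‖p.2 x‖ ^ 2 := fun p => by
    rw [sq (∑ j, _), Finset.sum_mul_sum, Finset.sum_mul]
    simp_rw [Finset.sum_mul]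
  simp_rw [e]
  refine ⟨integrable_finsetSum _ fun j _ => integrable_finsetSum _ fun j' _ => (h j j').1, ?_⟩
  rw [integral_finsetSum _ fun j _ => integrable_finsetSum _ fun j' _ => (h j j').1]
  have e2 : ∀ j, ∫ p : Γ × (ι → ℂ), ∑ j', ‖p.2 (a j)‖ ^ 2 * ‖p.2 (a j')‖ ^ 2 * ‖p.2 x‖ ^ 2
      ∂(jointLaw μ v) = (v (a j) * (∑ j', (v (a j') : ℝ)) + (v (a j) : ℝ) ^ 2) * v x := fun j => by
    rw [integral_finsetSum _ fun j' _ => (h j j').1]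
    simp_rw [(h _ _).2, ← Finset.sum_mul, Finset.sum_add_distrib, Finset.mul_sum]
    simp
  simp_rw [e2, ← Finset.sum_mul, Finset.sum_add_distrib, ← Finset.sum_mul]
  ring

end SideVariable

/-- Mean of the phase rotation by a Gaussian frequency error. -/
theorem integral_phase_gaussianReal (w : NNReal) (s : ℝ) :
    ∫ y, phase (-(y * s)) ∂(gaussianReal 0 w) = (Real.exp (-(w * s ^ 2 / 2)) : ℂ) := by
  have h := charFun_gaussianReal (μ := 0) (v := w) (-s)
  rw [charFun_apply_real] at h
  have e : ∀ y : ℝ, phase (-(y * s)) = Complex.exp (((-s : ℝ) : ℂ) * y * Complex.I) := fun y => by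
    rw [phase]; congr 1; push_cast; ring
  simp_rw [e]
  rw [h]
  push_cast
  congr 1
  ring

/-! ### Grouping of the terms into components and their powers -/

namespace Term

variable {M K L Nu : ℕ}

/-- Terms as a sum of product types. -/
def equivSum : (Fin M × Fin L × Fin K × Fin L) ⊕ (Fin M × Fin L × Fin K × Fin L) ⊕
    (Fin M × Fin L) ⊕ (Fin M × Fin L) ≃ Term M K L where
  toFun := Sum.elim (fun j => sig j.1 j.2.1 j.2.2.1 j.2.2.2)
    (Sum.elim (fun j => pil j.1 j.2.1 j.2.2.1 j.2.2.2)
      (Sum.elim (fun j => noise j.1 j.2) fun j => pilNoise j.1 j.2))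
  invFun
    | sig m l q l' => Sum.inl (m, l, q, l')
    | pil m l q l' => Sum.inr (Sum.inl (m, l, q, l'))
    | noise m l => Sum.inr (Sum.inr (Sum.inl (m, l)))
    | pilNoise m l => Sum.inr (Sum.inr (Sum.inr (m, l)))
  left_inv j := by rcases j with j | j | j | j <;> rfl
  right_inv τ := by cases τ <;> rfl

instance : Fintype (Term M K L) := Fintype.ofEquiv _ equivSum

theorem sum_eq {R : Type*} [AddCommMonoid R] (f : Term M K L → R) :
    ∑ τ, f τ = (∑ m, ∑ l, ∑ q, ∑ l', f (sig m l q l')) +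
      ((∑ m, ∑ l, ∑ q, ∑ l', f (pil m l q l')) + ((∑ m, ∑ l, f (noise m l)) +
        ∑ m, ∑ l, f (pilNoise m l))) := by
  rw [← equivSum.sum_comp]
  simp only [Fintype.sum_sum_type, Fintype.sum_prod_type]
  rfl

variable (par : Params K L) (k : Fin K) {t : ℕ} (ht : t ∈ dataTimes K L Nu)

/-- The component of the output to which a term belongs. -/
def kind : Term M K L → Component
  | sig _ l q l' => if q = k then if l' = l then .ES else .ISI else .MUI
  | _ => .EN

theorem proper_of_kind {τ : Term M K L} {c : Component} (h : τ.kind k = c) (hc : c ≠ .ES) :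
    τ.Proper k := by
  subst h
  cases τ <;> simp only [Proper]
  rintro ⟨h1, h2⟩
  exact hc (by simp [kind, h1, h2])

/-- The second moment of a term. -/
def power : Term M K L → ℝ
  | sig _ l q l' => par.pu * (par.pdp k l * par.pdp q l')
  | pil _ _ q l' => 1 / (K * L) * (par.noiseVar * par.pdp q l')
  | noise _ l => par.pdp k l * par.noiseVar
  | pilNoise _ _ => 1 / (K * L * par.pu) * (par.noiseVar * par.noiseVar)

theorem coefSq_mul_prod {τ : Term M K L} (hτ : τ.Proper k) :
    τ.coefSq par * ∏ i ∈ τ.supp k ht (Nu := Nu), (idxVar par M Nu i : ℝ) = τ.power par k := by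
  have hne := pilotIdx_ne_noiseIdx (M := M) k ht
  cases τ with
  | sig m l q l' =>
    have h : ¬(k = q ∧ l = l') := fun h => hτ ⟨h.1.symm, h.2.symm⟩
    rw [supp, Finset.prod_insert (by simpa [gainIdx, symIdx] using h),
      Finset.prod_pair (by simp [gainIdx, symIdx])]
    simp [gainIdx, symIdx, idxVar, coefSq, power]
  | pil m l q l' =>
    rw [supp, Finset.prod_insert (by simp [gainIdx, symIdx, pilotIdx]),
      Finset.prod_pair (by simp [gainIdx, symIdx])]
    simp [gainIdx, symIdx, pilotIdx, idxVar, coefSq, power]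
  | noise m l =>
    rw [supp, Finset.prod_pair (by simp [gainIdx, noiseIdx])]
    simp [gainIdx, noiseIdx, idxVar, coefSq, power]
  | pilNoise m l =>
    rw [supp, Finset.prod_pair (hne m m l l)]
    simp [pilotIdx, noiseIdx, idxVar, coefSq, power]

/-- Every term contains a gain or a noise sample. ES and SIF are even in all of these, so for proper
terms such a variable gives orthogonality to both. -/
theorem exists_mem_supp (τ : Term M K L) :
    ∃ i ∈ τ.supp k ht (Nu := Nu), ∀ j, i ≠ Sum.inr (Sum.inr j) := by
  cases τ with
  | sig m l q l' => exact ⟨gainIdx m k l, by simp [supp], by simp [gainIdx]⟩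
  | pil m l q l' => exact ⟨pilotIdx k ht m l, by simp [supp], by simp [pilotIdx]⟩
  | noise m l => exact ⟨gainIdx m k l, by simp [supp], by simp [gainIdx]⟩
  | pilNoise m l => exact ⟨pilotIdx k ht m l, by simp [supp], by simp [pilotIdx]⟩

open Classical in
/-- The terms of a component. -/
def ofKind (c : Component) : Finset (Term M K L) := Finset.univ.filter fun τ => τ.kind k = c

theorem sum_ofKind {R : Type*} [AddCommMonoid R] (f : Term M K L → R) :
    ∑ τ ∈ ofKind k .ISI, f τ = ∑ m, ∑ l, ∑ l' ∈ Finset.univ.erase l, f (sig m l k l') ∧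
    ∑ τ ∈ ofKind k .MUI, f τ =
      ∑ m, ∑ l, ∑ q ∈ Finset.univ.erase k, ∑ l', f (sig m l q l') ∧
    ∑ τ ∈ ofKind k .EN, f τ = (∑ m, ∑ l, ∑ q, ∑ l', f (pil m l q l')) +
      ((∑ m, ∑ l, f (noise m l)) + ∑ m, ∑ l, f (pilNoise m l)) := by
  classical
  have h1 : ∀ q l l', (if q = k then if l' = l then Component.ES else .ISI else .MUI) = .ISI ↔
      q = k ∧ l' ≠ l := fun (q : Fin K) (l l' : Fin L) => by split_ifs <;> simp_all
  have h2 : ∀ q l l', (if q = k then if l' = l then Component.ES else .ISI else .MUI) = .MUI ↔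
      q ≠ k := fun (q : Fin K) (l l' : Fin L) => by split_ifs <;> simp_all
  have h3 : ∀ q l l', (if q = k then if l' = l then Component.ES else .ISI else .MUI) = .EN ↔
      False := fun (q : Fin K) (l l' : Fin L) => by split_ifs <;> simp_all
  refine ⟨?_, ?_, ?_⟩ <;> rw [ofKind, Finset.sum_filter, sum_eq] <;> simp only [kind, h1, h2, h3,
    reduceCtorEq, if_false, if_true, Finset.sum_const_zero, add_zero, zero_add]
  · refine Finset.sum_congr rfl fun m _ => Finset.sum_congr rfl fun l _ => ?_
    rw [Finset.sum_eq_single k (fun q _ hq => by simp [hq]) (by simp), ← Finset.filter_ne',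
      Finset.sum_filter]
    simp
  · refine Finset.sum_congr rfl fun m _ => Finset.sum_congr rfl fun l _ => ?_
    rw [← Finset.filter_ne', Finset.sum_filter]
    refine Finset.sum_congr rfl fun q _ => ?_
    by_cases hq : q = k <;> simp [hq]

theorem sum_pdp (q : Fin K) : ∑ l, (par.pdp q l : ℝ) = par.theta q := rfl

/-- The powers of the terms with pilot noise do not depend on the filter tap l, so the sum over l
yields a factor L that cancels the one in 1/(K L). This cancellation needs L > 0. -/
theorem sum_power :
    (∑ τ ∈ ofKind (M := M) k .ISI, τ.power par k = tableVariance par M k t .ISI) ∧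
    (∑ τ ∈ ofKind (M := M) k .MUI, τ.power par k = tableVariance par M k t .MUI) ∧
    (0 < L → ∑ τ ∈ ofKind (M := M) k .EN, τ.power par k = tableVariance par M k t .EN) := by
  obtain ⟨h1, h2, h3⟩ := sum_ofKind k (fun τ : Term M K L => τ.power par k)
  refine ⟨h1.trans ?_, h2.trans ?_, fun hL => h3.trans ?_⟩
  · have : ∀ l : Fin L, ∑ l' ∈ Finset.univ.erase l, par.pu * ((par.pdp k l : ℝ) * par.pdp k l') =
        par.pu * (par.pdp k l * par.theta k - (par.pdp k l : ℝ) ^ 2) := fun l => by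
      rw [Params.theta, ← Finset.add_sum_erase _ _ (Finset.mem_univ l), ← Finset.mul_sum,
        ← Finset.mul_sum]
      ring
    simp only [power, this, tableVariance]
    simp_rw [← Finset.mul_sum, Finset.sum_sub_distrib, ← Finset.sum_mul, sum_pdp]
    simp
    ring
  · have : ∀ (l : Fin L) (q : Fin K), ∑ l', par.pu * ((par.pdp k l : ℝ) * par.pdp q l') =
        par.pu * (par.pdp k l * par.theta q) := fun l q => by
      rw [Params.theta, Finset.mul_sum, Finset.mul_sum]
    simp only [power, this, tableVariance]
    simp_rw [← Finset.mul_sum, ← Finset.sum_mul, sum_pdp]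
    simp
    ring
  · have hL' : (L : ℝ) ≠ 0 := by exact_mod_cast hL.ne'
    have hK' : (K : ℝ) ≠ 0 := by exact_mod_cast k.pos.ne'
    have hp := par.pu_pos.ne'
    simp only [power, tableVariance]
    simp_rw [← Finset.mul_sum, ← Finset.sum_mul, sum_pdp]
    simp
    field_simp
    ring

end Term

/-! ### Irrelevance of values outside the coherence interval -/

namespace Realization

variable {M K L : ℕ}

/-- Equality of the realizations during the coherence interval. -/
structure Agree (Nu : ℕ) (S S' : Realization M K L) : Prop where
  h : S.h = S'.h
  cfo : S.cfo = S'.cfo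
  cfoHat : S.cfoHat = S'.cfoHat
  w : ∀ m s, s < Nu → S.w m s = S'.w m s
  x : ∀ q s, s ∈ Set.Ico (K * L) Nu → S.x q s = S'.x q s

variable {Nu : ℕ} {S S' : Realization M K L} (hS : S.Agree Nu S') (par : Params K L)
  (k : Fin K) {t : ℕ} (ht : t ∈ dataTimes K L Nu)

include hS in
theorem Agree.cfoErr : S.cfoErr = S'.cfoErr := by
  funext q; simp only [Realization.cfoErr, hS.cfo, hS.cfoHat]

include hS in
theorem Agree.gain : S.gain par k t = S'.gain par k t := by
  rw [gain_eq, gain_eq, hS.cfoErr, hS.h]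

include hS ht in
theorem Agree.sigTerm (m : Fin M) (l : Fin L) (q : Fin K) (l' : Fin L) :
    S.sigTerm par k t m l q l' = S'.sigTerm par k t m l q l' := by
  simp only [Realization.sigTerm, hS.cfoErr, hS.cfo, hS.cfoHat, hS.h,
    hS.x q _ (symbol_time_mem q ht l l')]

include hS ht in
theorem Agree.isi : S.isi par k t = S'.isi par k t := by
  simp only [isi_eq_sum, hS.sigTerm par k ht]

include hS ht in
theorem Agree.mui : S.mui par k t = S'.mui par k t := by
  simp only [mui_eq_sum, hS.sigTerm par k ht]

include hS ht in
theorem Agree.en : S.en par k t = S'.en par k t := by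
  have h1 := fun l => noise_time_lt k ht l
  have h2 := fun m (l : Fin L) => hS.w m (k * L + l : ℕ) ((pilot_time_lt k l).trans_le
    ((h1 l).1.trans (h1 l).2.le))
  have h3 := fun q l l' => hS.x q _ (symbol_time_mem q ht l l')
  simp only [en_eq_sum, Realization.pilotTerm, Realization.noiseTerm, Realization.pilotNoiseTerm,
    hS.cfoErr, hS.cfo, hS.cfoHat, hS.h, h2, hS.w _ _ (h1 _).2, h3]

theorem output_eq (S : Realization M K L) : S.output par k t =
    S.gain par k t * S.x k t + S.isi par k t + S.mui par k t + S.en par k t := by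
  rw [en]; ring

include hS ht in
theorem Agree.output (hL : 0 < L) : S.output par k t = S'.output par k t := by
  have hx : S.x k t = S'.x k t := by
    simpa using hS.x k _ (symbol_time_mem k ht ⟨0, hL⟩ ⟨0, hL⟩)
  rw [output_eq, output_eq, hS.gain, hS.isi par k ht, hS.mui par k ht, hS.en par k ht, hx]

end Realization

theorem data_time_mem {K L Nu t : ℕ} (hK : 0 < K) (hL : 0 < L)
    (ht : t ∈ dataTimes K L Nu) : t ∈ Set.Ico (K * L) Nu := by
  simpa using symbol_time_mem ⟨0, hK⟩ ht ⟨0, hL⟩ ⟨0, hL⟩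

/-- Index of the desired symbol. -/
def dataIdx {K L Nu t : ℕ} (M : ℕ) (k : Fin K) (hL : 0 < L) (ht : t ∈ dataTimes K L Nu) :
    Idx M K L Nu :=
  Sum.inr (Sum.inr (k, ⟨t, data_time_mem k.pos hL ht⟩))

/-! ### Means, correlations and variances of the components -/

section Moments

variable {M K L Nu : ℕ} (hL : 0 < L) (par : Params K L) (k : Fin K) {t : ℕ}
  (ht : t ∈ dataTimes K L Nu)

namespace Sample

/-- The components of the output on the sample space; `g` is the mean gain. -/
def component (g : ℂ) (k : Fin K) (t : ℕ) : Component → Sample M K L Nu → ℂ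
  | .ES => fun p => g * p.toRealization.x k t
  | .SIF => fun p => (p.toRealization.gain par k t - g) * p.toRealization.x k t
  | .ISI => fun p => p.toRealization.isi par k t
  | .MUI => fun p => p.toRealization.mui par k t
  | .EN => fun p => p.toRealization.en par k t

theorem component_eq_sum (g : ℂ) {c : Component} (h1 : c ≠ .ES) (h2 : c ≠ .SIF)
    (p : Sample M K L Nu) :
    component par g k t c p = ∑ τ ∈ Term.ofKind k c, Term.val par k (t := t) τ p := by
  obtain ⟨e1, e2, e3⟩ := Term.sum_ofKind k (fun τ : Term M K L => Term.val par k (t := t) τ p)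
  cases c
  · exact absurd rfl h1
  · exact absurd rfl h2
  · rw [e1]; exact Realization.isi_eq_sum _ par k t
  · rw [e2]; exact Realization.mui_eq_sum _ par k t
  · rw [e3]
    refine (Realization.en_eq_sum _ par k t).trans ?_
    simp only [Finset.sum_add_distrib, add_assoc]
    rfl

theorem x_eq (p : Sample M K L Nu) :
    p.toRealization.x k t = p.2 (dataIdx M k hL ht) :=
  dif_pos (data_time_mem k.pos hL ht)

/-- Total squared gain of user `k`. -/
def gainSq (k : Fin K) (p : Sample M K L Nu) : ℝ :=
  ∑ j : Fin M × Fin L, ‖p.2 (Sum.inl (j.1, k, j.2))‖ ^ 2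

/-- Phase of the gain. -/
def gainPhase (k : Fin K) (t : ℕ) (γ : Fin K → ℝ × ℝ) : ℂ :=
  phase (-(((γ k).2 - (γ k).1) * ((t : ℝ) - (k : ℝ) * L)))

theorem gain_eq (p : Sample M K L Nu) : p.toRealization.gain par k t =
    (Real.sqrt par.pu : ℂ) * (gainPhase (L := L) k t p.1 * (gainSq k p : ℂ)) := by
  rw [Realization.gain_eq, mul_assoc, gainSq, Fintype.sum_prod_type]
  rfl

end Sample

/-- The mean of the gain. -/
def meanGainVal (M : ℕ) (t : ℕ) : ℝ :=
  Real.sqrt par.pu * (Real.exp (-(par.cfoVar k * ((t : ℝ) - (k : ℝ) * L) ^ 2 / 2)) *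
    (M * par.theta k))

/-- The mean of the Gaussian phase is exp(-σ²τ²/2), and its square is the decay factor exp(-σ²τ²).
-/
theorem meanGainVal_sq (M : ℕ) : meanGainVal par k M t ^ 2 = tableVariance par M k t .ES := by
  simp only [meanGainVal, tableVariance, mul_pow, Real.sq_sqrt par.pu_pos.le, Params.decay,
    ← Real.exp_nat_mul]
  rw [show ((2 : ℕ) : ℝ) * -((par.cfoVar k : ℝ) * ((t : ℝ) - (k : ℝ) * L) ^ 2 / 2) =
    -((par.cfoVar k : ℝ) * ((t : ℝ) - (k : ℝ) * L) ^ 2) by push_cast; ring]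
  ring

variable (μ : Measure (Fin K → ℝ × ℝ)) [IsProbabilityMeasure μ]
  (hμ : ∀ k, μ.map (fun γ => (γ k).2 - (γ k).1) = gaussianReal 0 (par.cfoVar k))

/-- Law on the sample space. -/
abbrev sampleLaw (M Nu : ℕ) : Measure (Sample M K L Nu) := jointLaw μ (idxVar par M Nu)

include hμ in
-- Only the law of the residual CFO of user k enters. The joint law of the CFOs and their estimates
-- is otherwise arbitrary.
theorem integral_gainPhase : ∫ γ, Sample.gainPhase (L := L) k t γ ∂μ =
    (Real.exp (-(par.cfoVar k * ((t : ℝ) - (k : ℝ) * L) ^ 2 / 2)) : ℂ) := by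
  have hm := measurable_phase
  rw [← integral_phase_gaussianReal, ← hμ, integral_map (by fun_prop)
    (Measurable.aestronglyMeasurable (by fun_prop))]
  rfl

theorem sum_idxVar : ∑ j : Fin M × Fin L, (idxVar par M Nu (Sum.inl (j.1, k, j.2)) : ℝ) =
    M * par.theta k := by
  rw [Fintype.sum_prod_type]
  simp [idxVar, Params.theta]

include hμ in
theorem integral_gain : ∫ p : Sample M K L Nu, p.toRealization.gain par k t ∂(sampleLaw par μ M Nu) =
    (meanGainVal par k M t : ℂ) := by
  simp_rw [Sample.gain_eq]
  rw [integral_const_mul, sampleLaw]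
  have h := integral_fst_mul_snd μ (idxVar par M Nu) (Sample.gainPhase (L := L) k t)
    (fun z => ∑ j : Fin M × Fin L, ‖z (Sum.inl (j.1, k, j.2))‖ ^ 2)
  have h2 := integral_sum_norm_sq μ (idxVar par M Nu)
    (a := fun j : Fin M × Fin L => Sum.inl (j.1, k, j.2))
  rw [sum_idxVar] at h2
  rw [h2, integral_gainPhase par k μ hμ] at h
  refine (congrArg _ h).trans ?_
  simp [meanGainVal]

theorem measurable_gain : Measurable fun p : Sample M K L Nu => p.toRealization.gain par k t := by
  have hm := measurable_phase
  simp_rw [Sample.gain_eq, Sample.gainPhase, Sample.gainSq]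
  fun_prop

include hL ht in
-- The phase disappears in the modulus, so the total power of ES and SIF together does not depend on
-- the CFO error.
theorem gain_mul_moments :
    MemLp (fun p : Sample M K L Nu => p.toRealization.gain par k t * p.toRealization.x k t) 2
      (sampleLaw par μ M Nu) ∧
    ∫ p : Sample M K L Nu, ‖p.toRealization.gain par k t * p.toRealization.x k t‖ ^ 2
      ∂(sampleLaw par μ M Nu) =
      par.pu * ((M * par.theta k) ^ 2 + M * ∑ l, (par.pdp k l : ℝ) ^ 2) := by
  have hinj : Function.Injective
      fun j : Fin M × Fin L => (Sum.inl (j.1, k, j.2) : Idx M K L Nu) := fun j j' h => by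
    simp only [Sum.inl.injEq, Prod.mk.injEq, true_and] at h
    exact Prod.ext h.1 h.2
  obtain ⟨h1, h2⟩ := integrable_and_integral_sum_norm_sq_sq_mul μ (idxVar par M Nu) hinj
    (x := dataIdx M k hL ht) (by simp [dataIdx])
  have e : ∀ p : Sample M K L Nu, ‖p.toRealization.gain par k t * p.toRealization.x k t‖ ^ 2 =
      par.pu * ((∑ j : Fin M × Fin L, ‖p.2 (Sum.inl (j.1, k, j.2))‖ ^ 2) ^ 2 *
        ‖p.2 (dataIdx M k hL ht)‖ ^ 2) := fun p => by
    rw [Sample.gain_eq, Sample.x_eq hL k ht]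
    simp only [norm_mul, Complex.norm_real, mul_pow, Real.norm_eq_abs, sq_abs,
      Real.sq_sqrt par.pu_pos.le, Sample.gainPhase, norm_phase, Sample.gainSq]
    ring
  have hx : Measurable fun p : Sample M K L Nu => p.toRealization.x k t := by
    simp_rw [Sample.x_eq hL k ht]; fun_prop
  constructor
  · rw [memLp_two_iff_integrable_sq_norm
      (by exact ((measurable_gain par k).mul hx).aestronglyMeasurable)]
    simp_rw [e]
    exact h1.const_mul _
  · simp_rw [e]
    rw [integral_const_mul, h2, sum_idxVar]
    simp [idxVar, dataIdx, Fintype.sum_prod_type]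

include hL ht in
theorem memLp_x : MemLp (fun p : Sample M K L Nu => p.toRealization.x k t) 2
    (sampleLaw par μ M Nu) := by
  simp_rw [Sample.x_eq hL k ht]
  rw [memLp_two_iff_integrable_sq_norm (by fun_prop)]
  exact integrable_norm_sq_coord μ _ _

include hL ht hμ in
theorem integral_gain_mul_conj :
    ∫ p : Sample M K L Nu, p.toRealization.gain par k t * p.toRealization.x k t *
      (starRingEnd ℂ) (p.toRealization.x k t) ∂(sampleLaw par μ M Nu) = meanGainVal par k M t := by
  have h := integral_fst_mul_snd μ (idxVar par M Nu) (Sample.gainPhase (L := L) k t)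
    (fun z => (∑ j : Fin M × Fin L, ‖z (Sum.inl (j.1, k, j.2))‖ ^ 2) *
      ‖z (dataIdx M k hL ht)‖ ^ 2)
  have h2 := integral_sum_norm_sq_mul μ (idxVar par M Nu) (x := dataIdx M k hL ht)
    (a := fun j : Fin M × Fin L => Sum.inl (j.1, k, j.2)) (by simp [dataIdx])
  rw [sum_idxVar] at h2
  rw [h2, integral_gainPhase par k μ hμ] at h
  have e : ∀ p : Sample M K L Nu, p.toRealization.gain par k t * p.toRealization.x k t *
      (starRingEnd ℂ) (p.toRealization.x k t) = (Real.sqrt par.pu : ℂ) *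
      (Sample.gainPhase (L := L) k t p.1 *
        (((∑ j : Fin M × Fin L, ‖p.2 (Sum.inl (j.1, k, j.2))‖ ^ 2) *
          ‖p.2 (dataIdx M k hL ht)‖ ^ 2 : ℝ) : ℂ)) := fun p => by
    rw [mul_assoc, Complex.mul_conj, Complex.normSq_eq_norm_sq, Sample.gain_eq,
      Sample.x_eq hL k ht, Sample.gainSq, Complex.ofReal_mul]
    ring
  simp_rw [e]
  rw [integral_const_mul]
  refine (congrArg _ h).trans ?_
  simp [meanGainVal, idxVar, dataIdx]

/-- Shorthand for the components with the true mean gain. -/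
abbrev comp (M Nu : ℕ) (t : ℕ) (c : Component) : Sample M K L Nu → ℂ :=
  Sample.component par (meanGainVal par k M t : ℂ) k t c

theorem comp_SIF : comp par k M Nu t .SIF = fun p =>
    p.toRealization.gain par k t * p.toRealization.x k t - comp par k M Nu t .ES p := by
  funext p
  simp only [Sample.component]
  ring

include hL ht in
theorem comp_memLp (c : Component) : MemLp (comp par k M Nu t c) 2 (sampleLaw par μ M Nu) := by
  have hx := memLp_x (M := M) hL par k ht μ
  have hAx := (gain_mul_moments (M := M) hL par k ht μ).1
  have hsum : ∀ c : Component, c ≠ .ES → c ≠ .SIF →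
      MemLp (comp par k M Nu t c) 2 (sampleLaw par μ M Nu) := fun c h1 h2 => by
    have : comp par k M Nu t c = fun p => ∑ τ ∈ Term.ofKind k c, Term.val par k (t := t) τ p :=
      funext fun p => Sample.component_eq_sum par k _ h1 h2 p
    rw [this]
    exact memLp_finsetSum _ fun τ hτ => (Term.isMono_val par k ht
      (Term.proper_of_kind k (by simpa [Term.ofKind] using hτ) h1)).memLp
  have hES : MemLp (comp par k M Nu t .ES) 2 (sampleLaw par μ M Nu) := hx.const_mul _
  cases c with
  | ES => exact hES
  | SIF =>
    rw [comp_SIF]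
    exact hAx.sub hES
  | ISI => exact hsum _ (by simp) (by simp)
  | MUI => exact hsum _ (by simp) (by simp)
  | EN => exact hsum _ (by simp) (by simp)

include hL ht in
-- The gain is built from squared moduli, hence invariant under all sign changes. Only the desired
-- symbol is odd.
theorem comp_signFlip {c : Component} (hc : c = .ES ∨ c = .SIF) (i : Idx M K L Nu)
    (p : Sample M K L Nu) : comp par k M Nu t c (signFlip i p) =
      (if i = dataIdx M k hL ht then -1 else 1) * comp par k M Nu t c p := by
  have hg : (Sample.toRealization (signFlip i p)).gain par k t = p.toRealization.gain par k t := by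
    rw [Sample.gain_eq, Sample.gain_eq]
    have : Sample.gainSq k (signFlip i p) = Sample.gainSq k p := by
      refine Finset.sum_congr rfl fun j _ => ?_
      simp only [signFlip]
      split_ifs <;> simp
    rw [this]
    rfl
  have hx : (Sample.toRealization (signFlip i p)).x k t =
      (if i = dataIdx M k hL ht then -1 else 1) * p.toRealization.x k t := by
    rw [Sample.x_eq hL k ht, Sample.x_eq hL k ht]
    by_cases h : i = dataIdx M k hL ht
    · simp [signFlip, h]
    · simp [signFlip, h, Ne.symm h]
  rcases hc with rfl | rfl
  · simp only [Sample.component, hx]; ring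
  · simp only [Sample.component, hx, hg]; ring

include hL ht in
theorem integral_comp_eq_zero (c : Component) :
    ∫ p, comp par k M Nu t c p ∂(sampleLaw par μ M Nu) = 0 := by
  by_cases hc : c = .ES ∨ c = .SIF
  · exact integral_eq_zero_of_flip μ _ (dataIdx M k hL ht) fun p => by
      rw [comp_signFlip hL par k ht hc]; simp
  · push Not at hc
    simp_rw [comp, Sample.component_eq_sum par k _ hc.1 hc.2]
    have hm : ∀ τ ∈ Term.ofKind (M := M) k c, IsMono _ _ _ := fun τ hτ => Term.isMono_val par k ht
      (Term.proper_of_kind k (by simpa [Term.ofKind] using hτ) hc.1)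
    rw [integral_finsetSum _ fun τ hτ => (hm τ hτ).memLp.integrable (by norm_num)]
    exact Finset.sum_eq_zero fun τ hτ => (hm τ hτ).integral_eq_zero
      ⟨_, (τ.exists_mem_supp k ht).choose_spec.1⟩

include hL ht in
-- Each term of the other component is odd in some gain or noise sample, while ES and SIF are even
-- in it.
theorem integral_signal_mul_conj_sum {c c' : Component} (hc : c = .ES ∨ c = .SIF)
    (h1 : c' ≠ .ES) (h2 : c' ≠ .SIF) :
    ∫ p, comp par k M Nu t c p * (starRingEnd ℂ) (comp par k M Nu t c' p)
      ∂(sampleLaw par μ M Nu) = 0 := by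
  have hm : ∀ τ ∈ Term.ofKind (M := M) k c', IsMono _ _ _ := fun τ hτ => Term.isMono_val par k ht
    (Term.proper_of_kind k (by simpa [Term.ofKind] using hτ) h1)
  have h := integral_sum_mul_conj_sum (P := sampleLaw par μ M Nu)
    (F := fun _ : Unit => comp par k M Nu t c) {()} (Term.ofKind (M := M) k c')
    (fun _ _ => comp_memLp hL par k ht μ c) (fun τ hτ => (hm τ hτ).memLp)
  simp only [Finset.sum_singleton] at h
  simp_rw [comp, Sample.component_eq_sum par k _ h1 h2]
  refine h.trans (Finset.sum_eq_zero fun τ hτ => ?_)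
  obtain ⟨i, hi, hi'⟩ := τ.exists_mem_supp k ht
  refine integral_mul_conj_eq_zero_of_flip i (s := 1) (by simp) (fun p => ?_) fun p => ?_
  · rw [comp_signFlip hL par k ht hc, if_neg (show i ≠ dataIdx M k hL ht from hi' _)]
  · rw [(hm τ hτ).map_flip, if_pos hi]

include hL ht hμ in
-- The symbol has unit power and is independent of A, so E[A x x̄] = E[A] and ES is the orthogonal
-- projection of A x on the symbol. The power of SIF is then the difference of the powers of A x and
-- ES.
theorem integral_ES_mul_conj_SIF :
    ∫ p, comp par k M Nu t .SIF p * (starRingEnd ℂ) (comp par k M Nu t .ES p)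
      ∂(sampleLaw par μ M Nu) = 0 ∧
    ∫ p, ‖comp par k M Nu t .ES p‖ ^ 2 ∂(sampleLaw par μ M Nu) = tableVariance par M k t .ES ∧
    ∫ p, ‖comp par k M Nu t .SIF p‖ ^ 2 ∂(sampleLaw par μ M Nu) =
      tableVariance par M k t .SIF := by
  obtain ⟨hA, hA2⟩ := gain_mul_moments (M := M) hL par k ht μ
  have hES := comp_memLp (M := M) hL par k ht μ .ES
  have hSIF := comp_memLp (M := M) hL par k ht μ .SIF
  have h1 : ∫ p, ‖comp par k M Nu t .ES p‖ ^ 2 ∂(sampleLaw par μ M Nu) =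
      meanGainVal par k M t ^ 2 := by
    simp only [Sample.component, norm_mul, mul_pow, Complex.norm_real, Real.norm_eq_abs, sq_abs,
      Sample.x_eq hL k ht]
    rw [integral_const_mul, sampleLaw, integral_norm_sq_coord]
    simp [idxVar, dataIdx]
  have h2 : ∫ p : Sample M K L Nu, p.toRealization.gain par k t * p.toRealization.x k t *
      (starRingEnd ℂ) (comp par k M Nu t .ES p) ∂(sampleLaw par μ M Nu) =
      (meanGainVal par k M t : ℂ) ^ 2 := by
    have := integral_gain_mul_conj (M := M) hL par k ht μ hμ
    simp only [Sample.component, map_mul, Complex.conj_ofReal]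
    simp_rw [mul_left_comm _ (meanGainVal par k M t : ℂ)]
    rw [integral_const_mul, this, sq]
  have h3 : ∫ p, comp par k M Nu t .SIF p * (starRingEnd ℂ) (comp par k M Nu t .ES p)
      ∂(sampleLaw par μ M Nu) = 0 := by
    simp_rw [comp_SIF, sub_mul]
    rw [integral_sub (MemLp.integrable_mul_conj hA hES) (MemLp.integrable_mul_conj hES hES), h2,
      integral_mul_conj_self (fun p => comp par k M Nu t .ES p), h1]
    simp
  refine ⟨h3, h1.trans (meanGainVal_sq par k M), ?_⟩
  have h4 : ∫ p : Sample M K L Nu, ‖p.toRealization.gain par k t * p.toRealization.x k t‖ ^ 2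
      ∂(sampleLaw par μ M Nu) = ∫ p, ‖comp par k M Nu t .ES p‖ ^ 2 ∂(sampleLaw par μ M Nu) +
        ∫ p, ‖comp par k M Nu t .SIF p‖ ^ 2 ∂(sampleLaw par μ M Nu) := by
    have h5 : ∫ p, comp par k M Nu t .ES p * (starRingEnd ℂ) (comp par k M Nu t .SIF p)
        ∂(sampleLaw par μ M Nu) = 0 := by
      have := congrArg (starRingEnd ℂ) h3
      rw [← integral_conj] at this
      simpa [mul_comm] using this
    have := integral_norm_sq_sum_of_orthogonal (P := sampleLaw par μ M Nu)
      (F := fun b : Bool => comp par k M Nu t (if b then .ES else .SIF)) Finset.univ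
      (fun b _ => comp_memLp hL par k ht μ _) (by
        intro b _ b' _ hb
        cases b <;> cases b' <;> simp_all)
    simp only [Fintype.univ_bool, Finset.mem_singleton, Bool.true_eq_false, not_false_eq_true,
      Finset.sum_insert, Finset.sum_singleton, if_true, Bool.false_eq_true, if_false] at this
    rw [← this]
    simp [comp_SIF]
  rw [hA2, h1] at h4
  have h6 := meanGainVal_sq par k M (t := t)
  simp only [tableVariance] at h6 ⊢
  linarith

include hL ht hμ in
-- Three cases: both among ES and SIF, exactly one of them, or neither. In the last case different
-- components have no term in common, and distinct terms have distinct supports.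
theorem integral_comp_mul_conj {c c' : Component} (hc : c ≠ c') :
    ∫ p, comp par k M Nu t c p * (starRingEnd ℂ) (comp par k M Nu t c' p)
      ∂(sampleLaw par μ M Nu) = 0 := by
  have hsymm : ∀ c c', ∫ p, comp par k M Nu t c p * (starRingEnd ℂ) (comp par k M Nu t c' p)
      ∂(sampleLaw par μ M Nu) = 0 → ∫ p, comp par k M Nu t c' p *
        (starRingEnd ℂ) (comp par k M Nu t c p) ∂(sampleLaw par μ M Nu) = 0 := fun c c' h => by
    have := congrArg (starRingEnd ℂ) h
    rw [← integral_conj] at this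
    simpa [mul_comm] using this
  by_cases h1 : c = .ES ∨ c = .SIF <;> by_cases h2 : c' = .ES ∨ c' = .SIF
  · have h := (integral_ES_mul_conj_SIF (M := M) hL par k ht μ hμ).1
    rcases h1 with rfl | rfl <;> rcases h2 with rfl | rfl
    · exact absurd rfl hc
    · exact hsymm _ _ h
    · exact h
    · exact absurd rfl hc
  · push Not at h2
    exact integral_signal_mul_conj_sum hL par k ht μ h1 h2.1 h2.2
  · push Not at h1
    exact hsymm _ _ (integral_signal_mul_conj_sum hL par k ht μ h2 h1.1 h1.2)
  · push Not at h1 h2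
    have hk : ∀ c : Component, ∀ τ ∈ Term.ofKind (M := M) (L := L) k c, τ.kind k = c :=
      fun c τ hτ => by simpa [Term.ofKind] using hτ
    have hm : ∀ c : Component, c ≠ .ES → ∀ τ ∈ Term.ofKind (M := M) k c, IsMono _ _ _ :=
      fun c hc τ hτ => Term.isMono_val par k ht (Term.proper_of_kind k (hk c τ hτ) hc)
    have h := integral_sum_mul_conj_sum (P := sampleLaw par μ M Nu) (Term.ofKind (M := M) k c)
      (Term.ofKind (M := M) k c') (fun τ hτ => (hm c h1.1 τ hτ).memLp)
      (fun τ hτ => (hm c' h2.1 τ hτ).memLp)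
    simp_rw [comp, Sample.component_eq_sum par k _ h1.1 h1.2,
      Sample.component_eq_sum par k _ h2.1 h2.2]
    refine h.trans (Finset.sum_eq_zero fun τ hτ => Finset.sum_eq_zero fun τ' hτ' => ?_)
    refine (hm c h1.1 τ hτ).integral_mul_conj (hm c' h2.1 τ' hτ') fun he => hc ?_
    rw [← hk c τ hτ, ← hk c' τ' hτ', Term.supp_injective k ht
      (Term.proper_of_kind k (hk c τ hτ) h1.1) (Term.proper_of_kind k (hk c' τ' hτ') h2.1) he]

include hL ht hμ in
theorem integral_norm_sq_comp (c : Component) :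
    ∫ p, ‖comp par k M Nu t c p‖ ^ 2 ∂(sampleLaw par μ M Nu) = tableVariance par M k t c := by
  have hsum : ∀ c : Component, c ≠ .ES → c ≠ .SIF →
      ∫ p, ‖comp par k M Nu t c p‖ ^ 2 ∂(sampleLaw par μ M Nu) =
        ∑ τ ∈ Term.ofKind (M := M) k c, τ.power par k := fun c h1 h2 => by
    have hp : ∀ τ ∈ Term.ofKind (M := M) (L := L) k c, τ.Proper k := fun τ hτ =>
      Term.proper_of_kind k (by simpa [Term.ofKind] using hτ) h1
    have hm : ∀ τ ∈ Term.ofKind (M := M) k c, IsMono _ _ _ := fun τ hτ =>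
      Term.isMono_val par k ht (hp τ hτ)
    simp_rw [comp, Sample.component_eq_sum par k _ h1 h2]
    rw [integral_norm_sq_sum_of_orthogonal _ fun τ hτ => (hm τ hτ).memLp]
    · exact Finset.sum_congr rfl fun τ hτ => (hm τ hτ).integral_norm_sq.trans
        (Term.coefSq_mul_prod par k ht (hp τ hτ))
    · exact fun τ hτ τ' hτ' hne => (hm τ hτ).integral_mul_conj (hm τ' hτ') fun he =>
        hne (Term.supp_injective k ht (hp τ hτ) (hp τ' hτ') he)
  obtain ⟨h1, h2, h3⟩ := Term.sum_power (M := M) par k (t := t)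
  cases c with
  | ES => exact (integral_ES_mul_conj_SIF (M := M) hL par k ht μ hμ).2.1
  | SIF => exact (integral_ES_mul_conj_SIF (M := M) hL par k ht μ hμ).2.2
  | ISI => exact (hsum _ (by simp) (by simp)).trans h1
  | MUI => exact (hsum _ (by simp) (by simp)).trans h2
  | EN => exact (hsum _ (by simp) (by simp)).trans (h3 hL)

end Moments

/-! ### The lower bound on mutual information -/

section Information

variable {α : Type*} [MeasurableSpace α]

/-- The Donsker–Varadhan lower bound for a normalized exponent. -/
theorem ofReal_integral_le_klDiv {μ ν : Measure α} [IsProbabilityMeasure μ]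
    [IsProbabilityMeasure ν] {f : α → ℝ} (hf : Integrable f μ)
    (he : Integrable (fun x => Real.exp (f x)) ν) (h1 : ∫ x, Real.exp (f x) ∂ν = 1) :
    ENNReal.ofReal (∫ x, f x ∂μ) ≤ InformationTheory.klDiv μ ν := by
  by_cases hk : InformationTheory.klDiv μ ν = ⊤
  · simp [hk]
  obtain ⟨hac, hint⟩ := InformationTheory.klDiv_ne_top_iff.1 hk
  rw [InformationTheory.klDiv_of_ac_of_integrable hac hint]
  refine ENNReal.ofReal_le_ofReal ?_
  -- Gibbs' inequality is applied to μ and the law with density proportional to exp f with respect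
  -- to ν. This divergence is that of μ from ν minus the μ-mean of f, plus the logarithm of the
  -- normalizer, which is 0 here.
  have := isProbabilityMeasure_tilted he
  have h2 := InformationTheory.integral_llr_add_sub_measure_univ_nonneg
    (hac.trans (absolutelyContinuous_tilted he)) (integrable_llr_tilted_right hac hf hint he)
  rw [integral_llr_tilted_right hac hf he hint, h1] at h2
  simp only [Real.log_one, probReal_univ] at h2 ⊢
  linarith

variable {P : Measure α} {X Y : α → ℂ}

theorem integrable_infoDensity [IsProbabilityMeasure P] (a v : ℝ) (hX : MemLp X 2 P)
    (hY : MemLp Y 2 P) : Integrable (fun w => infoDensity a v (X w) (Y w)) P ∧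
    ∫ w, infoDensity a v (X w) (Y w) ∂P = Real.log ((a ^ 2 + v) / v) -
      (∫ w, ‖Y w - a * X w‖ ^ 2 ∂P) / v + (∫ w, ‖Y w‖ ^ 2 ∂P) / (a ^ 2 + v) := by
  have h1 : Integrable (fun w => ‖Y w - a * X w‖ ^ 2) P :=
    (hY.sub (hX.const_mul (a : ℂ))).integrable_norm_pow (by norm_num)
  have h2 : Integrable (fun w => ‖Y w‖ ^ 2) P := hY.integrable_norm_pow (by norm_num)
  have h3 : Integrable (fun w => Real.log ((a ^ 2 + v) / v) - ‖Y w - a * X w‖ ^ 2 / v) P :=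
    (integrable_const _).sub (h1.div_const v)
  refine ⟨h3.add (h2.div_const _), ?_⟩
  simp only [infoDensity]
  rw [integral_add h3 (h2.div_const _), integral_sub (integrable_const _) (h1.div_const v),
    integral_div, integral_div]
  simp

/-- The Gaussian metric is a test function whose exponential is normalized under the product law. In
its mean under the joint law the two quadratic parts contribute -1 and +1, leaving the logarithm.
Independence of Y - a X and X is never used. -/
theorem ofReal_logb_le_mutualInfoBits [IsProbabilityMeasure P] (hXm : Measurable X)
    (hYm : Measurable Y) (hlaw : P.map X = complexGaussian 1) (hX : MemLp X 2 P)
    (hY : MemLp Y 2 P) {a v : ℝ} (hv : 0 < v) (h1 : ∫ w, ‖Y w‖ ^ 2 ∂P = a ^ 2 + v)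
    (h2 : ∫ w, ‖Y w - a * X w‖ ^ 2 ∂P = v) :
    ENNReal.ofReal (Real.logb 2 ((a ^ 2 + v) / v)) ≤ mutualInfoBits P X Y := by
  have hav : 0 < a ^ 2 + v := by positivity
  have hXY : Measurable fun w => (X w, Y w) := hXm.prodMk hYm
  have := Measure.isProbabilityMeasure_map (μ := P) hXY.aemeasurable
  have := Measure.isProbabilityMeasure_map (μ := P) hYm.aemeasurable
  have hm := measurable_infoDensity a v
  have hme : Measurable fun p : ℂ × ℂ => ENNReal.ofReal (Real.exp (infoDensity a v p.1 p.2)) :=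
    (Real.measurable_exp.comp hm).ennreal_ofReal
  obtain ⟨hi, hI⟩ := integrable_infoDensity a v hX hY
  have hl : ∫⁻ p, ENNReal.ofReal (Real.exp (infoDensity a v p.1 p.2))
      ∂((complexGaussian 1).prod (P.map Y)) = 1 := by
    rw [lintegral_prod_symm' _ hme]
    simp [lintegral_exp_infoDensity a hv]
  have he : Integrable (fun p : ℂ × ℂ => Real.exp (infoDensity a v p.1 p.2))
      ((complexGaussian 1).prod (P.map Y)) := by
    refine ⟨(Real.measurable_exp.comp hm).aestronglyMeasurable, ?_⟩
    rw [hasFiniteIntegral_iff_ofReal (Filter.Eventually.of_forall fun p => (Real.exp_pos _).le), hl]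
    exact ENNReal.one_lt_top
  have h := ofReal_integral_le_klDiv (μ := P.map fun w => (X w, Y w))
    (f := fun p => infoDensity a v p.1 p.2)
    ((integrable_map_measure hm.aestronglyMeasurable hXY.aemeasurable).2 hi) he (by
      rw [integral_eq_lintegral_of_nonneg_ae (Filter.Eventually.of_forall fun p =>
        (Real.exp_pos _).le) (Real.measurable_exp.comp hm).aestronglyMeasurable, hl,
        ENNReal.toReal_one])
  rw [integral_map hXY.aemeasurable hm.aestronglyMeasurable, hI, h1, h2, div_self hv.ne',
    div_self hav.ne', sub_add_cancel] at h
  rw [mutualInfoBits, hlaw, Real.logb, ENNReal.ofReal_div_of_pos (Real.log_pos (by norm_num))]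
  exact ENNReal.div_le_div_right h _

end Information

/-! ### Transfer of the moments to the model -/

namespace Model

variable {M K L Nu : ℕ} {par : Params K L} {Ω : Type*} [MeasurableSpace Ω] {P : Measure Ω}
  (U : Model M K L Nu par P)

/-- The CFOs and their estimates. -/
def cfoPair (a : Ω) : Fin K → ℝ × ℝ := fun k => (U.cfo k a, U.cfoHat k a)

/-- The Gaussian variables. -/
def gaussians (i : Idx M K L Nu) : Ω → ℂ :=
  Sum.elim (fun j => U.h j.1 j.2.1 j.2.2) (Sum.elim (fun j => U.w j.1 j.2) (fun j => U.x j.1 j.2)) i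

/-- The random variables of the model as one random element of the sample space. -/
def sample (a : Ω) : Sample M K L Nu := (U.cfoPair a, fun i => U.gaussians i a)

theorem measurable_cfoPair : Measurable U.cfoPair :=
  measurable_pi_lambda _ fun k => (U.measurable_cfo k).prodMk (U.measurable_cfoHat k)

theorem measurable_gaussians (i : Idx M K L Nu) : Measurable (U.gaussians i) := by
  rcases i with i | i | i
  · exact U.measurable_h _ _ _
  · exact U.measurable_w _ _
  · exact U.measurable_x _ _

theorem measurable_sample : Measurable U.sample :=
  U.measurable_cfoPair.prodMk (measurable_pi_lambda _ U.measurable_gaussians)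

theorem agree_sample (a : Ω) : (U.realization a).Agree Nu (U.sample a).toRealization where
  h := rfl
  cfo := rfl
  cfoHat := rfl
  w m s hs := by simp [Sample.toRealization, realization, sample, gaussians, hs]
  x q s hs := by
    have hs' := hs
    simp only [Set.mem_Ico] at hs'
    simp [Sample.toRealization, realization, sample, gaussians, hs']

variable [IsProbabilityMeasure P]

instance : IsProbabilityMeasure (P.map U.cfoPair) :=
  Measure.isProbabilityMeasure_map U.measurable_cfoPair.aemeasurable

/-- The two independence hypotheses and the marginal laws together say that the joint law is a
product. All moments can therefore be computed on the concrete sample space. -/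
theorem measurePreserving_sample :
    MeasurePreserving U.sample P (sampleLaw par (P.map U.cfoPair) M Nu) := by
  refine ⟨U.measurable_sample, ?_⟩
  have h1 := (indepFun_iff_map_prod_eq_prod_map_map U.measurable_cfoPair.aemeasurable
    (measurable_pi_lambda _ U.measurable_gaussians).aemeasurable).1 U.indep_cfo
  have h2 := (iIndepFun_iff_map_fun_eq_pi_map
    fun i => (U.measurable_gaussians i).aemeasurable).1 U.indep
  refine h1.trans ?_
  rw [sampleLaw, jointLaw]
  congr 1
  refine h2.trans ?_
  congr 1
  funext i
  rcases i with i | i | i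
  · exact U.law_h _ _ _
  · exact U.law_w _ _ i.2.2
  · exact U.law_x _ _ i.2.2.1 i.2.2.2

theorem map_cfoPair (k : Fin K) : (P.map U.cfoPair).map (fun γ => (γ k).2 - (γ k).1) =
    gaussianReal 0 (par.cfoVar k) := by
  rw [Measure.map_map (by fun_prop) U.measurable_cfoPair]
  exact U.law_cfoErr k

variable (hL : 0 < L) (k : Fin K) {t : ℕ} (ht : t ∈ dataTimes K L Nu)

theorem meanGain_eq : U.meanGain k t = (meanGainVal par k M t : ℂ) := by
  rw [meanGain, ← integral_gain par k (P.map U.cfoPair) U.map_cfoPair (Nu := Nu),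
    ← U.measurePreserving_sample.map_eq, integral_map U.measurable_sample.aemeasurable
      (measurable_gain par k).aestronglyMeasurable]
  simp_rw [(U.agree_sample _).gain par k]

include hL ht in
theorem component_eq (c : Component) (a : Ω) :
    U.component k t c a = comp par k M Nu t c (U.sample a) := by
  have hS := U.agree_sample a
  have hx := hS.x k t (data_time_mem k.pos hL ht)
  cases c with
  | ES =>
    change U.meanGain k t * _ = (meanGainVal par k M t : ℂ) * _
    rw [meanGain_eq]
    exact congrArg _ hx
  | SIF =>
    change ((U.realization a).gain par k t - U.meanGain k t) * _ =
      ((U.sample a).toRealization.gain par k t - (meanGainVal par k M t : ℂ)) * _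
    rw [meanGain_eq, hS.gain par k]
    exact congrArg _ hx
  | ISI => exact hS.isi par k ht
  | MUI => exact hS.mui par k ht
  | EN => exact hS.en par k ht

include hL ht in
theorem memLp_component (c : Component) : MemLp (U.component k t c) 2 P := by
  have h := (comp_memLp (M := M) hL par k ht (P.map U.cfoPair) c).comp_measurePreserving
    U.measurePreserving_sample
  refine h.congr_norm (h.1.congr (Filter.Eventually.of_forall fun a => ?_))
    (Filter.Eventually.of_forall fun a => ?_)
  · exact (U.component_eq hL k ht c a).symm
  · rw [U.component_eq hL k ht c a]; rfl

include hL ht in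
theorem integral_component (c : Component) : ∫ a, U.component k t c a ∂P = 0 := by
  simp_rw [U.component_eq hL k ht c]
  rw [← integral_map U.measurable_sample.aemeasurable
    (by rw [U.measurePreserving_sample.map_eq]; exact (comp_memLp hL par k ht _ c).1),
    U.measurePreserving_sample.map_eq]
  exact integral_comp_eq_zero hL par k ht _ c

include hL ht in
theorem integral_component_mul_conj {c c' : Component} (hc : c ≠ c') :
    ∫ a, U.component k t c a * (starRingEnd ℂ) (U.component k t c' a) ∂P = 0 := by
  simp_rw [U.component_eq hL k ht]
  have h := integral_comp_mul_conj (M := M) hL par k ht (P.map U.cfoPair) U.map_cfoPair hc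
  rw [← U.measurePreserving_sample.map_eq, integral_map U.measurable_sample.aemeasurable
    (by rw [U.measurePreserving_sample.map_eq]; exact (MemLp.integrable_mul_conj
      (comp_memLp hL par k ht _ c) (comp_memLp hL par k ht _ c')).1)] at h
  exact h

include hL ht in
theorem integral_norm_sq_component (c : Component) :
    ∫ a, ‖U.component k t c a‖ ^ 2 ∂P = tableVariance par M k t c := by
  simp_rw [U.component_eq hL k ht]
  have h := integral_norm_sq_comp (M := M) hL par k ht (P.map U.cfoPair) U.map_cfoPair c
  rw [← U.measurePreserving_sample.map_eq, integral_map U.measurable_sample.aemeasurable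
    (by rw [U.measurePreserving_sample.map_eq]; exact
      ((comp_memLp hL par k ht _ c).integrable_norm_pow (by norm_num)).1)] at h
  exact h

/-- Power of the noise and interference. -/
def _root_.TRMRC.noisePower {K L : ℕ} (par : Params K L) (M : ℕ) (k : Fin K) (t : ℕ) : ℝ :=
  tableVariance par M k t .SIF + tableVariance par M k t .ISI +
    tableVariance par M k t .MUI + tableVariance par M k t .EN

include hL ht in
theorem integral_norm_sq_sum_component (s : Finset Component) :
    ∫ a, ‖∑ c ∈ s, U.component k t c a‖ ^ 2 ∂P = ∑ c ∈ s, tableVariance par M k t c := by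
  rw [integral_norm_sq_sum_of_orthogonal s (fun c _ => U.memLp_component hL k ht c)
    fun c _ c' _ hc => U.integral_component_mul_conj hL k ht hc]
  exact Finset.sum_congr rfl fun c _ => U.integral_norm_sq_component hL k ht c

theorem output_eq (a : Ω) : U.output k t a = U.component k t .ES a + U.totalNoise k t a := by
  simp only [totalNoise, component, output, Realization.en, realization]
  ring

include hL ht in
theorem integral_norm_sq_totalNoise :
    ∫ a, ‖U.totalNoise k t a‖ ^ 2 ∂P = noisePower par M k t := by
  classical
  have h := U.integral_norm_sq_sum_component hL k ht {.SIF, .ISI, .MUI, .EN}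
  simpa [add_assoc, totalNoise, noisePower] using h

include hL ht in
theorem integral_norm_sq_output :
    ∫ a, ‖U.output k t a‖ ^ 2 ∂P = meanGainVal par k M t ^ 2 + noisePower par M k t := by
  classical
  have h := U.integral_norm_sq_sum_component hL k ht {.ES, .SIF, .ISI, .MUI, .EN}
  rw [meanGainVal_sq]
  simpa [add_assoc, output_eq, totalNoise, noisePower] using h

include hL ht in
theorem memLp_output : MemLp (U.output k t) 2 P := by
  have h := ((((U.memLp_component hL k ht .SIF).add (U.memLp_component hL k ht .ISI)).add
    (U.memLp_component hL k ht .MUI)).add (U.memLp_component hL k ht .EN))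
  have h2 := (U.memLp_component hL k ht .ES).add h
  have : U.output k t = U.component k t .ES + (U.component k t .SIF + U.component k t .ISI +
      U.component k t .MUI + U.component k t .EN) := funext fun a => U.output_eq k a
  rwa [this]

end Model

/-! ### The closed form of the SINR -/

section Sinr

variable {M K L : ℕ} (hM : 0 < M) (hL : 0 < L) (par : Params K L) (k : Fin K) (t : ℕ)

/-- The sums of σ⁴ in SIF and ISI cancel, and the term θ_k² of ISI supplies the missing summand q =
k of MUI. -/
theorem noisePower_eq : noisePower par M k t =
    (M : ℝ) ^ 2 * par.pu * par.theta k ^ 2 * (1 - par.decay k t) +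
      M * par.pu * par.theta k * (∑ q, par.theta q) +
      (M * (par.noiseVar : ℝ) / K * (∑ q, par.theta q) +
      M * (par.noiseVar : ℝ) ^ 2 / (K * par.pu) + M * (par.noiseVar : ℝ) * par.theta k) := by
  rw [noisePower, ← Finset.add_sum_erase _ _ (Finset.mem_univ k)]
  simp only [tableVariance, ← Finset.add_sum_erase _ par.theta (Finset.mem_univ k)]
  ring

include hL in
theorem theta_pos : 0 < par.theta k :=
  Finset.sum_pos (fun l _ => par.pdp_pos k l) ⟨⟨0, hL⟩, Finset.mem_univ _⟩

include hM hL in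
theorem noisePower_pos : 0 < noisePower par M k t := by
  have h1 : 0 ≤ 1 - par.decay k t := by
    rw [sub_nonneg, Params.decay, Real.exp_le_one_iff, neg_nonpos]
    positivity
  have h2 : ∀ q, 0 < par.theta q := theta_pos hL par
  have h3 : 0 ≤ ∑ q, par.theta q := Finset.sum_nonneg fun q _ => (h2 q).le
  have h4 := h2 k
  have h5 := par.pu_pos
  have h6 : (0 : ℝ) < par.noiseVar := par.noiseVar_pos
  have h7 : (0 : ℝ) < M := by exact_mod_cast hM
  rw [noisePower_eq]
  positivity

include hM hL in
theorem sinr_eq : tableVariance par M k t .ES / noisePower par M k t =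
    par.sinrFormula M k t := by
  have h4 := theta_pos hL par k
  have h5 := par.pu_pos
  have h6 : (0 : ℝ) < par.noiseVar := par.noiseVar_pos
  have h7 : (0 : ℝ) < M := by exact_mod_cast hM
  have h8 : (0 : ℝ) < K := by exact_mod_cast k.pos
  -- The common factor M² p_u θ_k² is the power of ES without the decay.
  have hd : noisePower par M k t = (M : ℝ) ^ 2 * par.pu * par.theta k ^ 2 *
      ((1 - par.decay k t) + 1 / (M * K * par.gamma k ^ 2) + par.c1 k / (M * par.gamma k) +
      par.c2 k / M) := by
    rw [noisePower_eq, Params.gamma, Params.c1, Params.c2]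
    field_simp
    ring
  rw [hd, Params.sinrFormula, tableVariance]
  exact mul_div_mul_left _ _ (by positivity)

end Sinr

/-! ### Product measures: selection of coordinates, law of large numbers, Chernoff bound -/

section ProductMeasures

variable {ι ι' : Type*} [Fintype ι] [Fintype ι'] {α β δ : Type*} [MeasurableSpace α]
  [MeasurableSpace β] [MeasurableSpace δ]

/-- Distinct coordinates stay independent. This is used to pick codewords out of a random codebook
and to replace some variables by fresh ones. -/
theorem measurePreserving_pi_comp_injective (ν : ι → Measure α) [∀ i, IsProbabilityMeasure (ν i)]
    {e : ι' → ι} (he : Function.Injective e) :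
    MeasurePreserving (fun (z : ι → α) (i : ι') => z (e i)) (Measure.pi ν)
      (Measure.pi fun i => ν (e i)) := by
  refine ⟨by fun_prop, ?_⟩
  rw [← Measure.infinitePi_eq_pi, ← Measure.infinitePi_eq_pi]
  exact Measure.map_infinitePi_infinitePi_of_inj he

/-- Codebook columns and coherence intervals are independent across i, so a statement about one
interval lifts to n of them. -/
theorem measurePreserving_pi_pair {μ : Measure α} {ν : Measure β} {κ : Measure δ}
    [IsProbabilityMeasure μ] [IsProbabilityMeasure ν] [IsProbabilityMeasure κ]
    {G : α × β → δ} (hG : MeasurePreserving G (μ.prod ν) κ) :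
    MeasurePreserving (fun (z : (ι → α) × (ι → β)) i => G (z.1 i, z.2 i))
      ((Measure.pi fun _ => μ).prod (Measure.pi fun _ => ν)) (Measure.pi fun _ : ι => κ) :=
  (measurePreserving_pi (fun _ : ι => μ.prod ν) (fun _ => κ) fun _ => hG).comp
    (measurePreserving_arrowProdEquivProdArrow α β ι (fun _ => μ) (fun _ => ν)).symm

/-- Weak law of large numbers on finite powers, one-sided. -/
theorem tendsto_measure_sum_le {κ : Measure δ} [IsProbabilityMeasure κ] {g : δ → ℝ}
    (hg : Measurable g) (hi : Integrable g κ) {r : ℝ} (hr : r < ∫ z, g z ∂κ) :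
    Filter.Tendsto (fun n : ℕ => (Measure.pi fun _ : Fin n => κ) {z | ∑ i, g (z i) ≤ n * r})
      Filter.atTop (nhds 0) := by
  -- All finite powers are marginals of one infinite product, where the strong law holds. Almost
  -- sure convergence then gives convergence in measure.
  let ν := Measure.infinitePi fun _ : ℕ => κ
  have hmp := fun i : ℕ => measurePreserving_eval_infinitePi (fun _ : ℕ => κ) i
  have hind : iIndepFun (fun (i : ℕ) (w : ℕ → δ) => g (w i)) ν :=
    iIndepFun_infinitePi (X := fun _ => g) fun _ => hg
  have hid : ∀ i, IdentDistrib (fun w : ℕ → δ => g (w i)) (fun w => g (w 0)) ν ν := fun i =>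
    ⟨(hg.comp (measurable_pi_apply i)).aemeasurable, (hg.comp (measurable_pi_apply 0)).aemeasurable, by
      have h := fun j => Measure.map_map (μ := ν) hg (measurable_pi_apply (X := fun _ => δ) j)
      simp only [Function.comp_def] at h
      rw [← h, ← h]
      exact congrArg _ ((hmp i).map_eq.trans (hmp 0).map_eq.symm)⟩
  have hm : ∫ w, g (w 0) ∂ν = ∫ z, g z ∂κ := by
    rw [← (hmp 0).map_eq, integral_map (hmp 0).measurable.aemeasurable hg.aestronglyMeasurable]
  have hsl := strong_law_ae_real (fun (i : ℕ) (w : ℕ → δ) => g (w i))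
    ((hmp 0).integrable_comp_of_integrable hi) (fun i j hij => hind.indepFun hij) hid
  have htm := tendstoInMeasure_of_tendsto_ae (μ := ν)
    (f := fun (n : ℕ) w => (∑ i ∈ Finset.range n, g (w i)) / n)
    (fun n => Measurable.aestronglyMeasurable (by fun_prop)) hsl
  rw [tendstoInMeasure_iff_norm] at htm
  refine tendsto_of_tendsto_of_tendsto_of_le_of_le' tendsto_const_nhds
    (htm (∫ z, g z ∂κ - r) (by linarith)) (Filter.Eventually.of_forall fun _ => bot_le)
    (Filter.eventually_atTop.2 ⟨1, fun n hn => ?_⟩)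
  have hmeas : MeasurableSet {z : Fin n → δ | ∑ i, g (z i) ≤ n * r} :=
    measurableSet_le (by fun_prop) (by fun_prop)
  have hpi : ν.map (fun w (i : Fin n) => w i) = Measure.pi fun _ : Fin n => κ := by
    rw [← Measure.infinitePi_eq_pi]
    exact Measure.map_infinitePi_infinitePi_of_inj Fin.val_injective
  rw [← hpi, Measure.map_apply (by fun_prop) hmeas]
  refine measure_mono fun w hw => ?_
  have hn' : (0 : ℝ) < n := by exact_mod_cast hn
  simp only [Set.mem_preimage, Set.mem_ofPred_eq] at hw ⊢
  rw [Fin.sum_univ_eq_sum_range (fun i => g (w i))] at hw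
  have h1 : (∑ i ∈ Finset.range n, g (w i)) / n ≤ r := by
    rw [div_le_iff₀ hn']; linarith
  rw [hm, Real.norm_eq_abs, abs_sub_comm]
  exact le_trans (by linarith) (le_abs_self _)

/-- Chernoff's bound on finite powers. -/
theorem measure_lt_sum_le {κ : Measure δ} [IsProbabilityMeasure κ] {g : δ → ℝ}
    (hi : Integrable (fun z => Real.exp (g z)) κ) (h1 : ∫ z, Real.exp (g z) ∂κ = 1)
    (n : ℕ) (r : ℝ) :
    (Measure.pi fun _ : Fin n => κ) {z | n * r < ∑ i, g (z i)} ≤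
      ENNReal.ofReal (Real.exp (-(n * r))) := by
  have hI := Integrable.fintype_prod (μ := fun _ : Fin n => κ)
    (f := fun _ z => Real.exp (g z)) fun _ => hi
  have hJ := integral_fintype_prod_eq_prod (μ := fun _ : Fin n => κ)
    (fun _ z => Real.exp (g z))
  simp only [h1, Finset.prod_const_one] at hJ
  -- Markov's inequality for the product of the exp(g), whose mean is 1.
  have h := mul_meas_ge_le_integral_of_nonneg (Filter.Eventually.of_forall fun z =>
    Finset.prod_nonneg fun i _ => (Real.exp_pos _).le) hI (Real.exp (n * r))
  rw [hJ] at h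
  have hs : (Measure.pi fun _ : Fin n => κ).real {z | n * r < ∑ i, g (z i)} ≤
      (Measure.pi fun _ : Fin n => κ).real {z | Real.exp (n * r) ≤ ∏ i, Real.exp (g (z i))} := by
    refine measureReal_mono fun z hz => ?_
    simp only [Set.mem_ofPred_eq] at hz ⊢
    rw [← Real.exp_sum]
    exact Real.exp_le_exp.2 hz.le
  rw [← ofReal_measureReal]
  refine ENNReal.ofReal_le_ofReal (hs.trans ?_)
  rw [Real.exp_neg, inv_eq_one_div, le_div_iff₀ (Real.exp_pos _), mul_comm]
  exact h

end ProductMeasures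

/-! ### Replacement and scaling of the data symbols -/

namespace Realization

variable {M K L : ℕ} (S : Realization M K L) (par : Params K L)

/-- The output is affine in the symbols. -/
theorem output_affine (x₀ x₁ : Fin K → ℕ → ℂ) (s : ℂ) (k : Fin K) (t : ℕ) :
    ({S with x := fun q n => (1 - s) * x₀ q n + s * x₁ q n} : Realization M K L).output par k t =
      (1 - s) * ({S with x := x₀} : Realization M K L).output par k t +
        s * ({S with x := x₁} : Realization M K L).output par k t := by
  simp only [output, Finset.mul_sum, ← Finset.sum_add_distrib]
  refine Finset.sum_congr rfl fun m _ => Finset.sum_congr rfl fun l _ => ?_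
  have : ({S with x := fun q n => (1 - s) * x₀ q n + s * x₁ q n} : Realization M K L).dataRx par m
      (t + l) = (1 - s) * ({S with x := x₀} : Realization M K L).dataRx par m (t + l) +
        s * ({S with x := x₁} : Realization M K L).dataRx par m (t + l) := by
    simp only [dataRx, mul_add, Finset.mul_sum, add_mul, Finset.sum_add_distrib]
    have e1 : ∀ q l', (Real.sqrt par.pu : ℂ) * (S.h m q l' * ((1 - s) * x₀ q (t + l - l')) *
        phase (S.cfo q * ((t + l : ℕ) : ℝ))) = (1 - s) * ((Real.sqrt par.pu : ℂ) *
          (S.h m q l' * x₀ q (t + l - l') * phase (S.cfo q * ((t + l : ℕ) : ℝ)))) :=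
      fun q l' => by ring
    have e2 : ∀ q l', (Real.sqrt par.pu : ℂ) * (S.h m q l' * (s * x₁ q (t + l - l')) *
        phase (S.cfo q * ((t + l : ℕ) : ℝ))) = s * ((Real.sqrt par.pu : ℂ) *
          (S.h m q l' * x₁ q (t + l - l') * phase (S.cfo q * ((t + l : ℕ) : ℝ)))) :=
      fun q l' => by ring
    simp only [e1, e2]
    ring
  rw [this]
  change (starRingEnd ℂ) (S.chanEst par m k l) * (_ * phase (-(S.cfoHat k * (t + l)))) =
    (1 - s) * ((starRingEnd ℂ) (S.chanEst par m k l) * (_ * phase (-(S.cfoHat k * (t + l))))) +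
    s * ((starRingEnd ℂ) (S.chanEst par m k l) * (_ * phase (-(S.cfoHat k * (t + l)))))
  ring

end Realization

/-- Pairs of a user and a data time. -/
abbrev Slot (K L Nu : ℕ) : Type := Fin K × dataTimes K L Nu

namespace Sample

variable {M K L Nu : ℕ}

/-- Source of each variable after replacement of the data symbols. -/
def source (i : Idx M K L Nu) : Idx M K L Nu ⊕ Slot K L Nu :=
  match i with
  | Sum.inr (Sum.inr (q, s)) =>
    if hs : (s : ℕ) ∈ dataTimes K L Nu then Sum.inr (q, ⟨s, hs⟩) else Sum.inl i
  | _ => Sum.inl i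

/-- The sample with data symbols `c`. -/
def withData (p : Sample M K L Nu) (c : Slot K L Nu → ℂ) : Sample M K L Nu :=
  (p.1, fun i => Sum.elim p.2 c (source i))

theorem source_injective : Function.Injective (source (M := M) (K := K) (L := L) (Nu := Nu)) := by
  intro i j h
  rcases i with i | i | ⟨q, s, hs⟩ <;> rcases j with j | j | ⟨q', s', hs'⟩ <;>
    simp only [source] at h
  · simpa using h
  · simp at h
  · split_ifs at h; simp at h
  · simp at h
  · simpa using h
  · split_ifs at h; simp at h
  · split_ifs at h; simp at h
  · split_ifs at h; simp at h
  · split_ifs at h <;> simp_all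

variable (par : Params K L) (μ : Measure (Fin K → ℝ × ℝ)) [IsProbabilityMeasure μ]

/-- Law of the data symbols of one interval. -/
abbrev dataLaw (τ : Type*) [Fintype τ] : Measure (τ → ℂ) :=
  Measure.pi fun _ : τ => complexGaussian 1

/-- Data symbols are replaced by fresh independent variables with the same law, so the joint law is
unchanged. Hence Gaussian codewords see the same statistics as the model. -/
theorem measurePreserving_withData :
    MeasurePreserving (fun z : Sample M K L Nu × (Slot K L Nu → ℂ) => z.1.withData z.2)
      ((sampleLaw par μ M Nu).prod (dataLaw (Slot K L Nu))) (sampleLaw par μ M Nu) := by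
  let ν : Idx M K L Nu ⊕ Slot K L Nu → Measure ℂ :=
    Sum.elim (fun i => complexGaussian (idxVar par M Nu i)) fun _ => complexGaussian 1
  have hν : ∀ i, IsProbabilityMeasure (ν i) := by
    rintro (i | i) <;> simp only [ν, Sum.elim_inl, Sum.elim_inr] <;> infer_instance
  have h1 := measurePreserving_prodAssoc μ
    (Measure.pi fun i => complexGaussian (idxVar par M Nu i)) (dataLaw (Slot K L Nu))
  have h2 := (measurePreserving_sumPiEquivProdPi_symm (X := fun _ => ℂ) ν)
  have h3 := measurePreserving_pi_comp_injective ν (source_injective (M := M) (K := K) (L := L))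
  have h4 := ((MeasurePreserving.id μ).prod (h3.comp h2)).comp h1
  have e : (fun i => ν (source i)) = fun i => complexGaussian (idxVar par M Nu i) := by
    funext i
    rcases i with i | i | ⟨q, s, hs⟩ <;> simp only [source, ν, Sum.elim_inl]
    split_ifs <;> simp [idxVar]
  rw [e] at h4
  have hfun : (fun z : Sample M K L Nu × (Slot K L Nu → ℂ) => z.1.withData z.2) =
      Prod.map id ((fun (z : Idx M K L Nu ⊕ Slot K L Nu → ℂ) i => z (source i)) ∘
        ⇑(MeasurableEquiv.sumPiEquivProdPi fun _ => ℂ).symm) ∘ ⇑MeasurableEquiv.prodAssoc := by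
    funext z
    refine Prod.ext rfl (funext fun i => ?_)
    change Sum.elim z.1.2 z.2 (source i) = Sum.rec z.1.2 z.2 (source i)
    cases source i <;> rfl
  rw [hfun]
  exact h4

end Sample

/-- The integral is a quadratic polynomial in s - 1. -/
theorem tendsto_integral_norm_sq_add_mul {α : Type*} [MeasurableSpace α] {P : Measure α}
    {F D : α → ℂ} (hF : MemLp F 2 P) (hD : MemLp D 2 P) :
    Filter.Tendsto (fun s : ℝ => ∫ z, ‖F z + ((s : ℂ) - 1) * D z‖ ^ 2 ∂P) (nhds 1)
      (nhds (∫ z, ‖F z‖ ^ 2 ∂P)) := by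
  have h1 : Integrable (fun z => ‖F z‖ ^ 2) P := hF.integrable_norm_pow (by norm_num)
  have h2 : Integrable (fun z => ‖D z‖ ^ 2) P := hD.integrable_norm_pow (by norm_num)
  have h3 : Integrable (fun z => (F z * (starRingEnd ℂ) (D z)).re) P :=
    (MemLp.integrable_mul_conj hF hD).re
  have e : ∀ s : ℝ, ∫ z, ‖F z + ((s : ℂ) - 1) * D z‖ ^ 2 ∂P = ∫ z, ‖F z‖ ^ 2 ∂P +
      (s - 1) ^ 2 * (∫ z, ‖D z‖ ^ 2 ∂P) +
      2 * (s - 1) * ∫ z, (F z * (starRingEnd ℂ) (D z)).re ∂P := fun s => by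
    have h4 : Integrable (fun z => ‖F z‖ ^ 2 + (s - 1) ^ 2 * ‖D z‖ ^ 2) P :=
      h1.add (h2.const_mul _)
    rw [← integral_const_mul, ← integral_const_mul, ← integral_add h1 (h2.const_mul _),
      ← integral_add h4 (h3.const_mul _)]
    congr with z
    rw [← Complex.normSq_eq_norm_sq, Complex.normSq_add, Complex.normSq_mul,
      show ((s : ℂ) - 1) = ((s - 1 : ℝ) : ℂ) by push_cast; rfl, Complex.normSq_ofReal, map_mul,
      Complex.conj_ofReal, mul_left_comm, Complex.re_ofReal_mul, Complex.normSq_eq_norm_sq,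
      Complex.normSq_eq_norm_sq]
    ring
  simp_rw [e]
  have hc : Continuous fun s : ℝ => ∫ z, ‖F z‖ ^ 2 ∂P + (s - 1) ^ 2 * (∫ z, ‖D z‖ ^ 2 ∂P) +
      2 * (s - 1) * ∫ z, (F z * (starRingEnd ℂ) (D z)).re ∂P := by fun_prop
  simpa using hc.tendsto 1

namespace Sample

variable {M K L Nu : ℕ} (par : Params K L)

theorem measurable_output (k : Fin K) (t : ℕ) :
    Measurable fun p : Sample M K L Nu => p.toRealization.output par k t := by
  have hc : Measurable (starRingEnd ℂ) := Complex.continuous_conj.measurable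
  have hm := measurable_phase
  have hx : ∀ q n, Measurable fun p : Sample M K L Nu => p.toRealization.x q n := fun q n => by
    simp only [toRealization]
    split_ifs <;> fun_prop
  have hw : ∀ m n, Measurable fun p : Sample M K L Nu => p.toRealization.w m n := fun m n => by
    simp only [toRealization]
    split_ifs <;> fun_prop
  have hh : ∀ m q l, Measurable fun p : Sample M K L Nu => p.toRealization.h m q l :=
    fun m q l => by simp only [toRealization]; fun_prop
  have h1 : ∀ q, Measurable fun p : Sample M K L Nu => p.toRealization.cfo q := fun q => by
    simp only [toRealization]; fun_prop
  have h2 : ∀ q, Measurable fun p : Sample M K L Nu => p.toRealization.cfoHat q := fun q => by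
    simp only [toRealization]; fun_prop
  simp only [Realization.output, Realization.chanEst, Realization.pilotRx, Realization.dataRx]
  fun_prop

theorem withData_x (p : Sample M K L Nu) (c : Slot K L Nu → ℂ) (τ : Slot K L Nu) (hL : 0 < L) :
    (p.withData c).toRealization.x τ.1 τ.2 = c τ := by
  refine (dif_pos (data_time_mem τ.1.pos hL τ.2.2)).trans ?_
  simp [withData, source]

/-- Symbols of a realization with replaced data symbols. -/
def dataX (p : Sample M K L Nu) (c : Slot K L Nu → ℂ) (q : Fin K) (n : ℕ) : ℂ :=
  if hs : n ∈ Set.Ico (K * L) Nu then Sum.elim p.2 c (source (Sum.inr (Sum.inr (q, ⟨n, hs⟩)))) else 0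

theorem withData_toRealization (p : Sample M K L Nu) (c : Slot K L Nu → ℂ) :
    (p.withData c).toRealization =
      { p.toRealization with x := p.dataX c } := rfl

theorem output_withData_affine (p : Sample M K L Nu) (c : Slot K L Nu → ℂ) (s : ℂ) (k : Fin K)
    (t : ℕ) : (p.withData fun τ => s * c τ).toRealization.output par k t =
      (1 - s) * (p.withData fun _ => 0).toRealization.output par k t +
        s * (p.withData c).toRealization.output par k t := by
  simp only [withData_toRealization]
  rw [← Realization.output_affine]
  congr 2
  funext q n
  simp only [dataX]
  split_ifs with h
  · cases source (M := M) (Sum.inr (Sum.inr (q, ⟨n, h⟩)))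
    -- A preamble or postamble symbol u is not scaled, which fits the affine form because (1 - s) u
    -- + s u = u.
    · simp only [Sum.elim_inl]; ring
    · simp
  · simp

end Sample

namespace Model

variable {M K L Nu : ℕ} {par : Params K L} {Ω : Type*} [MeasurableSpace Ω] {P : Measure Ω}
  (U : Model M K L Nu par P)

/-- The output when the data symbols are `s` times those of `z.1`. -/
def codedOutput (s : ℂ) (τ : Slot K L Nu) (z : (Slot K L Nu → ℂ) × Ω) : ℂ :=
  ((U.sample z.2).withData fun τ' => s * z.1 τ').toRealization.output par τ.1 τ.2

/-- Law of the data symbols and of the rest of the model. -/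
abbrev codedLaw (_ : Model M K L Nu par P) : Measure ((Slot K L Nu → ℂ) × Ω) :=
  (Sample.dataLaw (Slot K L Nu)).prod P

variable [IsProbabilityMeasure P]

theorem measurePreserving_withData :
    MeasurePreserving (fun z : (Slot K L Nu → ℂ) × Ω => (U.sample z.2).withData z.1) U.codedLaw
      (sampleLaw par (P.map U.cfoPair) M Nu) :=
  ((Sample.measurePreserving_withData par (P.map U.cfoPair)).comp
    (U.measurePreserving_sample.prod (MeasurePreserving.id (Sample.dataLaw (Slot K L Nu))))).comp
      Measure.measurePreserving_swap

theorem measurable_codedOutput (s : ℂ) (τ : Slot K L Nu) : Measurable (U.codedOutput s τ) := by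
  have h1 : Measurable fun z : Sample M K L Nu × (Slot K L Nu → ℂ) => z.1.withData z.2 :=
    (Sample.measurePreserving_withData par (P.map U.cfoPair)).measurable
  have h2 : Measurable fun z : (Slot K L Nu → ℂ) × Ω =>
      (U.sample z.2, fun τ' => s * z.1 τ') := by
    refine (U.measurable_sample.comp measurable_snd).prodMk (measurable_pi_lambda _ fun τ' => ?_)
    have h : Measurable fun z : (Slot K L Nu → ℂ) × Ω => z.1 τ' := by fun_prop
    exact h.const_mul s
  have h3 : U.codedOutput s τ = (fun p : Sample M K L Nu => p.toRealization.output par τ.1 τ.2) ∘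
      (fun z : Sample M K L Nu × (Slot K L Nu → ℂ) => z.1.withData z.2) ∘
      fun z => (U.sample z.2, fun τ' => s * z.1 τ') := rfl
  rw [h3]
  exact (Sample.measurable_output par τ.1 τ.2).comp (h1.comp h2)

theorem codedOutput_one (τ : Slot K L Nu) (z : (Slot K L Nu → ℂ) × Ω) : U.codedOutput 1 τ z =
    ((U.sample z.2).withData z.1).toRealization.output par τ.1 τ.2 := by
  simp [codedOutput]

theorem codedOutput_affine (s : ℂ) (τ : Slot K L Nu) (z : (Slot K L Nu → ℂ) × Ω) :
    U.codedOutput s τ z = U.codedOutput 1 τ z +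
      (s - 1) * (U.codedOutput 1 τ z - U.codedOutput 0 τ z) := by
  rw [codedOutput_one, codedOutput, codedOutput, Sample.output_withData_affine]
  simp only [zero_mul]
  ring

variable (hL : 0 < L) (τ : Slot K L Nu)

include hL in
theorem output_sample (a : Ω) :
    (U.sample a).toRealization.output par τ.1 τ.2 = U.output τ.1 τ.2 a :=
  ((U.agree_sample a).output par τ.1 τ.2.2 hL).symm

include hL in
-- At scale 1, a random codeword symbol and the resulting output have the joint law of symbol and
-- output in the model, so the moments computed there apply.
theorem integral_withData (G : ℂ → ℂ → ℝ) (hG : Measurable fun p : ℂ × ℂ => G p.1 p.2) :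
    ∫ z, G (z.1 τ) (U.codedOutput 1 τ z) ∂U.codedLaw =
      ∫ a, G (U.x τ.1 τ.2 a) (U.output τ.1 τ.2 a) ∂P := by
  have hx : Measurable fun p : Sample M K L Nu => p.toRealization.x τ.1 τ.2 := by
    simp_rw [Sample.x_eq hL τ.1 τ.2.2]; fun_prop
  have hm : Measurable fun p : Sample M K L Nu =>
      G (p.toRealization.x τ.1 τ.2) (p.toRealization.output par τ.1 τ.2) :=
    hG.comp (hx.prodMk (Sample.measurable_output par τ.1 τ.2))
  have h1 := integral_map (μ := U.codedLaw) U.measurePreserving_withData.measurable.aemeasurable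
    hm.aestronglyMeasurable
  have h2 := integral_map (μ := P) U.measurePreserving_sample.measurable.aemeasurable
    hm.aestronglyMeasurable
  rw [U.measurePreserving_withData.map_eq] at h1
  rw [U.measurePreserving_sample.map_eq] at h2
  have hxa : ∀ a, (U.sample a).toRealization.x τ.1 τ.2 = U.x τ.1 τ.2 a := fun a =>
    ((U.agree_sample a).x τ.1 τ.2 (data_time_mem τ.1.pos hL τ.2.2)).symm
  simp only [Sample.withData_x _ _ _ hL, ← codedOutput_one] at h1
  simp only [hxa, U.output_sample hL] at h2
  rw [← h1, h2]

include hL in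
theorem memLp_codedOutput_one : MemLp (U.codedOutput 1 τ) 2 U.codedLaw := by
  have h1 : MemLp (fun p : Sample M K L Nu => p.toRealization.output par τ.1 τ.2) 2
      (sampleLaw par (P.map U.cfoPair) M Nu) := by
    rw [← U.measurePreserving_sample.map_eq, memLp_map_measure_iff
      (Sample.measurable_output par τ.1 τ.2).aestronglyMeasurable U.measurable_sample.aemeasurable]
    have : (fun p : Sample M K L Nu => p.toRealization.output par τ.1 τ.2) ∘ U.sample =
      U.output τ.1 τ.2 := funext fun a => U.output_sample hL τ a
    rw [this]
    exact U.memLp_output hL τ.1 τ.2.2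
  have h2 := h1.comp_measurePreserving U.measurePreserving_withData
  have : U.codedOutput 1 τ = (fun p : Sample M K L Nu => p.toRealization.output par τ.1 τ.2) ∘
      fun z : (Slot K L Nu → ℂ) × Ω => (U.sample z.2).withData z.1 :=
    funext fun z => U.codedOutput_one τ z
  rwa [this]

include hL in
-- By affinity, the output without data is the average of the outputs for data c and -c. Both are
-- square integrable because the law of c is symmetric.
theorem memLp_codedOutput_zero : MemLp (U.codedOutput 0 τ) 2 U.codedLaw := by
  have h1 := U.memLp_codedOutput_one hL τ
  have hneg : MeasurePreserving (fun z : (Slot K L Nu → ℂ) × Ω => ((fun τ => -z.1 τ), z.2))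
      U.codedLaw U.codedLaw :=
    (measurePreserving_pi _ _ fun _ => measurePreserving_neg_complexGaussian 1).prod
      (MeasurePreserving.id P)
  have h2 := h1.comp_measurePreserving hneg
  have h3 := (h1.add h2).const_mul (1 / 2 : ℂ)
  refine h3.congr_norm (U.measurable_codedOutput 0 τ).aestronglyMeasurable
    (Filter.Eventually.of_forall fun z => congrArg _ ?_)
  have h4 : U.codedOutput 1 τ ((fun τ => -z.1 τ), z.2) = U.codedOutput (-1) τ z := by
    simp [codedOutput]
  have h5 := U.codedOutput_affine (-1) τ z
  simp only [Pi.add_apply, Function.comp_apply, h4, h5]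
  ring

include hL in
theorem memLp_codedOutput (s : ℂ) : MemLp (U.codedOutput s τ) 2 U.codedLaw := by
  have h := (U.memLp_codedOutput_one hL τ).add
    (((U.memLp_codedOutput_one hL τ).sub (U.memLp_codedOutput_zero hL τ)).const_mul (s - 1))
  have : U.codedOutput s τ = _ := funext fun z => U.codedOutput_affine s τ z
  rw [this]
  exact h

theorem memLp_symbol : MemLp (fun z : (Slot K L Nu → ℂ) × Ω => z.1 τ) 2 U.codedLaw := by
  have h : MemLp (fun z : ℂ => z) 2 (complexGaussian 1) := by
    rw [memLp_two_iff_integrable_sq_norm (by fun_prop)]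
    exact integrable_norm_pow_complexGaussian 1 2
  exact h.comp_measurePreserving ((measurePreserving_eval (fun _ : Slot K L Nu =>
    complexGaussian 1) τ).comp measurePreserving_fst)

/-- The decoding metric for a slot. -/
def metric {K L Nu : ℕ} (par : Params K L) (M : ℕ) (τ : Slot K L Nu) (x y : ℂ) : ℝ :=
  infoDensity (meanGainVal par τ.1 M τ.2) (noisePower par M τ.1 τ.2) x y

include hL in
theorem integrable_metric (s : ℂ) :
    Integrable (fun z => metric par M τ (z.1 τ) (U.codedOutput s τ z)) U.codedLaw :=
  (integrable_infoDensity _ _ (U.memLp_symbol τ) (U.memLp_codedOutput hL τ s)).1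

theorem output_sub (a : Ω) : U.output τ.1 τ.2 a - (meanGainVal par τ.1 M τ.2 : ℂ) *
    U.x τ.1 τ.2 a = U.totalNoise τ.1 τ.2 a := by
  rw [output_eq, ← U.meanGain_eq]
  exact add_sub_cancel_left _ _

include hL in
-- The metric has fixed parameters, those of scale 1, and its mean depends on s only through two
-- second moments, which are continuous in s. At s = 1 they are v and a² + v, and the quadratic
-- parts cancel.
theorem tendsto_integral_metric (hM : 0 < M) :
    Filter.Tendsto (fun s : ℝ => ∫ z, metric par M τ (z.1 τ) (U.codedOutput s τ z) ∂U.codedLaw)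
      (nhds 1) (nhds (Real.log (1 + par.sinrFormula M τ.1 τ.2))) := by
  set g := meanGainVal par τ.1 M τ.2 with hg
  set v := noisePower par M τ.1 τ.2 with hv
  have hvpos : 0 < v := noisePower_pos hM hL par τ.1 τ.2
  have hX := U.memLp_symbol τ
  have hY := U.memLp_codedOutput_one hL τ
  have hD := hY.sub (U.memLp_codedOutput_zero hL τ)
  have hI := fun s : ℝ => (integrable_infoDensity g v hX (U.memLp_codedOutput hL τ s)).2
  have e1 : ∀ (s : ℝ) z, U.codedOutput s τ z - (g : ℂ) * z.1 τ =
      (U.codedOutput 1 τ - fun w : (Slot K L Nu → ℂ) × Ω => (g : ℂ) * w.1 τ) z +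
        ((s : ℂ) - 1) * (U.codedOutput 1 τ - U.codedOutput 0 τ) z := fun s z => by
    rw [U.codedOutput_affine s τ z]
    simp only [Pi.sub_apply]
    ring
  have e2 : ∀ (s : ℝ) z, U.codedOutput s τ z = U.codedOutput 1 τ z +
        ((s : ℂ) - 1) * (U.codedOutput 1 τ - U.codedOutput 0 τ) z := fun s z =>
    U.codedOutput_affine s τ z
  have t1 := tendsto_integral_norm_sq_add_mul (hY.sub (hX.const_mul (g : ℂ))) hD
  have t2 := tendsto_integral_norm_sq_add_mul hY hD
  simp_rw [← e1] at t1
  simp_rw [← e2] at t2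
  have i1 : ∫ z, ‖(U.codedOutput 1 τ - fun w : (Slot K L Nu → ℂ) × Ω => (g : ℂ) * w.1 τ) z‖ ^ 2 ∂U.codedLaw = v := by
    have h := U.integral_withData hL τ (fun x y => ‖y - g * x‖ ^ 2) (by fun_prop)
    simp only [hg, U.output_sub] at h
    exact h.trans (U.integral_norm_sq_totalNoise hL τ.1 τ.2.2)
  have i2 : ∫ z, ‖U.codedOutput 1 τ z‖ ^ 2 ∂U.codedLaw = g ^ 2 + v := by
    have h := U.integral_withData hL τ (fun _ y => ‖y‖ ^ 2) (by fun_prop)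
    rw [h, U.integral_norm_sq_output hL τ.1 τ.2.2]
  rw [i1] at t1
  rw [i2] at t2
  have hlim := ((tendsto_const_nhds (x := Real.log ((g ^ 2 + v) / v))).sub
    (t1.div_const v)).add (t2.div_const (g ^ 2 + v))
  have hval : Real.log ((g ^ 2 + v) / v) - v / v + (g ^ 2 + v) / (g ^ 2 + v) =
      Real.log (1 + par.sinrFormula M τ.1 τ.2) := by
    rw [div_self hvpos.ne', div_self (by positivity), sub_add_cancel,
      ← sinr_eq hM hL, ← meanGainVal_sq, add_div, div_self hvpos.ne', add_comm]
  rw [hval] at hlim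
  exact hlim.congr fun s => (hI s).symm

include hL in
-- One s < 1 serves all slots because there are finitely many of them. Strict inequality is what
-- makes room for the power constraint.
theorem exists_scale (hM : 0 < M) {δ : ℝ} (hδ : 0 < δ) : ∃ s : ℝ, 0 < s ∧ s < 1 ∧
    ∀ τ : Slot K L Nu, Real.log (1 + par.sinrFormula M τ.1 τ.2) - δ <
      ∫ z, metric par M τ (z.1 τ) (U.codedOutput s τ z) ∂U.codedLaw := by
  have h1 : ∀ᶠ s : ℝ in nhdsWithin 1 (Set.Iio 1), ∀ τ : Slot K L Nu,
      Real.log (1 + par.sinrFormula M τ.1 τ.2) - δ <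
        ∫ z, metric par M τ (z.1 τ) (U.codedOutput s τ z) ∂U.codedLaw :=
    Filter.eventually_all.2 fun τ => ((U.tendsto_integral_metric hL τ hM).mono_left
      nhdsWithin_le_nhds).eventually_const_lt (by linarith)
  have h2 : ∀ᶠ s : ℝ in nhdsWithin 1 (Set.Iio 1), s ∈ Set.Ioo (0 : ℝ) 1 :=
    Ioo_mem_nhdsLT zero_lt_one
  obtain ⟨s, hs, hs'⟩ := (h1.and h2).exists
  exact ⟨s, hs'.1, hs'.2, hs⟩

end Model

/-- Threshold decoding is measurable. -/
theorem exists_measurable_decoder {β : Type*} [MeasurableSpace β] {N : ℕ}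
    {score : Fin (N + 1) → β → ℝ} (hs : ∀ m, Measurable (score m)) (r : ℝ) :
    ∃ d : β → Fin (N + 1), Measurable d ∧
      ∀ y m, r < score m y → (∀ m', m' ≠ m → score m' y ≤ r) → d y = m := by
  classical
  let flags : β → Fin (N + 1) → Prop := fun y m => r < score m y
  -- Any message above the threshold is chosen, and 0 if there is none. The choice is a function on
  -- a finite space, so measurability reduces to that of the threshold tests.
  let D : (Fin (N + 1) → Prop) → Fin (N + 1) := fun b => if h : ∃ m, b m then h.choose else 0
  refine ⟨fun y => D (flags y), (measurable_of_countable D).comp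
    (measurable_pi_lambda _ fun m => measurableSet_setOfPred.1 (measurableSet_lt measurable_const (hs m))), fun y m hm hm' => ?_⟩
  have h : ∃ m, flags y m := ⟨m, hm⟩
  simp only [D, dif_pos h]
  by_contra hne
  exact absurd h.choose_spec (not_lt.2 (hm' _ hne))

/-! ### Random codebooks and threshold decoding -/

variable {M K L Nu : ℕ} {par : Params K L} {Ω : Type*} [MeasurableSpace Ω] {P : Measure Ω}

/-- One column of a codebook, with `N τ + 1` messages in slot `τ`. -/
abbrev Column (N : Slot K L Nu → ℕ) : Type := (Σ τ : Slot K L Nu, Fin (N τ + 1)) → ℂ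

/-- Messages for all slots. -/
abbrev Msg (N : Slot K L Nu → ℕ) : Type :=
  (q : Fin K) → (t : dataTimes K L Nu) → Fin (N (q, t) + 1)

/-- Position of the message of slot `τ` in a column. -/
def Msg.sel {N : Slot K L Nu → ℕ} (msg : Msg N) (τ : Slot K L Nu) :
    Σ τ : Slot K L Nu, Fin (N τ + 1) := ⟨τ, msg τ.1 τ.2⟩

theorem Msg.sel_injective {N : Slot K L Nu → ℕ} (msg : Msg N) : Function.Injective msg.sel :=
  fun _ _ h => congrArg Sigma.fst h

section RandomCoding

variable (U : Model M K L Nu par P) [IsProbabilityMeasure P] {N : Slot K L Nu → ℕ} {n : ℕ}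
  (s : ℂ) (r : Slot K L Nu → ℝ)

theorem measurePreserving_select (j : Σ τ : Slot K L Nu, Fin (N τ + 1)) :
    MeasurePreserving (fun z : Column N × Ω => z.1 j)
      ((Sample.dataLaw (Σ τ : Slot K L Nu, Fin (N τ + 1))).prod P) (complexGaussian 1) :=
  (measurePreserving_eval (fun _ : Σ τ : Slot K L Nu, Fin (N τ + 1) =>
    complexGaussian 1) j).comp measurePreserving_fst

theorem measurePreserving_sel (msg : Msg N) :
    MeasurePreserving (fun z : Column N × Ω => ((fun τ => z.1 (msg.sel τ)), z.2))
      ((Sample.dataLaw (Σ τ : Slot K L Nu, Fin (N τ + 1))).prod P) U.codedLaw :=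
  (measurePreserving_pi_comp_injective (fun _ : Σ τ : Slot K L Nu, Fin (N τ + 1) =>
    complexGaussian 1) msg.sel_injective).prod (MeasurePreserving.id P)

/-- A codeword that is not sent is a fresh coordinate of the codebook, hence independent of all sent
codewords and of the channel. The outputs under test are functions of the latter. -/
theorem measurePreserving_wrong_sel (msg : Msg N) (τ : Slot K L Nu) {m : Fin (N τ + 1)}
    (hm : m ≠ msg τ.1 τ.2) :
    MeasurePreserving (fun z : Column N × Ω => (z.1 ⟨τ, m⟩, ((fun τ => z.1 (msg.sel τ)), z.2)))
      ((Sample.dataLaw (Σ τ : Slot K L Nu, Fin (N τ + 1))).prod P)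
      ((complexGaussian 1).prod U.codedLaw) := by
  let e : Unit ⊕ Slot K L Nu → Σ τ : Slot K L Nu, Fin (N τ + 1) :=
    Sum.elim (fun _ => ⟨τ, m⟩) msg.sel
  have he : Function.Injective e := by
    refine Function.Injective.sumElim (fun _ _ _ => rfl) msg.sel_injective fun _ τ' h => hm ?_
    have h1 : τ = τ' := congrArg Sigma.fst h
    subst h1
    exact eq_of_heq (Sigma.mk.inj h).2
  have h1 := measurePreserving_pi_comp_injective (fun _ : Σ τ : Slot K L Nu, Fin (N τ + 1) =>
    complexGaussian 1) he
  have h2 := measurePreserving_sumPiEquivProdPi (X := fun _ : Unit ⊕ Slot K L Nu => ℂ)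
    fun _ => complexGaussian 1
  have h3 := (measurePreserving_eval (fun _ : Unit => complexGaussian 1) ()).prod
    (MeasurePreserving.id (Sample.dataLaw (Slot K L Nu)))
  have h4 := (h3.comp (h2.comp h1)).prod (MeasurePreserving.id P)
  exact (measurePreserving_prodAssoc (complexGaussian 1) (Sample.dataLaw (Slot K L Nu)) P).comp h4

/-- Violation of the power constraint. -/
def powerBad (n : ℕ) (s : ℂ) : Set (Fin n → ℂ) := {w | (n : ℝ) < ∑ i, ‖s * w i‖ ^ 2}

/-- The score of the sent codeword is too small. -/
def missBad (n : ℕ) (τ : Slot K L Nu) : Set (Fin n → (Slot K L Nu → ℂ) × Ω) :=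
  {w | ∑ i, Model.metric par M τ ((w i).1 τ) (U.codedOutput s τ (w i)) ≤ n * r τ}

/-- The score of another codeword is too large. -/
def wrongBad (n : ℕ) (τ : Slot K L Nu) : Set (Fin n → ℂ × ((Slot K L Nu → ℂ) × Ω)) :=
  {w | n * r τ < ∑ i, Model.metric par M τ (w i).1 (U.codedOutput s τ (w i).2)}

theorem _root_.Measurable.infoDensity {α : Type*} [MeasurableSpace α] {X Y : α → ℂ}
    (hX : Measurable X) (hY : Measurable Y) (a v : ℝ) :
    Measurable fun z => infoDensity a v (X z) (Y z) := by
  unfold TRMRC.infoDensity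
  fun_prop

theorem measurable_metric {α : Type*} [MeasurableSpace α] (τ : Slot K L Nu) {X Y : α → ℂ}
    (hX : Measurable X) (hY : Measurable Y) :
    Measurable fun a => Model.metric par M τ (X a) (Y a) :=
  hX.infoDensity hY _ _

theorem measurable_metric_coded (τ : Slot K L Nu) :
    Measurable fun w : (Slot K L Nu → ℂ) × Ω =>
      Model.metric par M τ (w.1 τ) (U.codedOutput s τ w) :=
  measurable_metric τ (by fun_prop) (U.measurable_codedOutput s τ)

theorem measurable_metric_wrong (τ : Slot K L Nu) :
    Measurable fun w : ℂ × ((Slot K L Nu → ℂ) × Ω) =>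
      Model.metric par M τ w.1 (U.codedOutput s τ w.2) := by
  have h : Measurable fun w : ℂ × ((Slot K L Nu → ℂ) × Ω) => U.codedOutput s τ w.2 :=
    Measurable.comp (g := U.codedOutput s τ) (f := Prod.snd) (U.measurable_codedOutput s τ)
      measurable_snd
  exact measurable_metric τ measurable_fst h

theorem measurableSet_powerBad : MeasurableSet (powerBad n s) :=
  measurableSet_lt (by fun_prop) (by fun_prop)

theorem measurable_sum_coord {β : Type*} [MeasurableSpace β] {g : β → ℝ} (hg : Measurable g) :
    Measurable fun w : Fin n → β => ∑ i, g (w i) :=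
  Finset.measurable_sum _ fun i _ => hg.comp (measurable_pi_apply i)

theorem measurableSet_missBad (τ : Slot K L Nu) : MeasurableSet (missBad U s r n τ) :=
  measurableSet_le (measurable_sum_coord (measurable_metric_coded U s τ)) measurable_const

theorem measurableSet_wrongBad (τ : Slot K L Nu) : MeasurableSet (wrongBad U s r n τ) :=
  measurableSet_lt measurable_const (measurable_sum_coord (measurable_metric_wrong U s τ))

/-- The codebooks and realizations for which some constraint or test fails. -/
def badSet (n : ℕ) (msg : Msg N) : Set ((Fin n → Column N) × (Fin n → Ω)) :=
  (⋃ τ : Slot K L Nu, (fun (z : (Fin n → Column N) × (Fin n → Ω)) i =>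
    z.1 i (msg.sel τ)) ⁻¹' powerBad n s) ∪
  (⋃ τ : Slot K L Nu, (fun (z : (Fin n → Column N) × (Fin n → Ω)) i =>
    ((fun τ' => z.1 i (msg.sel τ')), z.2 i)) ⁻¹' missBad U s r n τ) ∪
  ⋃ τ : Slot K L Nu, ⋃ m ∈ (Finset.univ : Finset (Fin (N τ + 1))).erase (msg τ.1 τ.2),
    (fun (z : (Fin n → Column N) × (Fin n → Ω)) i =>
      (z.1 i ⟨τ, m⟩, ((fun τ' => z.1 i (msg.sel τ')), z.2 i))) ⁻¹' wrongBad U s r n τ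

/-- Law of a random codebook. -/
abbrev bookLaw (N : Slot K L Nu → ℕ) (n : ℕ) : Measure (Fin n → Column N) :=
  Measure.pi fun _ => Sample.dataLaw (Σ τ : Slot K L Nu, Fin (N τ + 1))

theorem measurableSet_badSet (msg : Msg N) : MeasurableSet (badSet U s r n msg) := by
  refine ((MeasurableSet.iUnion fun τ => ?_).union (MeasurableSet.iUnion fun τ => ?_)).union
    (MeasurableSet.iUnion fun τ => Finset.measurableSet_biUnion _ fun m hm => ?_)
  · exact (measurePreserving_pi_pair (measurePreserving_select (P := P) (msg.sel τ))).measurable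
      (measurableSet_powerBad s)
  · exact (measurePreserving_pi_pair (measurePreserving_sel U msg)).measurable
      (measurableSet_missBad U s r τ)
  · exact (measurePreserving_pi_pair (measurePreserving_wrong_sel U msg τ
      (Finset.ne_of_mem_erase hm))).measurable (measurableSet_wrongBad U s r τ)

/-- Bound for the error probability of random coding. -/
def errorBound (N : Slot K L Nu → ℕ) (n : ℕ) : ENNReal :=
  (∑ _τ : Slot K L Nu, (Measure.pi fun _ : Fin n => complexGaussian 1) (powerBad n s)) +
  (∑ τ, (Measure.pi fun _ : Fin n => U.codedLaw) (missBad U s r n τ)) +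
  ∑ τ, (N τ : ENNReal) * ENNReal.ofReal (Real.exp (-(n * r τ)))

/-- For each fixed output the integral over the independent codeword symbol is 1. So the actual law
of the output, and the scale s, are irrelevant. -/
theorem exp_metric (hM : 0 < M) (hL : 0 < L) (τ : Slot K L Nu) :
    Integrable (fun w : ℂ × ((Slot K L Nu → ℂ) × Ω) =>
      Real.exp (Model.metric par M τ w.1 (U.codedOutput s τ w.2)))
      ((complexGaussian 1).prod U.codedLaw) ∧
    ∫ w : ℂ × ((Slot K L Nu → ℂ) × Ω), Real.exp (Model.metric par M τ w.1
      (U.codedOutput s τ w.2)) ∂((complexGaussian 1).prod U.codedLaw) = 1 := by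
  have h1 : Measurable fun w : ℂ × ((Slot K L Nu → ℂ) × Ω) =>
      Real.exp (Model.metric par M τ w.1 (U.codedOutput s τ w.2)) :=
    (measurable_metric_wrong U s τ).exp
  have hl : ∫⁻ w : ℂ × ((Slot K L Nu → ℂ) × Ω), ENNReal.ofReal (Real.exp
      (Model.metric par M τ w.1 (U.codedOutput s τ w.2)))
      ∂((complexGaussian 1).prod U.codedLaw) = 1 := by
    rw [lintegral_prod_symm' _ h1.ennreal_ofReal]
    simp [Model.metric, lintegral_exp_infoDensity _ (noisePower_pos hM hL par τ.1 τ.2)]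
  have h0 := Filter.Eventually.of_forall (f := ae ((complexGaussian 1).prod U.codedLaw))
    fun w : ℂ × ((Slot K L Nu → ℂ) × Ω) =>
      (Real.exp_pos (Model.metric par M τ w.1 (U.codedOutput s τ w.2))).le
  refine ⟨⟨h1.aestronglyMeasurable, ?_⟩, ?_⟩
  · rw [hasFiniteIntegral_iff_ofReal h0, hl]
    exact ENNReal.one_lt_top
  · rw [integral_eq_lintegral_of_nonneg_ae h0 h1.aestronglyMeasurable, hl, ENNReal.toReal_one]

/-- Union bound over the slots and, for the third kind of event, over the wrong messages of each
slot. The bound is the same for every choice of messages. -/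
theorem measure_badSet_le (hM : 0 < M) (hL : 0 < L) (msg : Msg N) :
    ((bookLaw N n).prod (Measure.pi fun _ => P)) (badSet U s r n msg) ≤
      errorBound U s r N n := by
  refine (measure_union_le _ _).trans (add_le_add ((measure_union_le _ _).trans
    (add_le_add ?_ ?_)) ?_)
  · refine (measure_iUnion_fintype_le _ _).trans (Finset.sum_le_sum fun τ _ => le_of_eq ?_)
    exact (measurePreserving_pi_pair (measurePreserving_select (P := P)
      (msg.sel τ))).measure_preimage (measurableSet_powerBad s).nullMeasurableSet
  · refine (measure_iUnion_fintype_le _ _).trans (Finset.sum_le_sum fun τ _ => le_of_eq ?_)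
    exact (measurePreserving_pi_pair (measurePreserving_sel U msg)).measure_preimage
      (measurableSet_missBad U s r τ).nullMeasurableSet
  · refine (measure_iUnion_fintype_le _ _).trans (Finset.sum_le_sum fun τ _ => ?_)
    refine (measure_biUnion_finset_le _ _).trans ((Finset.sum_le_card_nsmul _ _
      (ENNReal.ofReal (Real.exp (-(n * r τ)))) fun m hm => ?_).trans ?_)
    · refine ((measurePreserving_pi_pair (measurePreserving_wrong_sel U msg τ
        (Finset.ne_of_mem_erase hm))).measure_preimage
        (measurableSet_wrongBad U s r τ).nullMeasurableSet).le.trans ?_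
      obtain ⟨h1, h2⟩ := exp_metric U s hM hL τ
      exact measure_lt_sum_le h1 h2 n (r τ)
    · rw [Finset.card_erase_of_mem (Finset.mem_univ _), Finset.card_univ, Fintype.card_fin,
        Nat.add_sub_cancel, nsmul_eq_mul]

theorem measurable_score (c : Fin n → Column N) (τ : Slot K L Nu) (m : Fin (N τ + 1)) :
    Measurable fun y : Fin n → ℂ => ∑ i, Model.metric par M τ (c i ⟨τ, m⟩) (y i) :=
  Finset.measurable_sum _ fun i _ => measurable_metric τ measurable_const
    (measurable_pi_apply i)

/-- The code given by a codebook: scaled codewords, erased if their power is too large, and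
threshold decoding. -/
def bookCode (s : ℂ) (r : Slot K L Nu → ℝ) (par : Params K L) (M : ℕ)
    (c : Fin n → Column N) : Code K L Nu n :=
  { size := fun q t => N (q, t) + 1
    size_pos := fun _ _ => Nat.succ_pos _
    enc := fun q t m i =>
      if ∑ i', ‖s * c i' ⟨(q, t), m⟩‖ ^ 2 ≤ n then s * c i ⟨(q, t), m⟩ else 0
    power_le := fun q t m => by
      split_ifs with h
      · exact h
      · simp
    dec := fun q t => (exists_measurable_decoder (measurable_score (par := par) (M := M) c (q, t)) (n * r (q, t))).choose
    measurable_dec := fun q t =>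
      (exists_measurable_decoder (measurable_score (par := par) (M := M) c (q, t)) (n * r (q, t))).choose_spec.1 }

theorem bookCode_dec (c : Fin n → Column N) (q : Fin K) (t : dataTimes K L Nu) (y : Fin n → ℂ)
    (m : Fin (N (q, t) + 1))
    (h1 : n * r (q, t) < ∑ i, Model.metric par M (q, t) (c i ⟨(q, t), m⟩) (y i))
    (h2 : ∀ m', m' ≠ m →
      ∑ i, Model.metric par M (q, t) (c i ⟨(q, t), m'⟩) (y i) ≤ n * r (q, t)) :
    (bookCode s r par M c).dec q t y = m :=
  (exists_measurable_decoder (measurable_score (par := par) (M := M) c (q, t))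
    (n * r (q, t))).choose_spec.2 y m h1 h2

theorem codedRealization_agree (C : Code K L Nu n) (msg : C.Messages) (i : Fin n) (a : Ω) :
    (C.codedRealization U msg i a).Agree Nu ((U.sample a).withData fun τ =>
      C.enc τ.1 τ.2 (msg τ.1 τ.2) i).toRealization where
  h := rfl
  cfo := rfl
  cfoHat := rfl
  w m n hn := by
    have := (U.agree_sample a).w m n hn
    exact this
  x q n hn := by
    have h := (U.agree_sample a).x q n hn
    by_cases hd : n ∈ dataTimes K L Nu
    · simp only [Code.codedRealization, dif_pos hd, Sample.toRealization, Sample.withData,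
        Sample.source, dif_pos hn, Sum.elim_inr]
    · refine Eq.trans (dif_neg hd) (h.trans ?_)
      simp only [Sample.toRealization, Sample.withData, Sample.source, dif_pos hn, dif_neg hd,
        Sum.elim_inl]

/-- Outside the bad set no codeword of any slot is erased. All slots matter here, since the
codewords of the others enter the output as interference. The output is then the one in the
threshold tests, and only the sent message passes. -/
theorem error_subset (hL : 0 < L) (c : Fin n → Column N) (msg : Msg N) :
    {a : Fin n → Ω | ∃ (q : Fin K) (t : dataTimes K L Nu), (bookCode s r par M c).dec q t
      (fun i => ((bookCode s r par M c).codedRealization U msg i (a i)).output par q t) ≠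
        msg q t} ⊆ Prod.mk c ⁻¹' badSet U s r n msg := by
  rintro a ⟨q, t, hne⟩
  by_contra hbad
  refine hne ?_
  simp only [badSet, Set.preimage_union, Set.preimage_iUnion, Set.mem_union, Set.mem_iUnion,
    Set.mem_preimage, not_or, not_exists, powerBad, missBad, wrongBad, Set.mem_ofPred_eq,
    not_lt, not_le] at hbad
  obtain ⟨⟨h1, h2⟩, h3⟩ := hbad
  have hout : ∀ i, ((bookCode s r par M c).codedRealization U msg i (a i)).output par q t =
      U.codedOutput s (q, t) ((fun τ' => c i (msg.sel τ')), a i) := fun i => by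
    rw [(codedRealization_agree U (bookCode s r par M c) msg i (a i)).output par q t.2 hL,
      Model.codedOutput]
    congr 3
    funext τ
    exact if_pos (h1 τ)
  simp only [hout]
  refine bookCode_dec s r c q t _ _ (h2 (q, t)) fun m' hm' => ?_
  exact h3 (q, t) m' (Finset.mem_erase.2 ⟨hm', Finset.mem_univ _⟩)

/-- Existence of a good code by averaging over random codebooks. -/
theorem exists_code (hM : 0 < M) (hL : 0 < L) (N : Slot K L Nu → ℕ) (n : ℕ) :
    ∃ C : Code K L Nu n, (∀ q t, C.size q t = N (q, t) + 1) ∧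
      ENNReal.ofReal (C.errorProb U) ≤ errorBound U s r N n := by
  classical
  let Q : Measure (Fin n → Ω) := Measure.pi fun _ => P
  have hmeas : ∀ msg : Msg N, Measurable fun c => Q (Prod.mk c ⁻¹' badSet U s r n msg) :=
    fun msg => measurable_measure_prodMk_left (measurableSet_badSet U s r msg)
  -- Some codebook does no worse than the average. The sum over messages is taken inside, so a
  -- single codebook is good for the mean error over all messages.
  obtain ⟨c, hc⟩ := exists_le_lintegral (μ := bookLaw N n)
    (f := fun c => ∑ msg : Msg N, Q (Prod.mk c ⁻¹' badSet U s r n msg))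
    (Finset.measurable_sum _ fun msg _ => hmeas msg).aemeasurable
  rw [lintegral_finsetSum _ fun msg _ => hmeas msg] at hc
  have hle : ∑ msg : Msg N, ∫⁻ c, Q (Prod.mk c ⁻¹' badSet U s r n msg) ∂(bookLaw N n) ≤
      Fintype.card (Msg N) * errorBound U s r N n := by
    refine (Finset.sum_le_card_nsmul _ _ (errorBound U s r N n) fun msg _ => ?_).trans_eq
      (by rw [Finset.card_univ, nsmul_eq_mul])
    rw [← Measure.prod_apply (measurableSet_badSet U s r msg)]
    exact measure_badSet_le U s r hM hL msg
  have hcard : (0 : ℝ) < Fintype.card (Msg N) := by exact_mod_cast Fintype.card_pos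
  refine ⟨bookCode s r par M c, fun q t => rfl, ?_⟩
  have herr : (bookCode s r par M c).errorProb U = (∑ msg : Msg N, Q.real
      {a : Fin n → Ω | ∃ (q : Fin K) (t : dataTimes K L Nu), (bookCode s r par M c).dec q t
      (fun i => ((bookCode s r par M c).codedRealization U msg i (a i)).output par q t) ≠
        msg q t}) / (Fintype.card (Msg N) : ℝ) := by
    rw [Code.errorProb]
    rfl
  rw [herr, ENNReal.ofReal_div_of_pos hcard,
    ENNReal.ofReal_sum_of_nonneg fun _ _ => measureReal_nonneg]
  refine ENNReal.div_le_of_le_mul ?_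
  rw [ENNReal.ofReal_natCast, mul_comm]
  refine le_trans (Finset.sum_le_sum fun msg _ => ?_) (hc.trans hle)
  rw [ofReal_measureReal]
  exact measure_mono (error_subset U s r hL c msg)

end RandomCoding

/-! ### Vanishing error probability and achievable rates -/

section Achievability

variable {M K L Nu : ℕ} {par : Params K L} {Ω : Type*} [MeasurableSpace Ω] {P : Measure Ω}

/-- The unscaled symbols have mean power 1 < 1/s², so the law of large numbers applies with a strict
gap. -/
theorem tendsto_powerBad {s : ℝ} (h0 : 0 < s) (h1 : s < 1) :
    Filter.Tendsto (fun n : ℕ => (Measure.pi fun _ : Fin n => complexGaussian 1)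
      (powerBad n (s : ℂ))) Filter.atTop (nhds 0) := by
  have hg : Measurable fun z : ℂ => -‖z‖ ^ 2 := by fun_prop
  have hr : -(1 / s ^ 2) < ∫ z : ℂ, -‖z‖ ^ 2 ∂(complexGaussian 1) := by
    rw [integral_neg, integral_norm_sq_complexGaussian, NNReal.coe_one, neg_lt_neg_iff,
      lt_div_iff₀ (by positivity), one_mul]
    nlinarith
  refine tendsto_of_tendsto_of_tendsto_of_le_of_le tendsto_const_nhds
    (tendsto_measure_sum_le hg (integrable_norm_pow_complexGaussian 1 2).neg hr)
    (fun _ => zero_le) fun n => measure_mono fun w hw => ?_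
  simp only [powerBad, Set.mem_ofPred_eq, norm_mul, mul_pow, Complex.norm_real,
    Real.norm_eq_abs, sq_abs, ← Finset.mul_sum] at hw
  simp only [Set.mem_ofPred_eq, Finset.sum_neg_distrib, mul_neg, neg_le_neg_iff, mul_one_div]
  rw [div_le_iff₀ (by positivity), mul_comm]
  exact hw.le

variable (U : Model M K L Nu par P) [IsProbabilityMeasure P]

theorem tendsto_missBad (hL : 0 < L) {s : ℂ} {r : Slot K L Nu → ℝ} (τ : Slot K L Nu)
    (hr : r τ < ∫ z, Model.metric par M τ (z.1 τ) (U.codedOutput s τ z) ∂U.codedLaw) :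
    Filter.Tendsto (fun n : ℕ => (Measure.pi fun _ : Fin n => U.codedLaw) (missBad U s r n τ))
      Filter.atTop (nhds 0) :=
  tendsto_measure_sum_le (measurable_metric_coded U s τ) (U.integrable_metric hL τ s) hr

/-- The number of wrong messages in a code of length `n` and rate `R` nats. -/
def numWrong (R : Slot K L Nu → ℝ) (n : ℕ) (τ : Slot K L Nu) : ℕ := ⌊Real.exp (n * R τ)⌋₊

/-- At most exp(nR) wrong messages, each passing with probability at most exp(-nr), and R < r. -/
theorem tendsto_numWrong_mul {R r : Slot K L Nu → ℝ} (τ : Slot K L Nu) (h : R τ < r τ) :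
    Filter.Tendsto (fun n : ℕ => (numWrong R n τ : ENNReal) *
      ENNReal.ofReal (Real.exp (-(n * r τ)))) Filter.atTop (nhds 0) := by
  have hexp : Filter.Tendsto (fun n : ℕ => ENNReal.ofReal (Real.exp (-(n * (r τ - R τ)))))
      Filter.atTop (nhds 0) := by
    have h1 : Filter.Tendsto (fun n : ℕ => Real.exp (-(n * (r τ - R τ)))) Filter.atTop
        (nhds 0) :=
      Real.tendsto_exp_neg_atTop_nhds_zero.comp
        (tendsto_natCast_atTop_atTop.atTop_mul_const (sub_pos.2 h))
    simpa using ENNReal.tendsto_ofReal h1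
  refine tendsto_of_tendsto_of_tendsto_of_le_of_le tendsto_const_nhds hexp
    (fun _ => zero_le) fun n => ?_
  rw [← ENNReal.ofReal_natCast, ← ENNReal.ofReal_mul (Nat.cast_nonneg _)]
  refine ENNReal.ofReal_le_ofReal ?_
  calc (numWrong R n τ : ℝ) * Real.exp (-(n * r τ))
      ≤ Real.exp (n * R τ) * Real.exp (-(n * r τ)) :=
        mul_le_mul_of_nonneg_right (Nat.floor_le (Real.exp_pos _).le) (Real.exp_pos _).le
    _ = Real.exp (-(n * (r τ - R τ))) := by
        rw [← Real.exp_add]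
        congr 1
        ring

theorem tendsto_errorBound (hL : 0 < L) {s : ℝ} (h0 : 0 < s) (h1 : s < 1)
    {R r : Slot K L Nu → ℝ} (hR : ∀ τ, R τ < r τ)
    (hr : ∀ τ, r τ < ∫ z, Model.metric par M τ (z.1 τ) (U.codedOutput s τ z) ∂U.codedLaw) :
    Filter.Tendsto (fun n : ℕ => errorBound U s r (numWrong R n) n) Filter.atTop (nhds 0) := by
  have h := ((tendsto_finsetSum (Finset.univ : Finset (Slot K L Nu))
    fun _ _ => tendsto_powerBad h0 h1).add
    (tendsto_finsetSum Finset.univ fun τ _ => tendsto_missBad U hL τ (hr τ))).add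
    (tendsto_finsetSum Finset.univ fun τ _ => tendsto_numWrong_mul τ (hR τ))
  simp only [Finset.sum_const_zero, add_zero] at h
  exact h

theorem card_dataTimes_le (hK : 0 < K) (hL : 0 < L) : (dataTimes K L Nu).card ≤ Nu := by
  have := Nat.mul_pos hK hL
  rw [dataTimes, Nat.card_Icc]
  omega

/-- Each slot loses at most ε bits per interval. There are at most Nu slots per user, so after
division by Nu the loss is at most ε. -/
theorem infoRate_sub_le_rate (hL : 0 < L) {n : ℕ} (hn : 0 < n) (C : Code K L Nu n) (q : Fin K)
    {ε : ℝ} (hε : 0 < ε) (hC : ∀ t : dataTimes K L Nu,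
      n * (Real.log (1 + par.sinrFormula M q t) - ε * Real.log 2) ≤ Real.log (C.size q t)) :
    par.infoRate M Nu q - ε ≤ C.rate q := by
  rcases Nat.eq_zero_or_pos Nu with rfl | hNu
  · simp [Params.infoRate, Code.rate, hε.le]
  have hn' : (0 : ℝ) < n := by exact_mod_cast hn
  have hNu' : (0 : ℝ) < Nu := by exact_mod_cast hNu
  have hlog : 0 < Real.log 2 := Real.log_pos one_lt_two
  have hcard : ((dataTimes K L Nu).card : ℝ) ≤ Nu := by exact_mod_cast card_dataTimes_le q.pos hL
  have h1 : ∀ t : dataTimes K L Nu, (n : ℝ) * (Real.logb 2 (1 + par.sinrFormula M q t) - ε) ≤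
      Real.logb 2 (C.size q t) := fun t => by
    rw [Real.logb, Real.logb, le_div_iff₀ hlog, mul_assoc, sub_mul, div_mul_cancel₀ _ hlog.ne']
    exact hC t
  have h2 : (n : ℝ) * ((∑ t ∈ dataTimes K L Nu, Real.logb 2 (1 + par.sinrFormula M q t)) -
      Nu * ε) ≤ ∑ t : dataTimes K L Nu, Real.logb 2 (C.size q t) := by
    refine le_trans (mul_le_mul_of_nonneg_left ?_ hn'.le)
      ((Finset.mul_sum _ _ _).trans_le (Finset.sum_le_sum fun t _ => h1 t))
    rw [Finset.sum_sub_distrib, Finset.sum_const, Finset.card_univ, Fintype.card_coe,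
      nsmul_eq_mul, Finset.sum_coe_sort (dataTimes K L Nu)
        fun t => Real.logb 2 (1 + par.sinrFormula M q t)]
    exact sub_le_sub_left (mul_le_mul_of_nonneg_right hcard hε.le) _
  rw [Code.rate, le_div_iff₀ (by positivity)]
  refine le_of_eq_of_le ?_ h2
  rw [Params.infoRate]
  field_simp

/-- All users attain the rates `I_k` simultaneously. -/
theorem isAchievable_infoRate (hM : 0 < M) (hL : 0 < L) :
    IsAchievable U (par.infoRate M Nu) := by
  intro ε hε
  have hδ : 0 < ε * Real.log 2 := mul_pos hε (Real.log_pos one_lt_two)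
  -- The loss ε log 2, in nats, is split in two: the decoding threshold lies halfway, above the code
  -- rate and below the mean score at scale s.
  obtain ⟨s, h0, h1, hs⟩ := U.exists_scale hL hM (half_pos hδ)
  let R : Slot K L Nu → ℝ := fun τ =>
    Real.log (1 + par.sinrFormula M τ.1 τ.2) - ε * Real.log 2
  have hlim := tendsto_errorBound U hL h0 h1 (R := R) (fun τ => by
    simp only [R]
    linarith) hs
  obtain ⟨n₀, hn₀⟩ := Filter.eventually_atTop.1
    (hlim.eventually_le_const (ENNReal.ofReal_pos.2 hε))
  -- The increment ensures n > 0, which is needed to divide by n in the rate.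
  refine ⟨n₀ + 1, fun n hn => ?_⟩
  obtain ⟨C, hsize, herr⟩ := exists_code U s
    (fun τ => Real.log (1 + par.sinrFormula M τ.1 τ.2) - ε * Real.log 2 / 2) hM hL
    (numWrong R n) n
  refine ⟨C, fun q => infoRate_sub_le_rate hL (by omega) C q hε fun t => ?_,
    (ENNReal.ofReal_le_ofReal_iff hε.le).1 (herr.trans (hn₀ n (by omega)))⟩
  -- With the sent message counted there are ⌊exp(nR)⌋ + 1 messages, so rounding down costs no rate.
  have h := Nat.lt_floor_add_one (Real.exp (n * R (q, t)))
  rw [hsize, Real.le_log_iff_exp_le (by positivity), Nat.cast_add_one]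
  exact h.le

end Achievability

/-! ### SINR and mutual information in the model -/

namespace Model

variable {M K L Nu : ℕ} {par : Params K L} {Ω : Type*} [MeasurableSpace Ω] {P : Measure Ω}
  (U : Model M K L Nu par P) [IsProbabilityMeasure P]

theorem sinr_eq_sinrFormula (hM : 0 < M) (hL : 0 < L) (k : Fin K) {t : ℕ}
    (ht : t ∈ dataTimes K L Nu) : U.sinr k t = par.sinrFormula M k t := by
  rw [sinr, U.integral_norm_sq_component hL k ht, U.integral_norm_sq_totalNoise hL k ht,
    sinr_eq hM hL]

theorem measurable_output (hL : 0 < L) (τ : Slot K L Nu) : Measurable (U.output τ.1 τ.2) := by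
  have h : U.output τ.1 τ.2 =
      (fun p : Sample M K L Nu => p.toRealization.output par τ.1 τ.2) ∘ U.sample :=
    funext fun a => (U.output_sample hL τ a).symm
  rw [h]
  exact (Sample.measurable_output par τ.1 τ.2).comp U.measurable_sample

theorem logb_le_mutualInfoBits (hM : 0 < M) (hL : 0 < L) (k : Fin K) {t : ℕ}
    (ht : t ∈ dataTimes K L Nu) : ENNReal.ofReal (Real.logb 2 (1 + U.sinr k t)) ≤
      mutualInfoBits P (U.x k t) (U.output k t) := by
  have hv := noisePower_pos hM hL par k t
  have hmem := data_time_mem k.pos hL ht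
  have hlaw := U.law_x k t hmem.1 hmem.2
  have hX : MemLp (U.x k t) 2 P := by
    rw [memLp_two_iff_integrable_sq_norm (U.measurable_x k t).aestronglyMeasurable]
    have h := integrable_norm_pow_complexGaussian 1 2
    rw [← hlaw] at h
    exact h.comp_measurable (U.measurable_x k t)
  have h := ofReal_logb_le_mutualInfoBits (U.measurable_x k t)
    (U.measurable_output hL (k, ⟨t, ht⟩)) hlaw hX (U.memLp_output hL k ht) hv
    (U.integral_norm_sq_output hL k ht) (by
      simp_rw [fun a => U.output_sub (k, ⟨t, ht⟩) a]
      exact U.integral_norm_sq_totalNoise hL k ht)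
  rwa [add_div, div_self hv.ne', meanGainVal_sq, sinr_eq hM hL, add_comm,
    ← U.sinr_eq_sinrFormula hM hL k ht] at h

end Model

end

end TRMRC

theorem mainTheorem2 {M K L Nu : ℕ} (hM : 0 < M) (hK : 0 < K) (hL : 0 < L)
    (par : TRMRC.Params K L) {Ω : Type*} [MeasurableSpace Ω] (P : MeasureTheory.Measure Ω)
    [MeasureTheory.IsProbabilityMeasure P] (U : TRMRC.Model M K L Nu par P) :
    (∀ (k : Fin K), ∀ t ∈ TRMRC.dataTimes K L Nu,
      (∀ a, U.output k t a = U.component k t .ES a + U.totalNoise k t a) ∧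
      (∀ c, MeasureTheory.MemLp (U.component k t c) 2 P ∧
        ∫ a, U.component k t c a ∂P = 0 ∧
        ∫ a, ‖U.component k t c a‖ ^ 2 ∂P = TRMRC.tableVariance par M k t c) ∧
      (∀ c c', c ≠ c' →
        ∫ a, U.component k t c a * (starRingEnd ℂ) (U.component k t c' a) ∂P = 0) ∧
      ∫ a, ‖U.totalNoise k t a‖ ^ 2 ∂P =
        TRMRC.tableVariance par M k t .SIF + TRMRC.tableVariance par M k t .ISI +
          TRMRC.tableVariance par M k t .MUI + TRMRC.tableVariance par M k t .EN ∧
      U.sinr k t = par.sinrFormula M k t ∧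
      ENNReal.ofReal (Real.logb 2 (1 + U.sinr k t)) ≤
        TRMRC.mutualInfoBits P (U.x k t) (U.output k t)) ∧
    TRMRC.IsAchievable U (par.infoRate M Nu) :=
  ⟨fun k _ ht => ⟨U.output_eq k,
    fun c => ⟨U.memLp_component hL k ht c, U.integral_component hL k ht c,
      U.integral_norm_sq_component hL k ht c⟩,
    fun _ _ hc => U.integral_component_mul_conj hL k ht hc,
    U.integral_norm_sq_totalNoise hL k ht, U.sinr_eq_sinrFormula hM hL k ht,
    U.logb_le_mutualInfoBits hM hL k ht⟩, TRMRC.isAchievable_infoRate U hM hL⟩
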